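/- Let $N>1$ be an integer. A generalized ring is a commutative algebraic monad $M$ on the category of sets (determined by the sets $M(\mathbf n)$, $n\ge 0$, with their units and substitution operations); its modules are the algebras of the monad. A prime ideal of $M$ is an $M$-submodule of $M(\mathbf 1)$ whose complement is a multiplicative system, and $\operatorname{Spec} M$ is the space of prime ideals with the Zariski topology and the sheaf of generalized rings determined by $D_m\mapsto M[m^{-1}]$, $m\in M(\mathbf 1)$. A commutative ring $R$ is regarded as the generalized ring $\mathbf n\mapsto R^n$. Let $A_N$ be the generalized ring $A_N(\mathbf n)=\{\lambda\in\mathbb Z[N^{-1}]^n:\sum_i|\lambda_i|\le 1\}$, and let $$X=\widehat{\operatorname{Spec}\mathbb Z^N}=\operatorname{Spec}A_N\coprod_{\operatorname{Spec}\mathbb Z[N^{-1}]}\operatorname{Spec}\mathbb Z$$ be the generalized scheme obtained by gluing along the common open subset $\operatorname{Spec}\mathbb Z[N^{-1}]$. A vector bundle of rank $r$ on $X$ is a sheaf of $\mathcal O_X$-modules that is locally isomorphic to $\mathcal O_X(\mathbf r)$; a line bundle is a vector bundle of rank $1$; $\operatorname{Pic}(X)$ is the set of isomorphism classes of line bundles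 with the operation given by the tensor product of $\mathcal O_X$-modules (the target of the universal bilinear map). For $r\ge 0$ let $\mathrm{Oct}_r\subset \mathrm{GL}_r(\mathbb Z[N^{-1}])$ be the group of linear symmetries of the octahedron $\{x\in\mathbb R^r:\sum_i|x_i|\le1\}$. Say that $A=(a_{ij})\in \mathrm{GL}_r(\mathbb Z[N^{-1}])$ describes a vector bundle $\mathcal E$ of rank $r$ on $X$ if there are a basis $(e_i)$ of $\mathcal E$ over $\operatorname{Spec}A_N$ and a basis $(f_j)$ of $\mathcal E$ over $\operatorname{Spec}\mathbb Z$ with $e_i=\sum_j a_{ij}f_j$ over $\operatorname{Spec}\mathbb Z[N^{-1}]$. Then for every $r$ there is a bijection from the set of isomorphism classes of vector bundles of rank $r$ on $X$ to the set of double cosets $$\mathrm{Oct}_r\backslash \mathrm{GL}_r(\mathbb Z[N^{-1}])/\mathrm{GL}_r(\mathbb Z),$$ under which the class of $\mathcal E$ corresponds to the double coset of $A$ if and only if $A$ describes $\mathcal E$. In particular, any two line bundles on $X$ have a tensor product, which is again a line bundle, the tensor product makes $\operatorname{Pic}(X)$ an abelian group, and $$\operatorname{Pic}(X)\cong\{\pm1\}\backslash\mathbb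 Z[N^{-1}]^*/\{\pm1\}\cong\log\mathbb Z[N^{-1}]^*_+,$$ where $\log\mathbb Z[N^{-1}]^*_+$ is the multiplicative group of positive units of $\mathbb Z[N^{-1}]$ written additively: the first bijection sends a line bundle to the double coset of any unit $\lambda$ that describes it, the second sends the double coset of $\lambda$ to $\log|\lambda|$, and the composite is an isomorphism of groups. -/

import Mathlib

open TopologicalSpace

noncomputable section

/-! ### Generalized rings (commutative algebraic monads on sets) -/

/-- A generalized ring, i.e. a commutative algebraic monad `M` on the category of sets.
An algebraic monad commutes with filtered colimits, hence is the same thing as its values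
`M(𝐧)` on the finite sets `𝐧 = Fin n` (`op n`), the unit `𝐧 → M(𝐧)` (`var`) and the
Kleisli composition `M(𝐧) × M(𝐦)ⁿ → M(𝐦)` (`subst`), subject to the monad laws.
The axiom `comm` says that any two operations commute. -/
structure GenRing where
  op : ℕ → Type
  var : {n : ℕ} → Fin n → op n
  subst : {n m : ℕ} → op n → (Fin n → op m) → op m
  var_subst : ∀ {n m : ℕ} (i : Fin n) (x : Fin n → op m), subst (var i) x = x i
  subst_var : ∀ {n : ℕ} (t : op n), subst t var = t
  subst_assoc : ∀ {n m k : ℕ} (t : op n) (x : Fin n → op m) (y : Fin m → op k),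
    subst (subst t x) y = subst t (fun i => subst (x i) y)
  comm : ∀ {n m k : ℕ} (t : op n) (s : op m) (x : Fin n → Fin m → op k),
    subst t (fun i => subst s (x i)) = subst s (fun j => subst t (fun i => x i j))

namespace GenRing

/-- Morphisms of generalized rings (morphisms of monads). -/
structure Hom (M M' : GenRing) where
  app : {n : ℕ} → M.op n → M'.op n
  map_var : ∀ {n : ℕ} (i : Fin n), app (M.var i) = M'.var i
  map_subst : ∀ {n m : ℕ} (t : M.op n) (x : Fin n → M.op m),
    app (M.subst t x) = M'.subst (app t) (fun i => app (x i))

/-- Modules over a generalized ring: algebras `M(X) → X` of the monad, given by the action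
`M(𝐧) × Xⁿ → X` of the `n`-ary operations. -/
structure ModuleStr (M : GenRing) (X : Type) where
  act : {n : ℕ} → M.op n → (Fin n → X) → X
  var_act : ∀ {n : ℕ} (i : Fin n) (x : Fin n → X), act (M.var i) x = x i
  act_assoc : ∀ {n m : ℕ} (t : M.op n) (s : Fin n → M.op m) (x : Fin m → X),
    act (M.subst t s) x = act t (fun i => act (s i) x)

/-- The generalized ring `M_R`, `M_R(𝐧) = Rⁿ`, of a commutative ring `R`. -/
def ofRing (R : Type) [CommRing R] : GenRing where
  op n := Fin n → R
  var i := Pi.single i 1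
  subst t x := fun j => ∑ i, t i * x i j
  var_subst i x := by ext j; simp [Pi.single_apply]
  subst_var t := by ext j; simp [Pi.single_apply]
  subst_assoc t x y := by
    ext j
    simp only [Finset.sum_mul, Finset.mul_sum]
    rw [Finset.sum_comm]
    simp only [mul_assoc]
  comm t s x := by
    ext j
    simp only [Finset.mul_sum]
    rw [Finset.sum_comm]
    simp only [mul_left_comm]

/-- The morphism `M_R → M_R'` induced by a ring homomorphism. -/
def ofRingHom {R R' : Type} [CommRing R] [CommRing R'] (f : R →+* R') :
    Hom (ofRing R) (ofRing R') where
  app t := fun i => f (t i)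
  map_var i := by
    funext j
    simp [ofRing, Pi.single_apply, apply_ite f]
  map_subst t x := by
    funext j
    simp [ofRing]

variable (M : GenRing)

/-- The multiplicative monoid `M(𝟏)`. -/
instance : CommMonoid (M.op 1) where
  one := M.var 0
  mul a b := M.subst a (fun _ => b)
  mul_assoc a b c := M.subst_assoc a (fun _ => b) (fun _ => c)
  one_mul a := M.var_subst 0 (fun _ => a)
  mul_one a := by
    have h : (fun _ : Fin 1 => M.var (0 : Fin 1)) = M.var := by
      funext i; rw [Subsingleton.elim i 0]
    change M.subst a (fun _ => M.var 0) = a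
    rw [h, M.subst_var]
  mul_comm a b := by
    have h : (fun _ : Fin 1 => M.var (0 : Fin 1)) = M.var := by
      funext i; rw [Subsingleton.elim i 0]
    have := M.comm a b (fun _ _ => M.var (0 : Fin 1))
    rw [h, M.subst_var, M.subst_var] at this
    exact this

/-- The action of `M(𝟏)` on `M(𝐧)`. -/
def scale {n : ℕ} (a : M.op 1) (t : M.op n) : M.op n := M.subst a (fun _ => t)

variable {M}

lemma one_scale {n : ℕ} (t : M.op n) : M.scale 1 t = t := M.var_subst 0 (fun _ => t)

lemma mul_scale {n : ℕ} (a b : M.op 1) (t : M.op n) :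
    M.scale (a * b) t = M.scale a (M.scale b t) :=
  M.subst_assoc a (fun _ => b) (fun _ => t)

lemma scale_subst_left {n m : ℕ} (c : M.op 1) (a : M.op n) (b : Fin n → M.op m) :
    M.scale c (M.subst a b) = M.subst (M.scale c a) b :=
  (M.subst_assoc c (fun _ => a) b).symm

lemma scale_subst_right {n m : ℕ} (c : M.op 1) (a : M.op n) (b : Fin n → M.op m) :
    M.scale c (M.subst a b) = M.subst a (fun i => M.scale c (b i)) :=
  M.comm c a (fun _ => b)

lemma mul_scale_subst {n m : ℕ} (c d : M.op 1) (a : M.op n) (b : Fin n → M.op m) :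
    M.scale (c * d) (M.subst a b) = M.subst (M.scale c a) (fun i => M.scale d (b i)) := by
  rw [mul_scale, scale_subst_right, scale_subst_left]

lemma Hom.map_one {M' : GenRing} (f : Hom M M') : f.app (1 : M.op 1) = 1 := f.map_var 0

lemma Hom.map_mul {M' : GenRing} (f : Hom M M') (a b : M.op 1) :
    f.app (a * b) = f.app a * f.app b := f.map_subst a (fun _ => b)

lemma Hom.map_scale {M' : GenRing} (f : Hom M M') {n : ℕ} (a : M.op 1) (t : M.op n) :
    f.app (M.scale a t) = M'.scale (f.app a) (f.app t) := f.map_subst a (fun _ => t)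

/-! ### Localization -/

/-- Equality of fractions: `(a, s) ∼ (b, t)` iff `u t a = u s b` for some `u ∈ S`. -/
def fracSetoid (M : GenRing) (S : Submonoid (M.op 1)) (n : ℕ) : Setoid (M.op n × S) where
  r p q := ∃ u : S, M.scale (u * q.2 : M.op 1) p.1 = M.scale (u * p.2 : M.op 1) q.1
  iseqv :=
    { refl := fun _ => ⟨1, rfl⟩
      symm := fun ⟨u, h⟩ => ⟨u, h.symm⟩
      trans := by
        rintro ⟨a, s⟩ ⟨b, t⟩ ⟨c, r⟩ ⟨u, h⟩ ⟨v, k⟩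
        refine ⟨u * v * t, ?_⟩
        dsimp only at h k ⊢
        have h' := congrArg (M.scale (v * r : M.op 1)) h
        have k' := congrArg (M.scale (u * s : M.op 1)) k
        simp only [← mul_scale] at h' k'
        push_cast
        rw [show (u * v * t * r : M.op 1) = v * r * (u * t) by ac_rfl, h',
          show (v * r * (u * s) : M.op 1) = u * s * (v * r) by ac_rfl, k']
        congr 1
        ac_rfl }

/-- `M[S⁻¹](𝐧)`. -/
def Frac (M : GenRing) (S : Submonoid (M.op 1)) (n : ℕ) : Type := Quotient (fracSetoid M S n)

/-- The fraction `a / s`. -/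
def frac {S : Submonoid (M.op 1)} {n : ℕ} (a : M.op n) (s : S) : Frac M S n :=
  Quotient.mk (fracSetoid M S n) (a, s)

section
variable {S : Submonoid (M.op 1)}

lemma frac_eq {n : ℕ} {a b : M.op n} {s t : S} :
    frac a s = frac b t ↔
      ∃ u : S, M.scale (u * t : M.op 1) a = M.scale (u * s : M.op 1) b :=
  Quotient.eq (r := fracSetoid M S n)

lemma frac_scale {n : ℕ} (c : S) (a : M.op n) (s : S) :
    frac (M.scale c a) (c * s) = frac a s := by
  rw [frac_eq]
  refine ⟨1, ?_⟩
  rw [← mul_scale]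
  congr 1
  push_cast
  ac_rfl

lemma exists_frac {n : ℕ} (q : Frac M S n) : ∃ (a : M.op n) (s : S), q = frac a s := by
  induction q using Quotient.inductionOn with
  | h p => exact ⟨p.1, p.2, rfl⟩

/-- Finitely many fractions have a common denominator. -/
lemma exists_common {n m : ℕ} (x : Fin n → Frac M S m) :
    ∃ (b : Fin n → M.op m) (t : S), x = fun i => frac (b i) t := by
  choose a s h using fun i => exists_frac (x i)
  refine ⟨fun i => M.scale ((∏ j ∈ Finset.univ.erase i, s j : S) : M.op 1) (a i),
    ∏ j, s j, funext fun i => ?_⟩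
  rw [h i, ← Finset.prod_erase_mul Finset.univ s (Finset.mem_univ i), frac_scale]

/-- Substitution of fractions, `(a/s)(b₁/t, …, bₙ/t) = a(b₁, …, bₙ)/(s t)`. -/
def fracSubst {n m : ℕ} (q : Frac M S n) (x : Fin n → Frac M S m) : Frac M S m :=
  frac (M.subst (exists_frac q).choose (exists_common x).choose)
    ((exists_frac q).choose_spec.choose * (exists_common x).choose_spec.choose)

lemma fracSubst_frac {n m : ℕ} (a : M.op n) (s : S) (b : Fin n → M.op m) (t : S) :
    fracSubst (frac a s) (fun i => frac (b i) t) = frac (M.subst a b) (s * t) := by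
  unfold fracSubst
  have h1 := (exists_frac (frac a s)).choose_spec.choose_spec
  have h2 := (exists_common (fun i => frac (b i) t)).choose_spec.choose_spec
  generalize (exists_frac (frac a s)).choose_spec.choose = s' at *
  generalize (exists_frac (frac a s)).choose = a' at *
  generalize (exists_common (fun i => frac (b i) t)).choose_spec.choose = t' at *
  generalize (exists_common (fun i => frac (b i) t)).choose = b' at *
  obtain ⟨u, hu⟩ := frac_eq.1 h1
  choose v hv using fun i => frac_eq.1 (congrFun h2 i)
  have hw : ∀ i, M.scale ((∏ j, v j : S) * t' : M.op 1) (b i) =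
      M.scale ((∏ j, v j : S) * t : M.op 1) (b' i) := by
    intro i
    have := congrArg (M.scale ((∏ j ∈ Finset.univ.erase i, v j : S) : M.op 1)) (hv i)
    rw [← mul_scale, ← mul_scale, ← mul_assoc, ← mul_assoc] at this
    rw [← Finset.prod_erase_mul Finset.univ v (Finset.mem_univ i)]
    exact this
  symm
  rw [frac_eq]
  refine ⟨u * ∏ j, v j, ?_⟩
  rw [show ((u * ∏ j, v j : S) * (s' * t' : S) : M.op 1) = (u * s') * ((∏ j, v j : S) * t') by
      push_cast; ac_rfl,
    show ((u * ∏ j, v j : S) * (s * t : S) : M.op 1) = (u * s) * ((∏ j, v j : S) * t) by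
      push_cast; ac_rfl, mul_scale_subst, mul_scale_subst, hu]
  congr 1
  exact funext hw

end

/-- The localization `M[S⁻¹]`. -/
def localization (M : GenRing) (S : Submonoid (M.op 1)) : GenRing where
  op := Frac M S
  var i := frac (M.var i) 1
  subst := fracSubst
  var_subst i x := by
    obtain ⟨b, t, rfl⟩ := exists_common x
    rw [fracSubst_frac, M.var_subst, one_mul]
  subst_var q := by
    obtain ⟨a, s, rfl⟩ := exists_frac q
    rw [fracSubst_frac, mul_one]
    exact congrArg (frac · s) (M.subst_var a)
  subst_assoc q x y := by
    obtain ⟨a, s, rfl⟩ := exists_frac q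
    obtain ⟨b, t, rfl⟩ := exists_common x
    obtain ⟨c, r, rfl⟩ := exists_common y
    simp only [fracSubst_frac, M.subst_assoc, mul_assoc]
  comm {n m k} q p x := by
    obtain ⟨a, s, rfl⟩ := exists_frac q
    obtain ⟨c, r, rfl⟩ := exists_frac p
    obtain ⟨b, t, h⟩ := exists_common (fun i : Fin (n * m) =>
      x (finProdFinEquiv.symm i).1 (finProdFinEquiv.symm i).2)
    obtain rfl : x = fun i j => frac (b (finProdFinEquiv (i, j))) t := by
      funext i j
      have := congrFun h (finProdFinEquiv (i, j))
      simpa using this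
    simp only [fracSubst_frac, M.comm a c]
    rw [mul_left_comm]

/-- A morphism `f : M → M'` with `f(S) ⊆ S'` induces `M[S⁻¹] → M'[S'⁻¹]`. -/
def Hom.localize {M' : GenRing} (f : Hom M M') (S : Submonoid (M.op 1))
    (S' : Submonoid (M'.op 1)) (h : ∀ s ∈ S, f.app s ∈ S') :
    Hom (M.localization S) (M'.localization S') where
  app {n} := Quotient.map' (s₁ := fracSetoid M S n) (s₂ := fracSetoid M' S' n)
    (fun p => (f.app p.1, ⟨f.app p.2, h _ p.2.2⟩)) (by
      rintro ⟨a, s⟩ ⟨b, t⟩ ⟨u, hu⟩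
      refine ⟨⟨f.app u, h _ u.2⟩, ?_⟩
      have := congrArg f.app hu
      simpa only [f.map_scale, f.map_mul] using this)
  map_var i := by
    change frac (f.app (M.var i)) (⟨f.app (1 : M.op 1), _⟩ : S') = frac (M'.var i) 1
    rw [f.map_var]
    exact congrArg (frac _) (Subtype.ext f.map_one)
  map_subst q x := by
    obtain ⟨a, s, rfl⟩ := exists_frac q
    obtain ⟨b, t, rfl⟩ := exists_common x
    change Quotient.map' _ _ (fracSubst _ _) =
      fracSubst (frac (f.app a) (⟨f.app s, h _ s.2⟩ : S'))
        (fun i => frac (f.app (b i)) (⟨f.app t, h _ t.2⟩ : S'))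
    rw [fracSubst_frac, fracSubst_frac]
    change frac (f.app (M.subst a b)) (⟨f.app (s * t : M.op 1), _⟩ : S') = _
    rw [f.map_subst]
    exact congrArg (frac _) (Subtype.ext (f.map_mul _ _))

/-! ### The prime spectrum -/

/-- Prime ideals of `M`: `M`-submodules of `M(𝟏)` whose complement is a multiplicative
system. -/
@[ext]
structure PrimeSpec (M : GenRing) where
  carrier : Set (M.op 1)
  subst_mem : ∀ {n : ℕ} (t : M.op n) (x : Fin n → M.op 1),
    (∀ i, x i ∈ carrier) → M.subst t x ∈ carrier
  one_notMem : (1 : M.op 1) ∉ carrier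
  mul_notMem : ∀ a b : M.op 1, a ∉ carrier → b ∉ carrier → a * b ∉ carrier

namespace PrimeSpec

/-- The multiplicative system `M(𝟏) ∖ 𝔭`. -/
def compl (p : PrimeSpec M) : Submonoid (M.op 1) where
  carrier := p.carrierᶜ
  one_mem' := p.one_notMem
  mul_mem' ha hb := p.mul_notMem _ _ ha hb

/-- The basic open set `D_m`. -/
def basicOpen (m : M.op 1) : Set (PrimeSpec M) := {p | m ∉ p.carrier}

/-- The Zariski topology. -/
instance : TopologicalSpace (PrimeSpec M) := generateFrom (Set.range basicOpen)

/-- The map `Spec M' → Spec M` induced by `f : M → M'`. -/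
def comap {M' : GenRing} (f : Hom M M') (p : PrimeSpec M') : PrimeSpec M where
  carrier := {a | f.app a ∈ p.carrier}
  subst_mem t x hx := by
    change f.app (M.subst t x) ∈ p.carrier
    rw [f.map_subst]
    exact p.subst_mem _ _ hx
  one_notMem := by
    change f.app (1 : M.op 1) ∉ p.carrier
    rw [f.map_one]
    exact p.one_notMem
  mul_notMem a b ha hb := by
    change f.app (a * b) ∉ p.carrier
    rw [f.map_mul]
    exact p.mul_notMem _ _ ha hb

/-- The stalk `M_𝔭`. -/
def stalk (p : PrimeSpec M) : GenRing := M.localization p.compl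

/-- The map of stalks `M_{f⁻¹(𝔭)} → M'_𝔭`. -/
def stalkMap {M' : GenRing} (f : Hom M M') (p : PrimeSpec M') :
    Hom (comap f p).stalk p.stalk :=
  f.localize _ _ (fun _ hs => hs)

/-- A family of germs is a regular section if locally it is given by a single fraction `a/f`. -/
def IsRegular {n : ℕ} (U : Set (PrimeSpec M)) (s : (x : U) → x.1.stalk.op n) : Prop :=
  ∀ x : U, ∃ V : Set (PrimeSpec M), IsOpen V ∧ x.1 ∈ V ∧ V ⊆ U ∧
    ∃ (a : M.op n) (f : M.op 1), ∀ y : U, y.1 ∈ V →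
      ∃ hf : f ∈ y.1.compl, s y = frac a ⟨f, hf⟩

/-- The generalized ring `𝒪_{Spec M}(U)`: families of germs which are locally fractions.
It is the sheaf with `𝒪(D_m) = M[m⁻¹]`. -/
def sections (U : Set (PrimeSpec M)) (hU : IsOpen U) : GenRing where
  op n := {s : (x : U) → x.1.stalk.op n // IsRegular U s}
  var i := ⟨fun x => x.1.stalk.var i, fun x =>
    ⟨U, hU, x.2, subset_rfl, M.var i, 1, fun y _ => ⟨y.1.compl.one_mem, rfl⟩⟩⟩
  subst t x := ⟨fun y => y.1.stalk.subst (t.1 y) (fun i => (x i).1 y), fun p => by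
    obtain ⟨V, hV, hpV, hVU, a, f, ha⟩ := t.2 p
    choose W hW hpW hWU b g hb using fun i => (x i).2 p
    refine ⟨V ∩ ⋂ i, W i, hV.inter (isOpen_iInter_of_finite hW),
      ⟨hpV, Set.mem_iInter.2 hpW⟩, fun q hq => hVU hq.1,
      M.subst a (fun i => M.scale (∏ j ∈ Finset.univ.erase i, g j) (b i)),
      f * ∏ j, g j, fun y hy => ?_⟩
    obtain ⟨hf, h1⟩ := ha y hy.1
    choose hg h2 using fun i => hb i y (Set.mem_iInter.1 hy.2 i)
    have hgp : ∀ s : Finset _, ∏ j ∈ s, g j ∈ y.1.compl :=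
      fun s => Submonoid.prod_mem _ fun j _ => hg j
    refine ⟨Submonoid.mul_mem _ hf (hgp _), ?_⟩
    have h3 : (fun i => (x i).1 y) = fun i =>
        frac (M.scale (∏ j ∈ Finset.univ.erase i, g j) (b i))
          (⟨∏ j, g j, hgp _⟩ : y.1.compl) := by
      funext i
      rw [h2 i, ← frac_scale (⟨_, hgp (Finset.univ.erase i)⟩ : y.1.compl)]
      exact congrArg (frac _)
        (Subtype.ext (Finset.prod_erase_mul Finset.univ g (Finset.mem_univ i)))
    change fracSubst (t.1 y) (fun i => (x i).1 y) = _
    rw [h1, h3]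
    exact fracSubst_frac _ _ _ _⟩
  var_subst i x := Subtype.ext (funext fun y => y.1.stalk.var_subst i _)
  subst_var t := Subtype.ext (funext fun y => y.1.stalk.subst_var _)
  subst_assoc t x z := Subtype.ext (funext fun y => y.1.stalk.subst_assoc _ _ _)
  comm t s x := Subtype.ext (funext fun y => y.1.stalk.comm _ _ _)

end PrimeSpec

end GenRing

/-! ### Generalized ringed spaces, sheaves of modules, vector bundles -/

/-- A topological space with a sheaf of generalized rings. -/
structure GenRingedSpace where
  carrier : Type
  [top : TopologicalSpace carrier]
  O : Opens carrier → GenRing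
  res : {U V : Opens carrier} → U ≤ V → GenRing.Hom (O V) (O U)
  res_self : ∀ {U : Opens carrier} {n : ℕ} (s : (O U).op n), (res le_rfl).app s = s
  res_res : ∀ {U V W : Opens carrier} (h : U ≤ V) (k : V ≤ W) {n : ℕ} (s : (O W).op n),
    (res h).app ((res k).app s) = (res (h.trans k)).app s
  glue : ∀ {n : ℕ} {ι : Type} (U : ι → Opens carrier) (s : (i : ι) → (O (U i)).op n),
    (∀ i j, (res (inf_le_left : U i ⊓ U j ≤ U i)).app (s i) =
      (res (inf_le_right : U i ⊓ U j ≤ U j)).app (s j)) →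
    ∃! t : (O (⨆ i, U i)).op n, ∀ i, (res (le_iSup U i)).app t = s i

attribute [instance] GenRingedSpace.top

/-- A sheaf of `𝒪_X`-modules. -/
structure OModule (X : GenRingedSpace) where
  obj : Opens X.carrier → Type
  str : (U : Opens X.carrier) → (X.O U).ModuleStr (obj U)
  res : {U V : Opens X.carrier} → U ≤ V → obj V → obj U
  res_self : ∀ {U : Opens X.carrier} (s : obj U), res le_rfl s = s
  res_res : ∀ {U V W : Opens X.carrier} (h : U ≤ V) (k : V ≤ W) (s : obj W),
    res h (res k s) = res (h.trans k) s
  res_act : ∀ {U V : Opens X.carrier} (h : U ≤ V) {n : ℕ} (t : (X.O V).op n)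
    (x : Fin n → obj V), res h ((str V).act t x) =
      (str U).act ((X.res h).app t) (fun i => res h (x i))
  glue : ∀ {ι : Type} (U : ι → Opens X.carrier) (s : (i : ι) → obj (U i)),
    (∀ i j, res (inf_le_left : U i ⊓ U j ≤ U i) (s i) =
      res (inf_le_right : U i ⊓ U j ≤ U j) (s j)) →
    ∃! t : obj (⨆ i, U i), ∀ i, res (le_iSup U i) t = s i

namespace OModule

variable {X : GenRingedSpace}

/-- Morphisms of sheaves of `𝒪_X`-modules. -/
structure Hom (E F : OModule X) where
  app : (U : Opens X.carrier) → E.obj U → F.obj U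
  naturality : ∀ {U V : Opens X.carrier} (h : U ≤ V) (s : E.obj V),
    app U (E.res h s) = F.res h (app V s)
  map_act : ∀ (U : Opens X.carrier) {n : ℕ} (t : (X.O U).op n) (x : Fin n → E.obj U),
    app U ((E.str U).act t x) = (F.str U).act t (fun i => app U (x i))

/-- `E` and `F` are isomorphic as sheaves of `𝒪_X`-modules. -/
def IsIsoTo (E F : OModule X) : Prop :=
  ∃ (f : Hom E F) (g : Hom F E), (∀ U s, g.app U (f.app U s) = s) ∧
    ∀ U s, f.app U (g.app U s) = s

/-- An isomorphism `𝒪_{X|U}(𝐫) ≃ E|_U` of `𝒪_{X|U}`-modules. -/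
structure Trivialization (E : OModule X) (U : Opens X.carrier) (r : ℕ) where
  equiv : (V : Opens X.carrier) → V ≤ U → (X.O V).op r ≃ E.obj V
  naturality : ∀ {V W : Opens X.carrier} (h : V ≤ W) (hW : W ≤ U) (s : (X.O W).op r),
    equiv V (h.trans hW) ((X.res h).app s) = E.res h (equiv W hW s)
  map_act : ∀ (V : Opens X.carrier) (hV : V ≤ U) {n : ℕ} (t : (X.O V).op n)
    (x : Fin n → (X.O V).op r),
    equiv V hV ((X.O V).subst t x) = (E.str V).act t (fun i => equiv V hV (x i))

/-- The basis of `E(U)` defined by a trivialization. -/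
def Trivialization.basis {E : OModule X} {U : Opens X.carrier} {r : ℕ}
    (τ : Trivialization E U r) (i : Fin r) : E.obj U :=
  τ.equiv U le_rfl ((X.O U).var i)

/-- `E` is a vector bundle of rank `r`. -/
def IsVectorBundle (E : OModule X) (r : ℕ) : Prop :=
  ∀ x : X.carrier, ∃ U : Opens X.carrier, x ∈ U ∧ Nonempty (Trivialization E U r)

/-- Bilinear maps `E × F → G` of sheaves of `𝒪_X`-modules. -/
structure Bilin (E F G : OModule X) where
  app : (U : Opens X.carrier) → E.obj U → F.obj U → G.obj U
  naturality : ∀ {U V : Opens X.carrier} (h : U ≤ V) (s : E.obj V) (t : F.obj V),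
    app U (E.res h s) (F.res h t) = G.res h (app V s t)
  map_act_left : ∀ (U : Opens X.carrier) {n : ℕ} (a : (X.O U).op n) (x : Fin n → E.obj U)
    (y : F.obj U), app U ((E.str U).act a x) y = (G.str U).act a (fun i => app U (x i) y)
  map_act_right : ∀ (U : Opens X.carrier) {n : ℕ} (a : (X.O U).op n) (x : E.obj U)
    (y : Fin n → F.obj U), app U x ((F.str U).act a y) = (G.str U).act a (fun i => app U x (y i))

/-- `T` is a tensor product of `E` and `F`: there is a universal bilinear map `E × F → T`. -/
def IsTensorProduct (E F T : OModule X) : Prop :=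
  ∃ β : Bilin E F T, ∀ (G : OModule X) (γ : Bilin E F G),
    ∃! f : Hom T G, ∀ U x y, f.app U (β.app U x y) = γ.app U x y

lemma IsIsoTo.refl (E : OModule X) : IsIsoTo E E :=
  ⟨⟨fun _ s => s, fun _ _ => rfl, fun _ _ _ _ => rfl⟩,
    ⟨fun _ s => s, fun _ _ => rfl, fun _ _ _ _ => rfl⟩, fun _ _ => rfl, fun _ _ => rfl⟩

lemma IsIsoTo.symm {E F : OModule X} (h : IsIsoTo E F) : IsIsoTo F E := by
  obtain ⟨f, g, h1, h2⟩ := h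
  exact ⟨g, f, h2, h1⟩

lemma IsIsoTo.trans {E F G : OModule X} (h : IsIsoTo E F) (k : IsIsoTo F G) :
    IsIsoTo E G := by
  obtain ⟨f, g, h1, h2⟩ := h
  obtain ⟨f', g', h1', h2'⟩ := k
  exact ⟨⟨fun U s => f'.app U (f.app U s), fun h s => by rw [f.naturality, f'.naturality],
      fun U _ t x => by rw [f.map_act, f'.map_act]⟩,
    ⟨fun U s => g.app U (g'.app U s), fun h s => by rw [g'.naturality, g.naturality],
      fun U _ t x => by rw [g'.map_act, g.map_act]⟩,
    fun U s => by simp only [h1', h1], fun U s => by simp only [h2, h2']⟩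

end OModule

/-- Vector bundles of rank `r` on `X`. -/
def GenVectorBundle (X : GenRingedSpace) (r : ℕ) : Type 1 :=
  {E : OModule X // E.IsVectorBundle r}

/-- Isomorphism of vector bundles. -/
instance GenVectorBundle.setoid (X : GenRingedSpace) (r : ℕ) : Setoid (GenVectorBundle X r) where
  r E F := E.1.IsIsoTo F.1
  iseqv := ⟨fun E => .refl E.1, .symm, .trans⟩

/-- The set of isomorphism classes of vector bundles of rank `r` on `X`. -/
def GenVectorBundleClass (X : GenRingedSpace) (r : ℕ) : Type 1 :=
  Quotient (GenVectorBundle.setoid X r)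

/-- The isomorphism class of a vector bundle. -/
def GenVectorBundle.cls {X : GenRingedSpace} {r : ℕ} (E : GenVectorBundle X r) :
    GenVectorBundleClass X r :=
  Quotient.mk _ E

/-- The set underlying `Pic X`: isomorphism classes of line bundles. -/
abbrev Pic (X : GenRingedSpace) : Type 1 := GenVectorBundleClass X 1

/-! ### Gluing two spectra -/

section Glue

open GenRing PrimeSpec

variable {A B C : GenRing} (φ : Hom A B) (ψ : Hom C B)

/-- The topological pushout `Spec A ⊔_{Spec B} Spec C`. -/
def GluedSpec : Type :=
  Quot (fun a b : PrimeSpec A ⊕ PrimeSpec C =>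
    ∃ y : PrimeSpec B, a = .inl (comap φ y) ∧ b = .inr (comap ψ y))

instance : TopologicalSpace (GluedSpec φ ψ) :=
  inferInstanceAs (TopologicalSpace (Quot _))

namespace GluedSpec

/-- The map `Spec A → Spec A ⊔_{Spec B} Spec C`. -/
def inl (x : PrimeSpec A) : GluedSpec φ ψ := Quot.mk _ (.inl x)

/-- The map `Spec C → Spec A ⊔_{Spec B} Spec C`. -/
def inr (x : PrimeSpec C) : GluedSpec φ ψ := Quot.mk _ (.inr x)

lemma inl_comap (y : PrimeSpec B) : inl φ ψ (comap φ y) = inr φ ψ (comap ψ y) :=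
  Quot.sound ⟨y, rfl, rfl⟩

lemma continuous_inl : Continuous (inl φ ψ) := continuous_quot_mk.comp _root_.continuous_inl

lemma continuous_inr : Continuous (inr φ ψ) := continuous_quot_mk.comp _root_.continuous_inr

variable {φ ψ}

/-- `(s, t)` has the same image in `𝒪_{Spec B}`. -/
def Agree {n : ℕ} (U : Set (GluedSpec φ ψ))
    (s : (x : inl φ ψ ⁻¹' U) → x.1.stalk.op n) (t : (x : inr φ ψ ⁻¹' U) → x.1.stalk.op n) :
    Prop :=
  ∀ (y : PrimeSpec B) (h : inl φ ψ (comap φ y) ∈ U) (k : inr φ ψ (comap ψ y) ∈ U),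
    (stalkMap φ y).app (s ⟨comap φ y, h⟩) = (stalkMap ψ y).app (t ⟨comap ψ y, k⟩)

/-- The generalized ring `𝒪(U) = 𝒪_{Spec A}(U) ×_{𝒪_{Spec B}(U)} 𝒪_{Spec C}(U)` of pairs of
sections agreeing on `Spec B`, for `U` open in `Spec A ⊔_{Spec B} Spec C`. -/
def sections (U : Opens (GluedSpec φ ψ)) : GenRing where
  op n := {p : (PrimeSpec.sections (inl φ ψ ⁻¹' U) (U.2.preimage (continuous_inl φ ψ))).op n ×
      (PrimeSpec.sections (inr φ ψ ⁻¹' U) (U.2.preimage (continuous_inr φ ψ))).op n //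
    Agree (U : Set (GluedSpec φ ψ)) p.1.1 p.2.1}
  var i := ⟨(GenRing.var _ i, GenRing.var _ i), fun y _ _ =>
    ((stalkMap φ y).map_var i).trans ((stalkMap ψ y).map_var i).symm⟩
  subst t x := ⟨(GenRing.subst _ t.1.1 (fun i => (x i).1.1),
    GenRing.subst _ t.1.2 (fun i => (x i).1.2)), fun y h k => by
      refine ((stalkMap φ y).map_subst _ _).trans (Eq.trans ?_ ((stalkMap ψ y).map_subst _ _).symm)
      rw [t.2 y h k]
      exact congrArg _ (funext fun i => (x i).2 y h k)⟩
  var_subst i x := Subtype.ext (Prod.ext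
    (GenRing.var_subst _ i (fun i => (x i).1.1)) (GenRing.var_subst _ i (fun i => (x i).1.2)))
  subst_var t := Subtype.ext (Prod.ext (GenRing.subst_var _ t.1.1) (GenRing.subst_var _ t.1.2))
  subst_assoc t x z := Subtype.ext (Prod.ext
    (GenRing.subst_assoc _ t.1.1 (fun i => (x i).1.1) (fun i => (z i).1.1))
    (GenRing.subst_assoc _ t.1.2 (fun i => (x i).1.2) (fun i => (z i).1.2)))
  comm t s x := Subtype.ext (Prod.ext
    (GenRing.comm _ t.1.1 s.1.1 (fun i j => (x i j).1.1))
    (GenRing.comm _ t.1.2 s.1.2 (fun i j => (x i j).1.2)))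

/-- Restriction of a regular section. -/
lemma _root_.GenRing.PrimeSpec.IsRegular.restrict {M : GenRing} {n : ℕ} {U V : Set (PrimeSpec M)}
    (hU : IsOpen U) (h : U ⊆ V) {s : (x : V) → x.1.stalk.op n} (hs : IsRegular V s) :
    IsRegular U (fun x => s ⟨x.1, h x.2⟩) := fun x => by
  obtain ⟨W, hW, hx, hWV, a, f, ha⟩ := hs ⟨x.1, h x.2⟩
  exact ⟨W ∩ U, hW.inter hU, ⟨hx, x.2⟩, Set.inter_subset_right, a, f,
    fun y hy => ha ⟨y.1, h y.2⟩ hy.1⟩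

/-- Restriction of sections. -/
def res {U V : Opens (GluedSpec φ ψ)} (h : U ≤ V) : Hom (sections V) (sections U) where
  app p := ⟨(⟨fun x => p.1.1.1 ⟨x.1, h x.2⟩,
      p.1.1.2.restrict (U.2.preimage (continuous_inl φ ψ)) (fun _ hx => h hx)⟩,
    ⟨fun x => p.1.2.1 ⟨x.1, h x.2⟩,
      p.1.2.2.restrict (U.2.preimage (continuous_inr φ ψ)) (fun _ hx => h hx)⟩),
    fun y hy hy' => p.2 y (h hy) (h hy')⟩
  map_var _ := rfl
  map_subst _ _ := rfl

/-- Regular sections glue. -/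
lemma _root_.GenRing.PrimeSpec.IsRegular.of_cover {M : GenRing} {n : ℕ} {ι : Type}
    {W : Set (PrimeSpec M)} (U : ι → Set (PrimeSpec M)) (hUW : ∀ i, U i ⊆ W)
    (hW : ∀ x ∈ W, ∃ i, x ∈ U i) (s : (x : W) → x.1.stalk.op n)
    (hs : ∀ i, IsRegular (U i) (fun x => s ⟨x.1, hUW i x.2⟩)) : IsRegular W s := fun x => by
  obtain ⟨i, hi⟩ := hW x.1 x.2
  obtain ⟨V, hV, hx, hVU, a, f, ha⟩ := hs i ⟨x.1, hi⟩
  exact ⟨V, hV, hx, hVU.trans (hUW i), a, f, fun y hy => ha ⟨y.1, hVU hy⟩ hy⟩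

lemma glue {n : ℕ} {ι : Type} (U : ι → Opens (GluedSpec φ ψ))
    (s : (i : ι) → (sections (U i)).op n)
    (hs : ∀ i j, (res (inf_le_left : U i ⊓ U j ≤ U i)).app (s i) =
      (res (inf_le_right : U i ⊓ U j ≤ U j)).app (s j)) :
    ∃! t : (sections (⨆ i, U i)).op n, ∀ i, (res (le_iSup U i)).app t = s i := by
  have hl : ∀ i j (x : PrimeSpec A) (hi : inl φ ψ x ∈ U i) (hj : inl φ ψ x ∈ U j),
      (s i).1.1.1 ⟨x, hi⟩ = (s j).1.1.1 ⟨x, hj⟩ := fun i j x hi hj =>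
    congrArg (fun p : (sections (U i ⊓ U j)).op n => p.1.1.1 ⟨x, ⟨hi, hj⟩⟩) (hs i j)
  have hr : ∀ i j (x : PrimeSpec C) (hi : inr φ ψ x ∈ U i) (hj : inr φ ψ x ∈ U j),
      (s i).1.2.1 ⟨x, hi⟩ = (s j).1.2.1 ⟨x, hj⟩ := fun i j x hi hj =>
    congrArg (fun p : (sections (U i ⊓ U j)).op n => p.1.2.1 ⟨x, ⟨hi, hj⟩⟩) (hs i j)
  have hm : ∀ z ∈ (⨆ i, U i : Opens (GluedSpec φ ψ)), ∃ i, z ∈ U i :=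
    fun z hz => Opens.mem_iSup.1 hz
  have key1 : ∀ i (x : PrimeSpec A) (hi : inl φ ψ x ∈ U i)
      (hx : inl φ ψ x ∈ (⨆ i, U i : Opens (GluedSpec φ ψ))),
      (s (hm _ hx).choose).1.1.1 ⟨x, (hm _ hx).choose_spec⟩ = (s i).1.1.1 ⟨x, hi⟩ :=
    fun i x hi hx => hl _ _ x _ _
  have key2 : ∀ i (x : PrimeSpec C) (hi : inr φ ψ x ∈ U i)
      (hx : inr φ ψ x ∈ (⨆ i, U i : Opens (GluedSpec φ ψ))),
      (s (hm _ hx).choose).1.2.1 ⟨x, (hm _ hx).choose_spec⟩ = (s i).1.2.1 ⟨x, hi⟩ :=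
    fun i x hi hx => hr _ _ x _ _
  refine ⟨⟨(⟨fun x => (s (hm _ x.2).choose).1.1.1 ⟨x.1, (hm _ x.2).choose_spec⟩, ?_⟩,
    ⟨fun x => (s (hm _ x.2).choose).1.2.1 ⟨x.1, (hm _ x.2).choose_spec⟩, ?_⟩), ?_⟩, ?_, ?_⟩
  · refine IsRegular.of_cover (fun i => inl φ ψ ⁻¹' (U i)) (fun i _ hx => le_iSup U i hx)
      (fun x hx => hm _ hx) _ (fun i => ?_)
    have := (s i).1.1.2
    convert this using 1
    funext x
    exact key1 i x.1 x.2 (le_iSup U i x.2)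
  · refine IsRegular.of_cover (fun i => inr φ ψ ⁻¹' (U i)) (fun i _ hx => le_iSup U i hx)
      (fun x hx => hm _ hx) _ (fun i => ?_)
    have := (s i).1.2.2
    convert this using 1
    funext x
    exact key2 i x.1 x.2 (le_iSup U i x.2)
  · intro y h k
    obtain ⟨i, hi⟩ := hm _ h
    have hi' : inr φ ψ (comap ψ y) ∈ U i := by rw [← inl_comap]; exact hi
    dsimp only
    rw [key1 i _ hi h, key2 i _ hi' k]
    exact (s i).2 y hi hi'
  · intro i
    refine Subtype.ext (Prod.ext (Subtype.ext (funext fun x => ?_))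
      (Subtype.ext (funext fun x => ?_)))
    · exact key1 i x.1 x.2 (le_iSup U i x.2)
    · exact key2 i x.1 x.2 (le_iSup U i x.2)
  · intro t ht
    refine Subtype.ext (Prod.ext (Subtype.ext (funext fun x => ?_))
      (Subtype.ext (funext fun x => ?_)))
    · exact congrArg (fun p : (sections (U (hm _ x.2).choose)).op n =>
        p.1.1.1 ⟨x.1, (hm _ x.2).choose_spec⟩) (ht _)
    · exact congrArg (fun p : (sections (U (hm _ x.2).choose)).op n =>
        p.1.2.1 ⟨x.1, (hm _ x.2).choose_spec⟩) (ht _)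

/-- The section `c` over `U` pulls back to the global section `b` on the preimage of `U` in
`Spec B`. -/
def PullsBackTo {U : Opens (GluedSpec φ ψ)} {n : ℕ} (c : (sections U).op n) (b : B.op n) : Prop :=
  ∀ (y : PrimeSpec B) (h : inl φ ψ (comap φ y) ∈ U),
    (stalkMap φ y).app (c.1.1.1 ⟨comap φ y, h⟩) = frac b 1

end GluedSpec

/-- The pushout of `Spec A ← Spec B → Spec C` as a generalized ringed space. -/
def gluedSpace : GenRingedSpace where
  carrier := GluedSpec φ ψ
  O := GluedSpec.sections
  res := GluedSpec.res
  res_self _ := rfl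
  res_res _ _ _ _ := rfl
  glue := GluedSpec.glue

end Glue

/-! ### The generalized scheme `Spec ℤ^N`-hat -/

/-- The ring `ℤ[N⁻¹] ⊆ ℚ`. -/
abbrev ZInv (N : ℕ) : Subalgebra ℤ ℚ := Algebra.adjoin ℤ {(N : ℚ)⁻¹}

/-- The generalized ring `A_N`, `A_N(𝐧) = {λ ∈ ℤ[N⁻¹]ⁿ ; ∑ |λ_i| ≤ 1}`, with the operations
of `ℤ[N⁻¹]`. -/
def AN (N : ℕ) : GenRing where
  op n := {l : Fin n → ZInv N // ∑ i, |l i| ≤ 1}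
  var i := ⟨Pi.single i 1, by simp [Pi.single_apply, apply_ite]⟩
  subst t x := ⟨(GenRing.ofRing (ZInv N)).subst t.1 (fun i => (x i).1), by
    calc ∑ j, |∑ i, t.1 i * (x i).1 j| ≤ ∑ j, ∑ i, |t.1 i| * |(x i).1 j| := by
          refine Finset.sum_le_sum fun j _ => (Finset.abs_sum_le_sum_abs _ _).trans ?_
          simp only [abs_mul, le_refl]
      _ = ∑ i, |t.1 i| * ∑ j, |(x i).1 j| := by
          rw [Finset.sum_comm]; simp only [Finset.mul_sum]
      _ ≤ ∑ i, |t.1 i| :=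
          Finset.sum_le_sum fun i _ => mul_le_of_le_one_right (abs_nonneg _) (x i).2
      _ ≤ 1 := t.2⟩
  var_subst i x := Subtype.ext ((GenRing.ofRing (ZInv N)).var_subst i _)
  subst_var t := Subtype.ext ((GenRing.ofRing (ZInv N)).subst_var t.1)
  subst_assoc t x y := Subtype.ext ((GenRing.ofRing (ZInv N)).subst_assoc t.1 _ _)
  comm t s x := Subtype.ext ((GenRing.ofRing (ZInv N)).comm t.1 s.1 _)

/-- The inclusion `A_N → ℤ[N⁻¹]`. -/
def ANincl (N : ℕ) : GenRing.Hom (AN N) (GenRing.ofRing (ZInv N)) where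
  app t := t.1
  map_var _ := rfl
  map_subst _ _ := rfl

/-- The inclusion `ℤ → ℤ[N⁻¹]`. -/
def Zincl (N : ℕ) : GenRing.Hom (GenRing.ofRing ℤ) (GenRing.ofRing (ZInv N)) :=
  GenRing.ofRingHom (algebraMap ℤ (ZInv N))

/-- `Spec A_N` and `Spec ℤ` glued along `Spec ℤ[N⁻¹]`. -/
def SpecZHat (N : ℕ) : GenRingedSpace := gluedSpace (ANincl N) (Zincl N)

/-- The matrix `A = (a_ij)` over `ℤ[N⁻¹]` describes `E`: there are a basis `e` of `E` over
`Spec A_N` and a basis `f` of `E` over `Spec ℤ` such that `e_i = ∑_j a_ij f_j` on the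
intersection `Spec ℤ[N⁻¹]`. -/
def Describes {N r : ℕ} (A : Matrix (Fin r) (Fin r) (ZInv N)) (E : OModule (SpecZHat N)) : Prop :=
  ∃ U V : Opens (SpecZHat N).carrier,
    (U : Set (SpecZHat N).carrier) = Set.range (GluedSpec.inl (ANincl N) (Zincl N)) ∧
    (V : Set (SpecZHat N).carrier) = Set.range (GluedSpec.inr (ANincl N) (Zincl N)) ∧
    ∃ (e : E.Trivialization U r) (f : E.Trivialization V r), ∀ i : Fin r,
      ∃ c : ((SpecZHat N).O (U ⊓ V)).op r, GluedSpec.PullsBackTo c (A i) ∧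
        E.res inf_le_left (e.basis i) =
          (E.str (U ⊓ V)).act c (fun j => E.res inf_le_right (f.basis j))

/-! ### The groups -/

/-- The `r`-octahedron in `ℝ^r`. -/
def octahedron (r : ℕ) : Set (Fin r → ℝ) := {x | ∑ i, |x i| ≤ 1}

/-- The symmetry group of the `r`-octahedron: linear automorphisms of `ℝ^r` mapping the
octahedron onto itself. -/
def octReal (r : ℕ) : Subgroup (GL (Fin r) ℝ) where
  carrier := {g | (fun x => g.1.mulVec x) '' octahedron r = octahedron r}
  one_mem' := by simp
  mul_mem' {g h} hg hh := by
    change (fun x => (g.1 * h.1).mulVec x) '' octahedron r = octahedron r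
    simp only [← Matrix.mulVec_mulVec]
    rw [← Set.image_image (fun x => g.1.mulVec x) (fun x => h.1.mulVec x), hh, hg]
  inv_mem' {g} hg := by
    change (fun x => (g⁻¹).1.mulVec x) '' octahedron r = octahedron r
    have hg' : (fun x => g.1.mulVec x) '' octahedron r = octahedron r := hg
    conv_lhs => rw [← hg']
    rw [Set.image_image]
    simp [Matrix.mulVec_mulVec]

/-- The inclusion `ℤ[N⁻¹] → ℝ`. -/
def ZInv.toReal (N : ℕ) : ZInv N →+* ℝ := (algebraMap ℚ ℝ).comp (ZInv N).val.toRingHom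

/-- `Oct_r` as a subgroup of `GL_r(ℤ[N⁻¹])`. -/
def Oct (N r : ℕ) : Subgroup (GL (Fin r) (ZInv N)) :=
  (octReal r).comap (Matrix.GeneralLinearGroup.map (ZInv.toReal N))

/-- `GL_r(ℤ)` as a subgroup of `GL_r(ℤ[N⁻¹])`. -/
def GLZ (N r : ℕ) : Subgroup (GL (Fin r) (ZInv N)) :=
  (Matrix.GeneralLinearGroup.map (algebraMap ℤ (ZInv N))).range

/-- The subgroup `{±1}` of `ℤ[N⁻¹]^*`. -/
def pmOne (N : ℕ) : Subgroup (ZInv N)ˣ := Subgroup.zpowers (-1)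

end

/-! Every generalized ring involved embeds in `ℚ`: its `n`-ary operations are vectors in `ℚⁿ`. The
zero ideals of `A_N`, `ℤ` and `ℤ[N⁻¹]` give one generic point of `X`, contained in every nonempty
open set, and all stalks again embed in `ℚⁿ`. A section of `𝒪(𝐧)` over a nonempty open set is
therefore the same thing as a vector in `ℚⁿ` that lies in the stalk at each point of that set
(`GluedSpec.val_injective`, `GluedSpec.exists_val_eq`). This gives `ℤⁿ` over `Spec ℤ` and `ℤ[N⁻¹]ⁿ`
over the intersection. Over `Spec A_N` it gives `A_N(𝐧)`, because the stalk at the ideal `{|λ| < 1}`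
inverts only elements with `|λ| = 1`, which are already invertible.

A vector bundle is trivial on both charts. An open set that contains the point `{|λ| < 1}` contains
all of `Spec A_N` (`chartA_le_of_infty_mem`). Over `Spec ℤ` (`exists_isBasis_chartZ`), the vectors
of the generic fibre `ℚ^r` that are regular at every prime form a lattice, and a `ℤ`-basis of this
lattice is a basis of the bundle over every open subset.

Hence a bundle amounts to a transition matrix `A` with `e = A f`. Every invertible matrix occurs, by
gluing free modules, and bundles with the same matrix are isomorphic. A new basis over `Spec ℤ`
multiplies `A` on the right by `GL_r(ℤ)`. A new basis over `Spec A_N` multiplies it on the left by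
some `P` such that all rows of `P` and of `P⁻¹` have `ℓ¹`-norm at most `1`. Such a `P` satisfies
`P⁻¹ = Pᵀ` (`eq_transpose_of_row_sum_le`), and these matrices are exactly the symmetries of the
octahedron (`mem_octReal_iff`).

In rank one both groups consist of the units of absolute value `1`, so the invariant of a line
bundle is `|λ|`. Multiplying coordinates is a universal bilinear map into the line bundle with
transition unit `λλ'` (`isTensorProduct_of_isBasis`), so tensor products correspond to products of
absolute values. -/

noncomputable section

/-! ### Sheaf-theoretic generalities -/

namespace OModule

variable {X : GenRingedSpace}

/-- The free module `𝒪_X(𝐫)`. -/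
def free (X : GenRingedSpace) (r : ℕ) : OModule X where
  obj U := (X.O U).op r
  str U := ⟨(X.O U).subst, (X.O U).var_subst, (X.O U).subst_assoc⟩
  res h := (X.res h).app
  res_self := X.res_self
  res_res h k s := X.res_res h k s
  res_act h _ t x := (X.res h).map_subst t x
  glue := X.glue

variable {E F G : OModule X} {r : ℕ}

/-- The sheaf axiom in a flexible form: `W` need only be propositionally equal to the union, and
compatibility is quantified over all smaller open sets rather than tied to `U i ⊓ U j`. -/
lemma existsUnique_glue {ι : Type} {W : Opens X.carrier} (U : ι → Opens X.carrier)
    (hW : W = ⨆ i, U i) (hU : ∀ i, U i ≤ W) (s : (i : ι) → E.obj (U i))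
    (hs : ∀ i j (W' : Opens X.carrier) (hi : W' ≤ U i) (hj : W' ≤ U j),
      E.res hi (s i) = E.res hj (s j)) :
    ∃! t : E.obj W, ∀ i, E.res (hU i) t = s i := by
  subst hW
  exact E.glue U s fun i j => hs i j _ _ _

lemma ext_of_cover {ι : Type} {W : Opens X.carrier} (U : ι → Opens X.carrier)
    (hW : W = ⨆ i, U i) (hU : ∀ i, U i ≤ W) {s t : E.obj W}
    (h : ∀ i, E.res (hU i) s = E.res (hU i) t) : s = t :=
  (existsUnique_glue U hW hU (fun i => E.res (hU i) t)
    fun i j W' hi hj => by rw [E.res_res, E.res_res]).unique h fun _ => rfl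

lemma ext_of_mem {W : Opens X.carrier} {s t : E.obj W}
    (h : ∀ x ∈ W, ∃ (V : Opens X.carrier) (hV : V ≤ W), x ∈ V ∧ E.res hV s = E.res hV t) :
    s = t := by
  choose V hV hx hst using fun x : W => h x.1 x.2
  refine ext_of_cover V (le_antisymm (fun x hx' => ?_) (iSup_le hV)) hV hst
  exact Opens.mem_iSup.2 ⟨⟨x, hx'⟩, hx _⟩

/-- The cover is indexed by the points of `W`, so for empty `W` the empty cover already produces a
section. -/
lemma exists_glue_of_mem {W : Opens X.carrier}
    (V : W → Opens X.carrier) (hV : ∀ x, V x ≤ W) (hx : ∀ x : W, x.1 ∈ V x)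
    (s : (x : W) → E.obj (V x))
    (hs : ∀ i j (W' : Opens X.carrier) (hi : W' ≤ V i) (hj : W' ≤ V j),
      E.res hi (s i) = E.res hj (s j)) :
    ∃ t : E.obj W, ∀ x, E.res (hV x) t = s x :=
  (existsUnique_glue V (le_antisymm (fun x hx' => Opens.mem_iSup.2 ⟨⟨x, hx'⟩, hx _⟩) (iSup_le hV))
    hV s hs).exists

lemma eq_iSup_bool {U V : Opens X.carrier} (hUV : U ⊔ V = ⊤) (W : Opens X.carrier) :
    W = ⨆ b : Bool, bif b then W ⊓ U else W ⊓ V := by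
  rw [iSup_bool_eq]
  simp [← inf_sup_left, hUV]

lemma ext_of_sup_eq_top {U V : Opens X.carrier} (hUV : U ⊔ V = ⊤) {W : Opens X.carrier}
    {s t : E.obj W}
    (h₁ : E.res (inf_le_left : W ⊓ U ≤ W) s = E.res inf_le_left t)
    (h₂ : E.res (inf_le_left : W ⊓ V ≤ W) s = E.res inf_le_left t) : s = t := by
  refine ext_of_cover _ (eq_iSup_bool hUV W) (fun b => ?_) (fun b => ?_)
  · cases b <;> exact inf_le_left
  · cases b
    · exact h₂
    · exact h₁

lemma exists_glue_of_sup_eq_top {U V : Opens X.carrier} (hUV : U ⊔ V = ⊤) {W : Opens X.carrier}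
    (a : E.obj (W ⊓ U)) (b : E.obj (W ⊓ V))
    (hab : ∀ (W' : Opens X.carrier) (h₁ : W' ≤ W ⊓ U) (h₂ : W' ≤ W ⊓ V),
      E.res h₁ a = E.res h₂ b) :
    ∃ t : E.obj W, E.res inf_le_left t = a ∧ E.res inf_le_left t = b := by
  have hle : ∀ i : Bool, (bif i then W ⊓ U else W ⊓ V) ≤ W := by
    intro i; cases i <;> exact inf_le_left
  obtain ⟨t, ht, -⟩ := existsUnique_glue (E := E) _ (eq_iSup_bool hUV W) hle
    (fun i => match i with
      | true => a
      | false => b) (by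
      rintro (_ | _) (_ | _) W' hi hj
      · rfl
      · exact (hab W' hj hi).symm
      · exact hab W' hi hj
      · rfl)
  exact ⟨t, ht true, ht false⟩

/-- Maps out of a presheaf of sets glue. -/
lemma exists_glue_map {U V : Opens X.carrier} (hUV : U ⊔ V = ⊤)
    (P : Opens X.carrier → Type) (pres : ∀ {W W' : Opens X.carrier}, W ≤ W' → P W' → P W)
    (pres_res : ∀ {W₁ W₂ W₃ : Opens X.carrier} (h : W₁ ≤ W₂) (k : W₂ ≤ W₃) (s : P W₃),
      pres h (pres k s) = pres (h.trans k) s)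
    (α : (W : Opens X.carrier) → W ≤ U → P W → F.obj W)
    (hα : ∀ {W W' : Opens X.carrier} (h : W ≤ W') (hW : W' ≤ U) (x : P W'),
      α W (h.trans hW) (pres h x) = F.res h (α W' hW x))
    (β : (W : Opens X.carrier) → W ≤ V → P W → F.obj W)
    (hβ : ∀ {W W' : Opens X.carrier} (h : W ≤ W') (hW : W' ≤ V) (x : P W'),
      β W (h.trans hW) (pres h x) = F.res h (β W' hW x))
    (hαβ : ∀ (W : Opens X.carrier) (h₁ : W ≤ U) (h₂ : W ≤ V) (x : P W), α W h₁ x = β W h₂ x) :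
    ∃ γ : (W : Opens X.carrier) → P W → F.obj W,
      (∀ {W W' : Opens X.carrier} (h : W ≤ W') (x : P W'), γ W (pres h x) = F.res h (γ W' x)) ∧
      (∀ W h x, γ W x = α W h x) ∧ ∀ W h x, γ W x = β W h x := by
  have key : ∀ (W : Opens X.carrier) (x : P W), ∃ t : F.obj W,
      F.res inf_le_left t = α (W ⊓ U) inf_le_right (pres inf_le_left x) ∧
      F.res inf_le_left t = β (W ⊓ V) inf_le_right (pres inf_le_left x) := by
    intro W x
    refine exists_glue_of_sup_eq_top hUV _ _ fun W' h₁ h₂ => ?_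
    rw [← hα, ← hβ, pres_res, pres_res]
    exact hαβ _ _ _ _
  choose γ hγ₁ hγ₂ using key
  -- The glued section is identified on every smaller open set inside `U`, not just on `W ⊓ U`;
  -- naturality compares restrictions to `W ⊓ U` of sections that come from a larger `W'`.
  have hres₁ : ∀ (W : Opens X.carrier) (x : P W) (W' : Opens X.carrier) (h : W' ≤ W)
      (h' : W' ≤ U), F.res h (γ W x) = α W' h' (pres h x) := by
    intro W x W' h h'
    rw [← F.res_res (le_inf h h') inf_le_left, hγ₁, ← hα, pres_res]
  have hres₂ : ∀ (W : Opens X.carrier) (x : P W) (W' : Opens X.carrier) (h : W' ≤ W)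
      (h' : W' ≤ V), F.res h (γ W x) = β W' h' (pres h x) := by
    intro W x W' h h'
    rw [← F.res_res (le_inf h h') inf_le_left, hγ₂, ← hβ, pres_res]
  refine ⟨γ, fun {W W'} h x => ?_, fun W h x => ?_, fun W h x => ?_⟩
  · refine ext_of_sup_eq_top hUV ?_ ?_
    · rw [hγ₁, pres_res, F.res_res]
      exact (hres₁ _ _ _ _ _).symm
    · rw [hγ₂, pres_res, F.res_res]
      exact (hres₂ _ _ _ _ _).symm
  · refine ext_of_sup_eq_top hUV ?_ ?_
    · rw [hγ₁, hα]
    · rw [hγ₂, ← hα]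
      exact (hαβ _ _ _ _).symm
  · refine ext_of_sup_eq_top hUV ?_ ?_
    · rw [hγ₁, ← hβ]
      exact hαβ _ _ _ _
    · rw [hγ₂, hβ]

/-! ### Bases -/

/-- `e` is a basis of `E|_U`. -/
def IsBasis (E : OModule X) (U : Opens X.carrier) (e : Fin r → E.obj U) : Prop :=
  ∀ (W : Opens X.carrier) (h : W ≤ U), Function.Bijective
    (fun t : (X.O W).op r => (E.str W).act t (fun i => E.res h (e i)))

lemma Trivialization.equiv_apply {U : Opens X.carrier} (τ : Trivialization E U r)
    (W : Opens X.carrier) (h : W ≤ U) (t : (X.O W).op r) :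
    τ.equiv W h t = (E.str W).act t (fun i => E.res h (τ.basis i)) := by
  conv_lhs => rw [← (X.O W).subst_var t]
  rw [τ.map_act]
  congr 1
  funext i
  rw [← (X.res h).map_var i]
  exact τ.naturality h le_rfl _

lemma Trivialization.isBasis {U : Opens X.carrier} (τ : Trivialization E U r) :
    IsBasis E U τ.basis := fun W h => by
  have : (fun t : (X.O W).op r => (E.str W).act t (fun i => E.res h (τ.basis i))) =
      τ.equiv W h := funext fun t => (τ.equiv_apply W h t).symm
  rw [this]
  exact (τ.equiv W h).bijective

namespace IsBasis

variable {U : Opens X.carrier} {e : Fin r → E.obj U}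

/-- The trivialization defined by a basis. -/
def trivialization (he : IsBasis E U e) : Trivialization E U r where
  equiv W h := Equiv.ofBijective _ (he W h)
  naturality h hW s := by
    simp only [Equiv.ofBijective_apply, E.res_act, E.res_res]
  map_act V hV _ t x := by
    simp only [Equiv.ofBijective_apply, (E.str V).act_assoc]

lemma basis_trivialization (he : IsBasis E U e) : he.trivialization.basis = e := by
  funext i
  change (E.str U).act ((X.O U).var i) (fun i => E.res le_rfl (e i)) = e i
  rw [(E.str U).var_act, E.res_self]

lemma restrict (he : IsBasis E U e) {V : Opens X.carrier} (h : V ≤ U) :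
    IsBasis E V (fun i => E.res h (e i)) := fun W hW => by
  simp only [E.res_res]
  exact he W _

/-- Coordinates with respect to a basis. -/
def coord (he : IsBasis E U e) {W : Opens X.carrier} (h : W ≤ U) (x : E.obj W) : (X.O W).op r :=
  (Equiv.ofBijective _ (he W h)).symm x

lemma act_coord (he : IsBasis E U e) {W : Opens X.carrier} (h : W ≤ U) (x : E.obj W) :
    (E.str W).act (he.coord h x) (fun i => E.res h (e i)) = x :=
  (Equiv.ofBijective _ (he W h)).apply_symm_apply x

lemma coord_eq (he : IsBasis E U e) {W : Opens X.carrier} (h : W ≤ U) {x : E.obj W}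
    {t : (X.O W).op r} (ht : (E.str W).act t (fun i => E.res h (e i)) = x) : he.coord h x = t :=
  (he W h).1 ((he.act_coord h x).trans ht.symm)

lemma coord_res (he : IsBasis E U e) {V W : Opens X.carrier} (h : V ≤ W) (hW : W ≤ U)
    (x : E.obj W) : he.coord (h.trans hW) (E.res h x) = (X.res h).app (he.coord hW x) := by
  apply he.coord_eq
  conv_rhs => rw [← he.act_coord hW x]
  simp only [E.res_act, E.res_res]

lemma coord_act (he : IsBasis E U e) {W : Opens X.carrier} (h : W ≤ U) {n : ℕ}
    (t : (X.O W).op n) (x : Fin n → E.obj W) :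
    he.coord h ((E.str W).act t x) = (X.O W).subst t (fun i => he.coord h (x i)) := by
  apply he.coord_eq
  rw [(E.str W).act_assoc]
  simp only [act_coord]

/-- Change of basis by an invertible matrix. -/
lemma change (he : IsBasis E U e) {c d : Fin r → (X.O U).op r}
    (hcd : ∀ i, (X.O U).subst (c i) d = (X.O U).var i)
    (hdc : ∀ i, (X.O U).subst (d i) c = (X.O U).var i) :
    IsBasis E U (fun i => (E.str U).act (c i) e) := fun W h => by
  have key : ∀ {c d : Fin r → (X.O U).op r}, (∀ i, (X.O U).subst (c i) d = (X.O U).var i) →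
      ∀ t : (X.O W).op r, (X.O W).subst ((X.O W).subst t (fun i => (X.res h).app (c i)))
        (fun i => (X.res h).app (d i)) = t := by
    intro c d hcd t
    rw [(X.O W).subst_assoc]
    simp only [← (X.res h).map_subst, hcd, (X.res h).map_var]
    exact (X.O W).subst_var t
  have h1 : Function.Bijective
      (fun t : (X.O W).op r => (X.O W).subst t (fun i => (X.res h).app (c i))) :=
    Function.bijective_iff_has_inverse.2
      ⟨fun t => (X.O W).subst t (fun i => (X.res h).app (d i)), key hcd, key hdc⟩
  have h2 := (he W h).comp h1
  convert h2 using 2 with t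
  simp only [Function.comp, (E.str W).act_assoc, E.res_act]

/-- The matrix expressing one basis in terms of another is invertible. -/
lemma coord_subst_coord {e' : Fin r → E.obj U} (he : IsBasis E U e) (he' : IsBasis E U e')
    (i : Fin r) :
    (X.O U).subst (he.coord le_rfl (e' i)) (fun j => he'.coord le_rfl (e j)) = (X.O U).var i := by
  rw [← he'.coord_act]
  apply he'.coord_eq
  rw [(E.str U).var_act, E.res_self]
  conv_lhs => rw [← he.act_coord le_rfl (e' i)]
  simp only [E.res_self]

end IsBasis

/-- Two morphisms that agree on bases over the members of a cover are equal. -/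
lemma Hom.app_eq_of_isBasis {U V : Opens X.carrier} (hUV : U ⊔ V = ⊤) {e : Fin r → E.obj U}
    {f : Fin r → E.obj V} (he : IsBasis E U e) (hf : IsBasis E V f) {φ φ' : Hom E F}
    (h₁ : ∀ i, φ.app U (e i) = φ'.app U (e i)) (h₂ : ∀ i, φ.app V (f i) = φ'.app V (f i))
    (W : Opens X.carrier) (x : E.obj W) : φ.app W x = φ'.app W x := by
  have key : ∀ {U W : Opens X.carrier} {e : Fin r → E.obj U}, IsBasis E U e →
      (∀ i, φ.app U (e i) = φ'.app U (e i)) → W ≤ U → ∀ x : E.obj W,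
        φ.app W x = φ'.app W x := by
    intro U W e he h hW x
    rw [← he.act_coord hW x]
    simp only [Hom.map_act, Hom.naturality, h]
  refine ext_of_sup_eq_top hUV ?_ ?_
  · rw [← φ.naturality, ← φ'.naturality]
    exact key he h₁ inf_le_right _
  · rw [← φ.naturality, ← φ'.naturality]
    exact key hf h₂ inf_le_right _

/-- A morphism is defined by its values on bases over the members of a cover. -/
lemma exists_hom_of_isBasis {U V : Opens X.carrier} (hUV : U ⊔ V = ⊤) {e : Fin r → E.obj U}
    {f : Fin r → E.obj V} (he : IsBasis E U e) (hf : IsBasis E V f)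
    (e' : Fin r → F.obj U) (f' : Fin r → F.obj V) (c : Fin r → (X.O (U ⊓ V)).op r)
    (hc : ∀ i, E.res inf_le_left (e i) =
      (E.str (U ⊓ V)).act (c i) (fun j => E.res inf_le_right (f j)))
    (hc' : ∀ i, F.res inf_le_left (e' i) =
      (F.str (U ⊓ V)).act (c i) (fun j => F.res inf_le_right (f' j))) :
    ∃ φ : Hom E F, (∀ i, φ.app U (e i) = e' i) ∧ ∀ i, φ.app V (f i) = f' i := by
  -- Stated for an arbitrary open set and basis, so that it serves both members of the cover.
  have nat : ∀ {U : Opens X.carrier} {e : Fin r → E.obj U} (he : IsBasis E U e)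
      (e' : Fin r → F.obj U) {W W' : Opens X.carrier} (h : W ≤ W') (hW : W' ≤ U) (x : E.obj W'),
      (F.str W).act (he.coord (h.trans hW) (E.res h x)) (fun i => F.res (h.trans hW) (e' i)) =
        F.res h ((F.str W').act (he.coord hW x) (fun i => F.res hW (e' i))) := by
    intro U e he e' W W' h hW x
    rw [he.coord_res h hW]
    simp only [F.res_act, F.res_res]
  obtain ⟨γ, hγ, hγ₁, hγ₂⟩ := exists_glue_map (F := F) hUV E.obj (fun h => E.res h) E.res_res
    (fun W h x => (F.str W).act (he.coord h x) (fun i => F.res h (e' i))) (nat he e')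
    (fun W h x => (F.str W).act (hf.coord h x) (fun i => F.res h (f' i))) (nat hf f') (by
      intro W h₁ h₂ x
      have hW : W ≤ U ⊓ V := le_inf h₁ h₂
      have h3 : ∀ i, E.res h₁ (e i) = (E.str W).act ((X.res hW).app (c i))
          (fun j => E.res h₂ (f j)) := fun i => by
        rw [← E.res_res hW inf_le_left, hc, E.res_act]
        simp only [E.res_res]
      have h3' : ∀ i, F.res h₁ (e' i) = (F.str W).act ((X.res hW).app (c i))
          (fun j => F.res h₂ (f' j)) := fun i => by
        rw [← F.res_res hW inf_le_left, hc', F.res_act]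
        simp only [F.res_res]
      -- Coordinates are row vectors, so passing from the basis `e` to the basis `f` multiplies them
      -- on the right by the transition matrix; the two local formulas therefore agree.
      have h4 : hf.coord h₂ x = (X.O W).subst (he.coord h₁ x) (fun i => (X.res hW).app (c i)) := by
        apply hf.coord_eq
        rw [(E.str W).act_assoc]
        simp only [← h3, he.act_coord]
      simp only [h3', h4, (F.str W).act_assoc])
  have hact : ∀ {U W : Opens X.carrier} {e : Fin r → E.obj U} (he : IsBasis E U e)
      (e' : Fin r → F.obj U) (hW : W ≤ U)
      (hγ : ∀ x, γ W x = (F.str W).act (he.coord hW x) (fun i => F.res hW (e' i)))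
      {n : ℕ} (t : (X.O W).op n) (x : Fin n → E.obj W),
      γ W ((E.str W).act t x) = (F.str W).act t (fun i => γ W (x i)) := by
    intro U W e he e' hW hγ n t x
    simp only [hγ, he.coord_act, (F.str W).act_assoc]
  -- On a general `W` the map `γ` has no formula, so linearity is checked after restriction to `W ⊓
  -- U` and `W ⊓ V`.
  refine ⟨⟨γ, hγ, fun W n t x => ext_of_sup_eq_top hUV ?_ ?_⟩, fun i => ?_, fun i => ?_⟩
  · rw [← hγ, E.res_act, hact he e' inf_le_right (hγ₁ _ _), F.res_act]
    simp only [hγ]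
  · rw [← hγ, E.res_act, hact hf f' inf_le_right (hγ₂ _ _), F.res_act]
    simp only [hγ]
  · change γ U (e i) = e' i
    rw [hγ₁ U le_rfl, he.coord_eq le_rfl (t := (X.O U).var i) (by
      rw [(E.str U).var_act, E.res_self]), (F.str U).var_act, F.res_self]
  · change γ V (f i) = f' i
    rw [hγ₂ V le_rfl, hf.coord_eq le_rfl (t := (X.O V).var i) (by
      rw [(E.str V).var_act, E.res_self]), (F.str V).var_act, F.res_self]

/-- Bundles with the same transition matrix are isomorphic. -/
lemma isIsoTo_of_isBasis {U V : Opens X.carrier} (hUV : U ⊔ V = ⊤) {e : Fin r → E.obj U}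
    {f : Fin r → E.obj V} (he : IsBasis E U e) (hf : IsBasis E V f)
    {e' : Fin r → F.obj U} {f' : Fin r → F.obj V} (he' : IsBasis F U e') (hf' : IsBasis F V f')
    (c : Fin r → (X.O (U ⊓ V)).op r)
    (hc : ∀ i, E.res inf_le_left (e i) =
      (E.str (U ⊓ V)).act (c i) (fun j => E.res inf_le_right (f j)))
    (hc' : ∀ i, F.res inf_le_left (e' i) =
      (F.str (U ⊓ V)).act (c i) (fun j => F.res inf_le_right (f' j))) : IsIsoTo E F := by
  obtain ⟨φ, h1, h2⟩ := exists_hom_of_isBasis hUV he hf e' f' c hc hc'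
  obtain ⟨ψ, k1, k2⟩ := exists_hom_of_isBasis hUV he' hf' e f c hc' hc
  refine ⟨φ, ψ, fun W s => ?_, fun W s => ?_⟩
  · exact Hom.app_eq_of_isBasis hUV he hf
      (φ := ⟨fun U s => ψ.app U (φ.app U s), fun h s => by rw [φ.naturality, ψ.naturality],
        fun U _ t x => by rw [φ.map_act, ψ.map_act]⟩)
      (φ' := ⟨fun _ s => s, fun _ _ => rfl, fun _ _ _ _ => rfl⟩)
      (fun i => by simp only [h1, k1]) (fun i => by simp only [h2, k2]) W s
  · exact Hom.app_eq_of_isBasis hUV he' hf'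
      (φ := ⟨fun U s => φ.app U (ψ.app U s), fun h s => by rw [ψ.naturality, φ.naturality],
        fun U _ t x => by rw [ψ.map_act, φ.map_act]⟩)
      (φ' := ⟨fun _ s => s, fun _ _ => rfl, fun _ _ _ _ => rfl⟩)
      (fun i => by simp only [h1, k1]) (fun i => by simp only [h2, k2]) W s

/-- Bases are transported by isomorphisms. -/
lemma IsBasis.map {U : Opens X.carrier} {e : Fin r → E.obj U} (he : IsBasis E U e)
    {φ : Hom E F} {ψ : Hom F E} (h₁ : ∀ U s, ψ.app U (φ.app U s) = s)
    (h₂ : ∀ U s, φ.app U (ψ.app U s) = s) : IsBasis F U (fun i => φ.app U (e i)) := fun W h => by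
  have hb : Function.Bijective (φ.app W) :=
    Function.bijective_iff_has_inverse.2 ⟨ψ.app W, h₁ W, h₂ W⟩
  convert hb.comp (he W h) using 2 with t
  simp only [Function.comp, φ.map_act, φ.naturality]

/-! ### Gluing two free modules -/

section Glue

variable {U V : Opens X.carrier} (c : Fin r → (X.O (U ⊓ V)).op r)

/-- The compatibility `a c = b` of coordinates `a` over `W ∩ U` and `b` over `W ∩ V`. -/
def Compatible (W : Opens X.carrier) (a : (X.O (W ⊓ U)).op r) (b : (X.O (W ⊓ V)).op r) : Prop :=
  ∀ (W' : Opens X.carrier) (h₁ : W' ≤ W ⊓ U) (h₂ : W' ≤ W ⊓ V) (h : W' ≤ U ⊓ V),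
    (X.O W').subst ((X.res h₁).app a) (fun i => (X.res h).app (c i)) = (X.res h₂).app b

/-- The module obtained by gluing `𝒪_U(𝐫)` and `𝒪_V(𝐫)` along the matrix `c`. -/
def glued : OModule X where
  obj W := {p : (X.O (W ⊓ U)).op r × (X.O (W ⊓ V)).op r // Compatible c W p.1 p.2}
  str W :=
    { act := fun t x => ⟨((X.O _).subst ((X.res inf_le_left).app t) (fun i => (x i).1.1),
        (X.O _).subst ((X.res inf_le_left).app t) (fun i => (x i).1.2)), fun W' h₁ h₂ h => by
          simp only [(X.res _).map_subst, X.res_res, (X.O W').subst_assoc]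
          congr 1
          exact funext fun i => (x i).2 W' h₁ h₂ h⟩
      var_act := fun i x => Subtype.ext (Prod.ext
        (by simp only [(X.res _).map_var, (X.O _).var_subst])
        (by simp only [(X.res _).map_var, (X.O _).var_subst]))
      act_assoc := fun t s x => Subtype.ext (Prod.ext
        (by simp only [(X.res _).map_subst, (X.O _).subst_assoc])
        (by simp only [(X.res _).map_subst, (X.O _).subst_assoc])) }
  res h p := ⟨((X.res (inf_le_inf_right _ h)).app p.1.1, (X.res (inf_le_inf_right _ h)).app p.1.2),
    fun W' h₁ h₂ h' => by
      simp only [X.res_res]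
      exact p.2 W' _ _ h'⟩
  res_self p := Subtype.ext (Prod.ext (X.res_self _) (X.res_self _))
  res_res h k p := Subtype.ext (Prod.ext (X.res_res _ _ _) (X.res_res _ _ _))
  res_act h _ t x := Subtype.ext (Prod.ext
    (by simp only [(X.res _).map_subst, X.res_res])
    (by simp only [(X.res _).map_subst, X.res_res]))
  glue := by
    intro ι W s hs
    have hs' : ∀ i j (W' : Opens X.carrier) (hi : W' ≤ W i) (hj : W' ≤ W j),
        (X.res (inf_le_inf_right U hi)).app (s i).1.1 =
          (X.res (inf_le_inf_right U hj)).app (s j).1.1 ∧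
        (X.res (inf_le_inf_right V hi)).app (s i).1.2 =
          (X.res (inf_le_inf_right V hj)).app (s j).1.2 := by
      intro i j W' hi hj
      have h1 := congrArg (fun p => (X.res (inf_le_inf_right U (le_inf hi hj))).app p.1.1) (hs i j)
      have h2 := congrArg (fun p => (X.res (inf_le_inf_right V (le_inf hi hj))).app p.1.2) (hs i j)
      simp only [X.res_res] at h1 h2
      exact ⟨h1, h2⟩
    obtain ⟨a, ha, ha'⟩ : ∃! a : (X.O ((⨆ i, W i) ⊓ U)).op r,
        ∀ i, (X.res (inf_le_inf_right U (le_iSup W i))).app a = (s i).1.1 :=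
      existsUnique_glue (E := free X r) (W := (⨆ i, W i) ⊓ U)
      (fun i => W i ⊓ U) (iSup_inf_eq _ _) (fun i => inf_le_inf_right _ (le_iSup W i))
      (fun i => (s i).1.1) (fun i j W' hi hj => by
        have := congrArg (X.res (le_inf le_rfl (hi.trans inf_le_right))).app
          (hs' i j W' (hi.trans inf_le_left) (hj.trans inf_le_left)).1
        simp only [X.res_res] at this
        exact this)
    obtain ⟨b, hb, hb'⟩ : ∃! b : (X.O ((⨆ i, W i) ⊓ V)).op r,
        ∀ i, (X.res (inf_le_inf_right V (le_iSup W i))).app b = (s i).1.2 :=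
      existsUnique_glue (E := free X r) (W := (⨆ i, W i) ⊓ V)
      (fun i => W i ⊓ V) (iSup_inf_eq _ _) (fun i => inf_le_inf_right _ (le_iSup W i))
      (fun i => (s i).1.2) (fun i j W' hi hj => by
        have := congrArg (X.res (le_inf le_rfl (hi.trans inf_le_right))).app
          (hs' i j W' (hi.trans inf_le_left) (hj.trans inf_le_left)).2
        simp only [X.res_res] at this
        exact this)
    refine ⟨⟨(a, b), fun W' h₁ h₂ h => ?_⟩, fun i => Subtype.ext (Prod.ext (ha i) (hb i)),
      fun p hp => Subtype.ext (Prod.ext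
        (ha' _ fun i => congrArg (fun q => q.1.1) (hp i))
        (hb' _ fun i => congrArg (fun q => q.1.2) (hp i)))⟩
    -- `W'` lies in the union of the `W i`, so compatibility may be tested on the pieces `W' ⊓ W i`,
    -- where `a` and `b` restrict to the given local pairs.
    refine ext_of_cover (E := free X r) (fun i => W' ⊓ W i) ?_ (fun i => inf_le_left) fun i => ?_
    · rw [← inf_iSup_eq, inf_eq_left.2 (h₁.trans inf_le_left)]
    · have k := (s i).2 (W' ⊓ W i) (le_inf inf_le_right (inf_le_left.trans (h₁.trans inf_le_right)))
        (le_inf inf_le_right (inf_le_left.trans (h₂.trans inf_le_right))) (inf_le_left.trans h)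
      rw [← ha i, ← hb i] at k
      dsimp only [free] at k ⊢
      simp only [(X.res _).map_subst, X.res_res] at k ⊢
      exact k

/-- With `x_i` the standard basis, the bases are `e_i = (x_i, c_i)` over `U` and `f_i = (d_i, x_i)`
over `V`. Over an open subset of one chart, the component on that chart determines the other through
`c` or its inverse `d`. -/
lemma exists_glued {d : Fin r → (X.O (U ⊓ V)).op r}
    (hcd : ∀ i, (X.O (U ⊓ V)).subst (c i) d = (X.O (U ⊓ V)).var i)
    (hdc : ∀ i, (X.O (U ⊓ V)).subst (d i) c = (X.O (U ⊓ V)).var i) :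
    ∃ (e : Fin r → (glued c).obj U) (f : Fin r → (glued c).obj V),
      IsBasis (glued c) U e ∧ IsBasis (glued c) V f ∧
      ∀ i, (glued c).res inf_le_left (e i) =
        ((glued c).str (U ⊓ V)).act (c i) (fun j => (glued c).res inf_le_right (f j)) := by
  have key : ∀ {c d : Fin r → (X.O (U ⊓ V)).op r},
      (∀ i, (X.O (U ⊓ V)).subst (c i) d = (X.O (U ⊓ V)).var i) →
      ∀ (W : Opens X.carrier) (h : W ≤ U ⊓ V) (t : (X.O W).op r),
      (X.O W).subst ((X.O W).subst t (fun i => (X.res h).app (c i)))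
        (fun i => (X.res h).app (d i)) = t := by
    intro c d hcd W h t
    rw [(X.O W).subst_assoc]
    simp only [← (X.res h).map_subst, hcd, (X.res h).map_var]
    exact (X.O W).subst_var t
  refine ⟨fun i => ⟨((X.O _).var i, (c i)), fun W' h₁ h₂ h => ?_⟩,
    fun i => ⟨((X.res ((inf_comm V U).le)).app (d i), (X.O _).var i), fun W' h₁ h₂ h => ?_⟩,
    fun W hW => ⟨fun s t hst => ?_, fun p => ?_⟩, fun W hW => ⟨fun s t hst => ?_, fun p => ?_⟩,
    fun i => ?_⟩
  · rw [(X.res _).map_var, (X.O _).var_subst]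
  · rw [(X.res _).map_var, X.res_res, ← (X.res h).map_subst, hdc, (X.res h).map_var]
  · have h1 := congrArg (fun p => (X.res (le_inf le_rfl hW)).app p.1.1) hst
    simp only [glued, (X.res _).map_subst, (X.res _).map_var, X.res_res] at h1
    rw [(X.O W).subst_var, (X.O W).subst_var, X.res_self, X.res_self] at h1
    exact h1
  · refine ⟨(X.res (le_inf le_rfl hW)).app p.1.1, Subtype.ext (Prod.ext ?_ ?_)⟩
    · simp only [glued, (X.res _).map_var, X.res_res]
      rw [(X.O _).subst_var, X.res_self]
    · have := p.2 (W ⊓ V) (le_inf inf_le_left (inf_le_left.trans hW)) le_rfl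
        (inf_le_inf_right _ hW)
      rw [X.res_self] at this
      simp only [glued, X.res_res]
      exact this
  · have h1 := congrArg (fun p => (X.res (le_inf le_rfl hW)).app p.1.2) hst
    simp only [glued, (X.res _).map_subst, (X.res _).map_var, X.res_res] at h1
    rw [(X.O W).subst_var, (X.O W).subst_var, X.res_self, X.res_self] at h1
    exact h1
  · refine ⟨(X.res (le_inf le_rfl hW)).app p.1.2, Subtype.ext (Prod.ext ?_ ?_)⟩
    -- Compatibility reads `a c = b`; multiplying by `d` recovers the `U`-component `a` from `b`.
    · have := p.2 (W ⊓ U) le_rfl (le_inf inf_le_left (inf_le_left.trans hW))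
        (le_inf inf_le_right (inf_le_left.trans hW))
      rw [X.res_self] at this
      simp only [glued, X.res_res]
      rw [← this]
      exact key hcd _ _ _
    · simp only [glued, (X.res _).map_var, X.res_res]
      rw [(X.O _).subst_var, X.res_self]
  · refine Subtype.ext (Prod.ext ?_ ?_)
    · simp only [glued, (X.res _).map_var, X.res_res, ← (X.res _).map_subst]
      rw [hcd, (X.res _).map_var]
    · simp only [glued, (X.res _).map_var, X.res_res]
      rw [(X.O _).subst_var]

end Glue

end OModule

/-! ### Generalized rings embedded in a field -/

namespace GenRing

/-- An embedding of a generalized ring with zero into a field `K`. -/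
structure FieldEmbedding (M : GenRing) (K : Type) [Field K] extends Hom M (ofRing K) where
  injective : ∀ n, Function.Injective (app : M.op n → (ofRing K).op n)
  zero : M.op 0

namespace FieldEmbedding

variable {M : GenRing} {K : Type} [Field K] (j : FieldEmbedding M K)

/-- The coordinates in `K` of an element of `M(𝐧)`. -/
def coe {n : ℕ} (a : M.op n) : Fin n → K := j.app a

lemma coe_injective {n : ℕ} {a b : M.op n} (h : j.coe a = j.coe b) : a = b := j.injective n h

lemma coe_var {n : ℕ} (i : Fin n) : j.coe (M.var i) = Pi.single i 1 := j.map_var i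

lemma coe_subst {n m : ℕ} (t : M.op n) (x : Fin n → M.op m) (k : Fin m) :
    j.coe (M.subst t x) k = ∑ i, j.coe t i * j.coe (x i) k := congrFun (j.map_subst t x) k

lemma coe_scale {n : ℕ} (a : M.op 1) (t : M.op n) (k : Fin n) :
    j.coe (M.scale a t) k = j.coe a 0 * j.coe t k :=
  (j.coe_subst a (fun _ => t) k).trans (by simp)

lemma coe_mul (a b : M.op 1) : j.coe (a * b) 0 = j.coe a 0 * j.coe b 0 := j.coe_scale a b 0

lemma coe_one : j.coe (1 : M.op 1) 0 = 1 := by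
  have := congrFun (j.coe_var (0 : Fin 1)) 0
  rwa [Pi.single_eq_same] at this

lemma coe_pow (a : M.op 1) (k : ℕ) : j.coe (a ^ k) 0 = j.coe a 0 ^ k := by
  induction k with
  | zero => rw [pow_zero, pow_zero, coe_one]
  | succ k ih => rw [pow_succ, pow_succ, coe_mul, ih]

/-- A prime ideal is closed under nullary operations too, so it contains the zero; anything outside
it is nonzero in `K`. -/
lemma coe_ne_zero {p : PrimeSpec M} {s : M.op 1} (hs : s ∉ p.carrier) : j.coe s 0 ≠ 0 := by
  intro h
  have h0 : M.subst j.zero (Fin.elim0 : Fin 0 → M.op 1) ∈ p.carrier :=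
    p.subst_mem _ _ fun i => i.elim0
  have : s = M.subst j.zero (Fin.elim0 : Fin 0 → M.op 1) := by
    apply j.coe_injective
    funext k
    rw [Subsingleton.elim k 0, h, coe_subst]
    simp
  exact hs (this ▸ h0)

/-- The zero ideal. -/
def generic : PrimeSpec M where
  carrier := {a | j.coe a 0 = 0}
  subst_mem t x hx := by
    change j.coe (M.subst t x) 0 = 0
    rw [coe_subst]
    exact Finset.sum_eq_zero fun i _ => by rw [show j.coe (x i) 0 = 0 from hx i, mul_zero]
  one_notMem := by
    change j.coe (1 : M.op 1) 0 ≠ 0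
    rw [coe_one]
    exact one_ne_zero
  mul_notMem a b ha hb := by
    change j.coe (a * b) 0 ≠ 0
    rw [coe_mul]
    exact mul_ne_zero ha hb

lemma generic_le (p : PrimeSpec M) : j.generic.carrier ⊆ p.carrier := fun s hs => by
  by_contra h
  exact j.coe_ne_zero h hs

/-- The value in `Kⁿ` of an element of the stalk `M_𝔭(𝐧)`. -/
def fracVal (p : PrimeSpec M) {n : ℕ} : p.stalk.op n → Fin n → K :=
  Quotient.lift (s := fracSetoid M p.compl n) 
    (fun (q : M.op n × p.compl) k => j.coe q.1 k / j.coe (q.2 : M.op 1) 0) (by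
    rintro ⟨a, s⟩ ⟨b, t⟩ ⟨u, hu⟩
    funext k
    have h := congrFun (congrArg j.coe hu) k
    simp only [coe_scale, coe_mul] at h ⊢
    have hs := j.coe_ne_zero s.2
    have ht := j.coe_ne_zero t.2
    have hu' := j.coe_ne_zero u.2
    rw [div_eq_div_iff hs ht]
    rw [mul_assoc, mul_assoc] at h
    linear_combination mul_left_cancel₀ hu' h)

lemma fracVal_frac (p : PrimeSpec M) {n : ℕ} (a : M.op n) (s : p.compl) :
    j.fracVal p (frac a s) = fun k => j.coe a k / j.coe (s : M.op 1) 0 := rfl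

/-- Cross-multiplied numerators have equal images in `Kⁿ`, hence agree in `M`; no auxiliary factor
`u` is needed to identify the fractions. -/
lemma fracVal_injective (p : PrimeSpec M) {n : ℕ} {q q' : p.stalk.op n}
    (h : j.fracVal p q = j.fracVal p q') : q = q' := by
  obtain ⟨a, s, rfl⟩ := exists_frac q
  obtain ⟨b, t, rfl⟩ := exists_frac q'
  refine frac_eq.2 ⟨1, j.coe_injective (funext fun k => ?_)⟩
  have h := congrFun h k
  rw [fracVal_frac, fracVal_frac, div_eq_div_iff (j.coe_ne_zero s.2) (j.coe_ne_zero t.2)] at h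
  simp only [coe_scale, OneMemClass.coe_one, one_mul]
  linear_combination h

/-- The embedding of the stalk in `K`. -/
def fracHom (p : PrimeSpec M) : Hom p.stalk (ofRing K) where
  app := j.fracVal p
  map_var i := by
    change j.fracVal p (frac (M.var i) 1) = Pi.single i 1
    rw [fracVal_frac, coe_var]
    funext k
    simp [coe_one]
  map_subst t x := by
    obtain ⟨a, s, rfl⟩ := exists_frac t
    obtain ⟨b, u, rfl⟩ := exists_common x
    change j.fracVal p (fracSubst _ _) = fun k => ∑ i, j.fracVal p (frac a s) i *
      j.fracVal p (frac (b i) u) k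
    rw [fracSubst_frac]
    funext k
    simp only [fracVal_frac, coe_subst, Submonoid.coe_mul, coe_mul, Finset.sum_div]
    exact Finset.sum_congr rfl fun i _ => by rw [div_mul_div_comm]

/-- The image of the stalk `M_𝔭(𝐧)` in `Kⁿ`. -/
def stalkSet (p : PrimeSpec M) (n : ℕ) : Set (Fin n → K) :=
  {v | ∃ (a : M.op n) (s : M.op 1), s ∉ p.carrier ∧ ∀ k, j.coe s 0 * v k = j.coe a k}

lemma fracVal_mem (p : PrimeSpec M) {n : ℕ} (q : p.stalk.op n) :
    j.fracVal p q ∈ j.stalkSet p n := by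
  obtain ⟨a, s, rfl⟩ := exists_frac q
  exact ⟨a, s, s.2, fun k => by rw [fracVal_frac, mul_div_cancel₀ _ (j.coe_ne_zero s.2)]⟩

lemma fracVal_frac_eq {p : PrimeSpec M} {n : ℕ} {a : M.op n} {s : M.op 1} {v : Fin n → K}
    (h : ∀ k, j.coe s 0 * v k = j.coe a k) (hs : s ∉ p.carrier) :
    j.fracVal p (frac a (⟨s, hs⟩ : p.compl)) = v := by
  funext k
  change j.coe a k / j.coe s 0 = v k
  rw [← h, mul_div_cancel_left₀ _ (j.coe_ne_zero hs)]

lemma coe_mem (p : PrimeSpec M) {n : ℕ} (a : M.op n) : j.coe a ∈ j.stalkSet p n :=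
  ⟨a, 1, p.one_notMem, fun k => by rw [coe_one, one_mul]⟩

end FieldEmbedding

/-! ### Generization and multiplicative properties of prime ideals -/

namespace PrimeSpec

variable {M M' : GenRing}

/-- Open sets are stable under generization. -/
lemma mem_of_le {V : Set (PrimeSpec M)} (hV : IsOpen V) {p q : PrimeSpec M}
    (h : q.carrier ⊆ p.carrier) (hp : p ∈ V) : q ∈ V := by
  induction hV with
  | basic s hs =>
    obtain ⟨m, rfl⟩ := hs
    exact fun hm => hp (h hm)
  | univ => trivial
  | inter s t _ _ ihs iht => exact ⟨ihs hp.1, iht hp.2⟩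
  | sUnion S _ ih =>
    obtain ⟨s, hs, hps⟩ := hp
    exact ⟨s, hs, ih s hs hps⟩

lemma isOpen_basicOpen (m : M.op 1) : IsOpen (basicOpen m) :=
  isOpen_generateFrom_of_mem ⟨m, rfl⟩

lemma pow_notMem (p : PrimeSpec M) {m : M.op 1} (h : m ∉ p.carrier) (k : ℕ) :
    m ^ k ∉ p.carrier :=
  p.compl.pow_mem h k

lemma mul_mem (p : PrimeSpec M) (a : M.op 1) {b : M.op 1} (h : b ∈ p.carrier) :
    a * b ∈ p.carrier := p.subst_mem a (fun _ => b) fun _ => h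

end PrimeSpec

/-! ### Localization away from one element -/

open PrimeSpec

/-- `f : M → M'` is a localization at the powers of `m`, as far as surjectivity is concerned. -/
structure IsAway {M M' : GenRing} (f : Hom M M') (m : M.op 1) : Prop where
  isUnit : ∃ u, u * f.app m = 1
  surj : ∀ {n : ℕ} (b : M'.op n), ∃ (k : ℕ) (a : M.op n), f.app a = M'.scale (f.app (m ^ k)) b

namespace IsAway

variable {M M' : GenRing} {f : Hom M M'} {m : M.op 1} {K : Type} [Field K]
  {j : FieldEmbedding M K} {j' : FieldEmbedding M' K}

lemma comap_mem (hf : IsAway f m) (y : PrimeSpec M') : comap f y ∈ basicOpen m := by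
  obtain ⟨u, hu⟩ := hf.isUnit
  intro h
  exact y.one_notMem (hu ▸ y.mul_mem u h)

lemma surj_coe (hf : IsAway f m) (hj : ∀ {n : ℕ} (a : M.op n), j'.coe (f.app a) = j.coe a)
    {n : ℕ} (b : M'.op n) :
    ∃ (k : ℕ) (a : M.op n), ∀ i, j.coe a i = j.coe m 0 ^ k * j'.coe b i := by
  obtain ⟨k, a, h⟩ := hf.surj b
  refine ⟨k, a, fun i => ?_⟩
  rw [← hj a, h, j'.coe_scale, hj, j.coe_pow]

/-- As `f(m)` is a unit, `m` lies outside every contracted prime. The powers of `m` that clear the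
denominators of `b` and `s` can then be moved into the denominator of the fraction. -/
lemma stalkSet_eq (hf : IsAway f m) (hj : ∀ {n : ℕ} (a : M.op n), j'.coe (f.app a) = j.coe a)
    (y : PrimeSpec M') (n : ℕ) : j'.stalkSet y n = j.stalkSet (comap f y) n := by
  ext v
  constructor
  · rintro ⟨b, s, hs, h⟩
    obtain ⟨k, a, ha⟩ := hf.surj_coe hj b
    obtain ⟨l, t, ht⟩ := hf.surj s
    have ht' : ∀ i, j.coe t i = j.coe m 0 ^ l * j'.coe s i := fun i => by
      rw [← hj t, ht, j'.coe_scale, hj, j.coe_pow]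
    refine ⟨M.scale (m ^ l) a, m ^ k * t, ?_, fun i => ?_⟩
    · refine (comap f y).mul_notMem _ _ (pow_notMem _ (hf.comap_mem y) k) ?_
      change f.app t ∉ y.carrier
      rw [ht]
      exact y.mul_notMem _ _ (pow_notMem (comap f y) (hf.comap_mem y) l) hs
    · rw [j.coe_mul, j.coe_pow, j.coe_scale, j.coe_pow, ha, ht', ← h]
      ring
  · rintro ⟨a, s, hs, h⟩
    exact ⟨f.app a, f.app s, hs, fun i => by rw [hj, hj, h]⟩

/-- As for rings, the prime over `p` consists of all `b` for which some `m ^ k * b` comes from an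
element of `p`. Membership is expressed through values in `K`, which replaces torsion arguments. -/
lemma exists_comap (hf : IsAway f m) (hj : ∀ {n : ℕ} (a : M.op n), j'.coe (f.app a) = j.coe a)
    {p : PrimeSpec M} (hp : p ∈ basicOpen m) : ∃ y, comap f y = p := by
  have hm := j.coe_ne_zero hp
  let q : PrimeSpec M' :=
    { carrier := {b | ∃ (k : ℕ) (a : M.op 1), a ∈ p.carrier ∧
        j.coe a 0 = j.coe m 0 ^ k * j'.coe b 0}
      subst_mem := by
        intro n t x hx
        choose k a ha h using hx
        obtain ⟨l, t', ht'⟩ := hf.surj_coe hj t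
        -- The exponents `k i` are brought to their sum by multiplying each `a i` by the missing
        -- powers of `m`; `l` accounts for the coefficients of `t`.
        refine ⟨l + ∑ i, k i, M.subst t' (fun i => m ^ (∑ i' ∈ Finset.univ.erase i, k i') * a i),
          p.subst_mem _ _ fun i => p.mul_mem _ (ha i), ?_⟩
        rw [j.coe_subst, j'.coe_subst, Finset.mul_sum]
        refine Finset.sum_congr rfl fun i _ => ?_
        rw [j.coe_mul, j.coe_pow, ht', h, ← Finset.sum_erase_add _ _ (Finset.mem_univ i)]
        ring
      one_notMem := by
        rintro ⟨k, a, ha, h⟩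
        have : a = m ^ k := j.coe_injective (funext fun i => by
          rw [Subsingleton.elim i 0, h, j.coe_pow, j'.coe_one, mul_one])
        exact pow_notMem p hp k (this ▸ ha)
      mul_notMem := by
        rintro b b' hb hb' ⟨l, c, hc, h⟩
        obtain ⟨k, a, ha⟩ := hf.surj_coe hj b
        obtain ⟨k', a', ha'⟩ := hf.surj_coe hj b'
        have h1 : a ∉ p.carrier := fun h1 => hb ⟨k, a, h1, ha 0⟩
        have h2 : a' ∉ p.carrier := fun h2 => hb' ⟨k', a', h2, ha' 0⟩
        have h3 : m ^ l * (a * a') = m ^ (k + k') * c := j.coe_injective (funext fun i => by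
          rw [Subsingleton.elim i 0]
          simp only [j.coe_mul, j.coe_pow, ha, ha', h, j'.coe_mul]
          ring)
        exact p.mul_notMem _ _ (pow_notMem p hp l) (p.mul_notMem _ _ h1 h2)
          (h3 ▸ p.mul_mem _ hc) }
  refine ⟨q, PrimeSpec.ext (Set.ext fun a => ⟨?_, fun ha => ⟨0, a, ha, ?_⟩⟩)⟩
  · rintro ⟨k, a', ha', h⟩
    rw [hj] at h
    have : a' = m ^ k * a := j.coe_injective (funext fun i => by
      rw [Subsingleton.elim i 0, h, j.coe_mul, j.coe_pow])
    by_contra hn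
    exact p.mul_notMem _ _ (pow_notMem p hp k) hn (this ▸ ha')
  · rw [pow_zero, one_mul, hj]

lemma range_comap (hf : IsAway f m) (hj : ∀ {n : ℕ} (a : M.op n), j'.coe (f.app a) = j.coe a) :
    Set.range (comap f) = basicOpen m := by
  ext p
  refine ⟨?_, fun hp => hf.exists_comap hj hp⟩
  rintro ⟨y, rfl⟩
  exact hf.comap_mem y

end IsAway

end GenRing

/-! ### Sections of a glued spectrum as vectors over a field -/

namespace GluedSpec

open GenRing PrimeSpec

variable {A B C : GenRing} {φ : Hom A B} {ψ : Hom C B} {K : Type} [Field K]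

/-- The gluing relation only generates an equivalence relation. Instead of describing the latter, a
predicate that is true on all of `Spec C` and singles out the image of `Spec B` in `Spec A` is
descended to the quotient. -/
lemma inl_mem_range_inr_iff {x : PrimeSpec A} :
    inl φ ψ x ∈ Set.range (inr φ ψ) ↔ x ∈ Set.range (comap φ) := by
  constructor
  · rintro ⟨c, hc⟩
    let P : GluedSpec φ ψ → Prop := Quot.lift
      (fun a => Sum.elim (fun x => x ∈ Set.range (comap φ)) (fun _ => True) a) (by
        rintro _ _ ⟨y, rfl, rfl⟩
        simp)
    have h : P (inr φ ψ c) := trivial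
    rw [hc] at h
    exact h
  · rintro ⟨y, rfl⟩
    exact ⟨comap ψ y, (inl_comap φ ψ y).symm⟩

lemma inr_mem_range_inl_iff {x : PrimeSpec C} :
    inr φ ψ x ∈ Set.range (inl φ ψ) ↔ x ∈ Set.range (comap ψ) := by
  constructor
  · rintro ⟨c, hc⟩
    let P : GluedSpec φ ψ → Prop := Quot.lift
      (fun a => Sum.elim (fun _ => True) (fun x => x ∈ Set.range (comap ψ)) a) (by
        rintro _ _ ⟨y, rfl, rfl⟩
        simp)
    have h : P (inl φ ψ c) := trivial
    rw [hc] at h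
    exact h
  · rintro ⟨y, rfl⟩
    exact ⟨comap φ y, inl_comap φ ψ y⟩

lemma isOpen_iff {S : Set (GluedSpec φ ψ)} :
    IsOpen S ↔ IsOpen (inl φ ψ ⁻¹' S) ∧ IsOpen (inr φ ψ ⁻¹' S) :=
  (isQuotientMap_quot_mk.isOpen_preimage (s := S)).symm.trans isOpen_sum_iff

lemma isOpen_range_inl (h : IsOpen (Set.range (comap ψ))) : IsOpen (Set.range (inl φ ψ)) := by
  refine isOpen_iff.2 ⟨?_, ?_⟩
  · convert isOpen_univ
    exact Set.eq_univ_of_forall fun x => ⟨x, rfl⟩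
  · convert h
    exact Set.ext fun x => inr_mem_range_inl_iff

lemma isOpen_range_inr (h : IsOpen (Set.range (comap φ))) : IsOpen (Set.range (inr φ ψ)) := by
  refine isOpen_iff.2 ⟨?_, ?_⟩
  · convert h
    exact Set.ext fun x => inl_mem_range_inr_iff
  · convert isOpen_univ
    exact Set.eq_univ_of_forall fun x => ⟨x, rfl⟩

lemma exists_rep (z : GluedSpec φ ψ) : (∃ x, inl φ ψ x = z) ∨ ∃ x, inr φ ψ x = z := by
  induction z using Quot.ind with
  | mk a =>
    cases a with
    | inl x => exact .inl ⟨x, rfl⟩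
    | inr x => exact .inr ⟨x, rfl⟩

/-- Near `x` the section is a single fraction, and every neighbourhood of `x` contains the zero
ideal, so both values are computed from that fraction. -/
lemma _root_.GenRing.PrimeSpec.IsRegular.fracVal_eq {M : GenRing} (j : FieldEmbedding M K) {n : ℕ}
    {U : Set (PrimeSpec M)} {s : (x : U) → x.1.stalk.op n} (hs : IsRegular U s) (x : U)
    (h : j.generic ∈ U) : j.fracVal x.1 (s x) = j.fracVal j.generic (s ⟨j.generic, h⟩) := by
  obtain ⟨V, hV, hxV, hVU, a, f, H⟩ := hs x
  obtain ⟨h1, h2⟩ := H x hxV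
  obtain ⟨h3, h4⟩ := H ⟨j.generic, h⟩ (mem_of_le hV (j.generic_le _) hxV)
  rw [h2, h4]
  rfl

/-- A fraction chosen at `x` with value `v` is defined on a basic open neighbourhood. There it
equals the fractions chosen at the other points, because germs are determined by their values. -/
lemma _root_.GenRing.PrimeSpec.exists_isRegular {M : GenRing} (j : FieldEmbedding M K) {n : ℕ}
    {U : Set (PrimeSpec M)} (hU : IsOpen U) {v : Fin n → K} (hv : ∀ x ∈ U, v ∈ j.stalkSet x n) :
    ∃ s : (x : U) → x.1.stalk.op n, IsRegular U s ∧ ∀ x, j.fracVal x.1 (s x) = v := by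
  choose a f hf h using hv
  refine ⟨fun x => frac (a x.1 x.2) (⟨f x.1 x.2, hf _ _⟩ : x.1.compl), fun x => ?_,
    fun x => j.fracVal_frac_eq (h _ _) (hf _ _)⟩
  refine ⟨U ∩ basicOpen (f x.1 x.2), hU.inter (isOpen_basicOpen _), ⟨x.2, hf _ _⟩,
    Set.inter_subset_left, a x.1 x.2, f x.1 x.2, fun y hy => ⟨hy.2, ?_⟩⟩
  apply j.fracVal_injective y.1
  exact (j.fracVal_frac_eq (h _ _) (hf _ _)).trans (j.fracVal_frac_eq (h _ _) hy.2).symm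

lemma fracVal_stalkMap {M M' : GenRing} {f : Hom M M'} {j : FieldEmbedding M K}
    {j' : FieldEmbedding M' K} (hj : ∀ {n : ℕ} (a : M.op n), j'.coe (f.app a) = j.coe a)
    (y : PrimeSpec M') {n : ℕ} (q : (comap f y).stalk.op n) :
    j'.fracVal y ((stalkMap f y).app q) = j.fracVal (comap f y) q := by
  obtain ⟨a, s, rfl⟩ := exists_frac q
  funext k
  rw [j.fracVal_frac, ← hj, ← hj]
  rfl

lemma comap_generic {M M' : GenRing} {f : Hom M M'} {j : FieldEmbedding M K}
    {j' : FieldEmbedding M' K} (hj : ∀ {n : ℕ} (a : M.op n), j'.coe (f.app a) = j.coe a) :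
    comap f j'.generic = j.generic := by
  refine PrimeSpec.ext (Set.ext fun a => ?_)
  change j'.coe (f.app a) 0 = 0 ↔ j.coe a 0 = 0
  rw [hj]

/-! ### Generic values of sections on the glued space -/

variable {jA : FieldEmbedding A K} {jB : FieldEmbedding B K} {jC : FieldEmbedding C K}

lemma inl_generic (hφ : ∀ {n : ℕ} (a : A.op n), jB.coe (φ.app a) = jA.coe a)
    (hψ : ∀ {n : ℕ} (a : C.op n), jB.coe (ψ.app a) = jC.coe a) :
    inl φ ψ jA.generic = inr φ ψ jC.generic := by
  rw [← comap_generic hφ, ← comap_generic hψ, inl_comap]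

lemma generic_mem (hφ : ∀ {n : ℕ} (a : A.op n), jB.coe (φ.app a) = jA.coe a)
    (hψ : ∀ {n : ℕ} (a : C.op n), jB.coe (ψ.app a) = jC.coe a)
    {U : Opens (GluedSpec φ ψ)} {z : GluedSpec φ ψ} (hz : z ∈ U) :
    inr φ ψ jC.generic ∈ U := by
  obtain ⟨x, rfl⟩ | ⟨x, rfl⟩ := exists_rep z
  · rw [← inl_generic hφ hψ]
    exact mem_of_le (U.2.preimage (continuous_inl φ ψ)) (jA.generic_le x) hz
  · exact mem_of_le (U.2.preimage (continuous_inr φ ψ)) (jC.generic_le x) hz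

variable (jC) in
/-- The value of a section at the generic point. -/
def val (U : Opens (GluedSpec φ ψ)) (hU : inr φ ψ jC.generic ∈ U) :
    Hom (sections U) (ofRing K) where
  app c := jC.fracVal jC.generic (c.1.2.1 ⟨jC.generic, hU⟩)
  map_var i := (jC.fracHom jC.generic).map_var i
  map_subst _ _ := (jC.fracHom jC.generic).map_subst _ _

lemma val_inr {U : Opens (GluedSpec φ ψ)} (hU : inr φ ψ jC.generic ∈ U) {n : ℕ}
    (c : (sections U).op n) (x : PrimeSpec C) (hx : inr φ ψ x ∈ U) :
    jC.fracVal x (c.1.2.1 ⟨x, hx⟩) = (val jC U hU).app c :=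
  c.1.2.2.fracVal_eq jC ⟨x, hx⟩ hU

lemma val_comap (hφ : ∀ {n : ℕ} (a : A.op n), jB.coe (φ.app a) = jA.coe a)
    (hψ : ∀ {n : ℕ} (a : C.op n), jB.coe (ψ.app a) = jC.coe a)
    {U : Opens (GluedSpec φ ψ)} (hU : inr φ ψ jC.generic ∈ U) {n : ℕ}
    (c : (sections U).op n) (y : PrimeSpec B) (hy : inl φ ψ (comap φ y) ∈ U) :
    jA.fracVal (comap φ y) (c.1.1.1 ⟨comap φ y, hy⟩) = (val jC U hU).app c := by
  have hy' : inr φ ψ (comap ψ y) ∈ U := by rwa [← inl_comap]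
  rw [← fracVal_stalkMap hφ, c.2 y hy hy', fracVal_stalkMap hψ, val_inr hU]

/-- The two components of a section are linked only through stalks on `Spec B`, so the comparison
passes through the generic point of `Spec B`. -/
lemma val_inl (hφ : ∀ {n : ℕ} (a : A.op n), jB.coe (φ.app a) = jA.coe a)
    (hψ : ∀ {n : ℕ} (a : C.op n), jB.coe (ψ.app a) = jC.coe a)
    {U : Opens (GluedSpec φ ψ)} (hU : inr φ ψ jC.generic ∈ U) {n : ℕ}
    (c : (sections U).op n) (x : PrimeSpec A) (hx : inl φ ψ x ∈ U) :
    jA.fracVal x (c.1.1.1 ⟨x, hx⟩) = (val jC U hU).app c := by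
  have h : inl φ ψ jA.generic ∈ U := by rwa [inl_generic hφ hψ]
  refine (c.1.1.2.fracVal_eq jA ⟨x, hx⟩ h).trans ?_
  have h' : inl φ ψ (comap φ jB.generic) ∈ U := by rwa [comap_generic hφ]
  rw [← val_comap hφ hψ hU c jB.generic h']
  exact (c.1.1.2.fracVal_eq jA ⟨_, h'⟩ h).symm

lemma val_injective (hφ : ∀ {n : ℕ} (a : A.op n), jB.coe (φ.app a) = jA.coe a)
    (hψ : ∀ {n : ℕ} (a : C.op n), jB.coe (ψ.app a) = jC.coe a)
    {U : Opens (GluedSpec φ ψ)} (hU : inr φ ψ jC.generic ∈ U) {n : ℕ}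
    {c c' : (sections U).op n} (h : (val jC U hU).app c = (val jC U hU).app c') : c = c' := by
  refine Subtype.ext (Prod.ext (Subtype.ext (funext fun x => ?_))
    (Subtype.ext (funext fun x => ?_)))
  · apply jA.fracVal_injective
    exact (val_inl hφ hψ hU c x.1 x.2).trans (h.trans (val_inl hφ hψ hU c' x.1 x.2).symm)
  · apply jC.fracVal_injective
    exact (val_inr hU c x.1 x.2).trans (h.trans (val_inr hU c' x.1 x.2).symm)

/-- The components over `Spec A` and `Spec C` are built separately. They agree on `Spec B`
automatically, since both have value `v` and germs there embed in `Kⁿ`. -/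
lemma exists_val_eq (hφ : ∀ {n : ℕ} (a : A.op n), jB.coe (φ.app a) = jA.coe a)
    (hψ : ∀ {n : ℕ} (a : C.op n), jB.coe (ψ.app a) = jC.coe a)
    {U : Opens (GluedSpec φ ψ)} (hU : inr φ ψ jC.generic ∈ U) {n : ℕ} {v : Fin n → K}
    (hA : ∀ x, inl φ ψ x ∈ U → v ∈ jA.stalkSet x n)
    (hC : ∀ x, inr φ ψ x ∈ U → v ∈ jC.stalkSet x n) :
    ∃ c : (sections U).op n, (val jC U hU).app c = v := by
  obtain ⟨s, hs, hsv⟩ := exists_isRegular jA (U.2.preimage (continuous_inl φ ψ)) hA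
  obtain ⟨t, ht, htv⟩ := exists_isRegular jC (U.2.preimage (continuous_inr φ ψ)) hC
  refine ⟨⟨(⟨s, hs⟩, ⟨t, ht⟩), fun y h k => ?_⟩, htv ⟨_, hU⟩⟩
  apply jB.fracVal_injective
  rw [fracVal_stalkMap hφ, fracVal_stalkMap hψ]
  exact (hsv ⟨_, h⟩).trans (htv ⟨_, k⟩).symm

/-- At every point of `Spec B` the condition is the same equation in `Kⁿ`, so testing it at the
generic point suffices. -/
lemma pullsBackTo_iff (hφ : ∀ {n : ℕ} (a : A.op n), jB.coe (φ.app a) = jA.coe a)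
    (hψ : ∀ {n : ℕ} (a : C.op n), jB.coe (ψ.app a) = jC.coe a)
    {U : Opens (GluedSpec φ ψ)} (hU : inr φ ψ jC.generic ∈ U) {n : ℕ}
    (c : (sections U).op n) (b : B.op n) :
    PullsBackTo c b ↔ (val jC U hU).app c = jB.coe b := by
  have key : ∀ y (h : inl φ ψ (comap φ y) ∈ U),
      (stalkMap φ y).app (c.1.1.1 ⟨comap φ y, h⟩) = frac b 1 ↔
        (val jC U hU).app c = jB.coe b := by
    intro y h
    have h1 : jB.fracVal y (frac b 1) = jB.coe b := by
      rw [jB.fracVal_frac]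
      funext k
      rw [OneMemClass.coe_one, jB.coe_one, div_one]
    rw [← val_comap hφ hψ hU c y h, ← h1, ← fracVal_stalkMap hφ]
    exact ⟨fun h => congrArg _ h, fun h => jB.fracVal_injective y h⟩
  refine ⟨fun h => ?_, fun h y hy => (key y hy).2 h⟩
  have h' : inl φ ψ (comap φ jB.generic) ∈ U := by rwa [comap_generic hφ, inl_generic hφ hψ]
  exact (key _ h').1 (h _ h')

end GluedSpec

/-! ### The spectrum of a commutative ring as a generalized ring -/

namespace GenRing

open PrimeSpec

variable {R : Type} [CommRing R]

/-- A vector over `R` as an operation of the generalized ring `R`. -/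
def vec {n : ℕ} (v : Fin n → R) : (ofRing R).op n := v

lemma ofRing_mul_apply (a b : (ofRing R).op 1) : (a * b) 0 = a 0 * b 0 :=
  Fin.sum_univ_one (fun i => a i * b 0)

lemma ofRing_one_apply : (1 : (ofRing R).op 1) 0 = (1 : R) :=
  Pi.single_eq_same (M := fun _ => R) (0 : Fin 1) 1

/-- A prime ideal of a ring as a prime ideal of the associated generalized ring. -/
def ofPrime (p : PrimeSpectrum R) : PrimeSpec (ofRing R) where
  carrier := {a | a 0 ∈ p.asIdeal}
  subst_mem t x hx := by
    change ∑ i, t i * x i 0 ∈ p.asIdeal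
    exact Ideal.sum_mem _ fun i _ => p.asIdeal.mul_mem_left _ (hx i)
  one_notMem := by
    change (1 : (ofRing R).op 1) 0 ∉ p.asIdeal
    rw [ofRing_one_apply]
    exact p.asIdeal.ne_top_iff_one.1 p.2.ne_top
  mul_notMem a b ha hb := by
    change (a * b) 0 ∉ p.asIdeal
    rw [ofRing_mul_apply]
    exact fun h => (p.2.mem_or_mem h).elim ha hb

/-- A submodule of `R` in the monadic sense is an ideal: the operation `(1, 1)` gives closure under
addition, the nullary one gives zero, and the unary ones give multiples. -/
lemma ofPrime_surjective : Function.Surjective (ofPrime (R := R)) := by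
  intro q
  have hc : ∀ a : (ofRing R).op 1, vec (fun _ => a 0) = a := fun a =>
    funext fun i => by rw [Subsingleton.elim i 0]; rfl
  let I : Ideal R :=
    { carrier := {r | vec (fun _ : Fin 1 => r) ∈ q.carrier}
      add_mem' := by
        intro a b ha hb
        have h := q.subst_mem (vec (fun _ => 1 : Fin 2 → R))
          ![vec (fun _ => a), vec (fun _ => b)] (by intro i; fin_cases i; exacts [ha, hb])
        have h' : vec (fun _ : Fin 1 => a + b) = (ofRing R).subst (vec (fun _ => 1 : Fin 2 → R))
            ![vec (fun _ => a), vec (fun _ => b)] := funext fun k => by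
          simp [ofRing, vec]
        exact (congrArg (· ∈ q.carrier) h').mpr h
      zero_mem' := by
        have h := q.subst_mem (vec (Fin.elim0 : Fin 0 → R)) Fin.elim0 (fun i => i.elim0)
        have h' : vec (fun _ : Fin 1 => (0 : R)) =
            (ofRing R).subst (vec (Fin.elim0 : Fin 0 → R)) Fin.elim0 := funext fun k => by
          simp [ofRing, vec]
        exact (congrArg (· ∈ q.carrier) h').mpr h
      smul_mem' := by
        intro a b hb
        have h := q.subst_mem (vec (fun _ : Fin 1 => a)) (fun _ => vec (fun _ => b)) (fun _ => hb)
        have h' : vec (fun _ : Fin 1 => a • b) =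
            (ofRing R).subst (vec (fun _ : Fin 1 => a)) (fun _ => vec (fun _ => b)) :=
          funext fun k => by simp [ofRing, vec]
        exact (congrArg (· ∈ q.carrier) h').mpr h }
  have hI : I.IsPrime := by
    refine ⟨fun h => q.one_notMem ?_, fun {a b} hab => ?_⟩
    · rw [← hc 1, ofRing_one_apply]
      exact (I.eq_top_iff_one.1 h)
    · by_contra h
      rw [not_or] at h
      refine q.mul_notMem (vec fun _ => a) (vec fun _ => b) h.1 h.2 ?_
      rw [← hc (_ * _), ofRing_mul_apply]
      exact hab
  refine ⟨⟨I, hI⟩, PrimeSpec.ext (Set.ext fun a => ?_)⟩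
  change vec (fun _ => a 0) ∈ q.carrier ↔ a ∈ q.carrier
  rw [hc]

lemma continuous_ofPrime : Continuous (ofPrime (R := R)) := by
  refine continuous_generateFrom_iff.2 ?_
  rintro _ ⟨m, rfl⟩
  exact (PrimeSpectrum.basicOpen (m 0)).2

/-- Quasi-compactness of `Spec ℤ` is what makes finitely many trivializations enough. A continuous
surjection from the usual spectrum is all that is required. -/
instance : CompactSpace (PrimeSpec (ofRing R)) :=
  ofPrime_surjective.compactSpace continuous_ofPrime

/-- An injective ring homomorphism to a field as an embedding of generalized rings. -/
def ringEmbedding {K : Type} [Field K] (f : R →+* K) (hf : Function.Injective f) :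
    FieldEmbedding (ofRing R) K where
  toHom := ofRingHom f
  injective _ _ _ h := funext fun i => hf (congrFun h i)
  zero := Fin.elim0

/-- A vector that is regular at all points of the spectrum is regular. -/
lemma exists_coe_eq {K : Type} [Field K] (f : R →+* K) (hf : Function.Injective f) {n : ℕ}
    {v : Fin n → K} (hv : ∀ p, v ∈ (ringEmbedding f hf).stalkSet p n) :
    ∃ a : Fin n → R, ∀ k, v k = f (a k) := by
  -- The ideal of denominators of `v`.
  let I : Ideal R :=
    { carrier := {s | ∃ a : Fin n → R, ∀ k, f s * v k = f (a k)}
      add_mem' := by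
        rintro s t ⟨a, ha⟩ ⟨b, hb⟩
        exact ⟨a + b, fun k => by rw [map_add, add_mul, ha, hb, Pi.add_apply, map_add]⟩
      zero_mem' := ⟨0, fun k => by simp⟩
      smul_mem' := by
        rintro c s ⟨a, ha⟩
        exact ⟨c • a, fun k => by
          rw [smul_eq_mul, map_mul, mul_assoc, ha, Pi.smul_apply, smul_eq_mul, map_mul]⟩ }
  by_cases h : I = ⊤
  · obtain ⟨a, ha⟩ := I.eq_top_iff_one.1 h
    exact ⟨a, fun k => by rw [← ha, map_one, one_mul]⟩
  -- A proper ideal of denominators would lie in a maximal ideal `m`, but regularity of `v` at `m`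
  -- supplies a denominator outside `m`.
  · obtain ⟨m, hm, hIm⟩ := I.exists_le_maximal h
    obtain ⟨a, s, hs, has⟩ := hv (ofPrime ⟨m, hm.isPrime⟩)
    exact absurd (hIm ⟨a, has⟩ : s 0 ∈ m) hs

end GenRing

/-! ### The charts of `Spec ℤ^N`-hat -/

namespace SpecZHat

open GenRing PrimeSpec

variable (N : ℕ)

/-- The embedding of `ℤ[N⁻¹]` in `ℚ`. -/
def embB : FieldEmbedding (ofRing (ZInv N)) ℚ :=
  ringEmbedding (ZInv N).val.toRingHom Subtype.val_injective

/-- The embedding of `A_N` in `ℚ`. -/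
def embA : FieldEmbedding (AN N) ℚ where
  app a := (embB N).app ((ANincl N).app a)
  map_var i := (embB N).map_var i
  map_subst t x := (embB N).map_subst t.1 _
  injective n a b h := Subtype.ext ((embB N).injective n h)
  zero := ⟨Fin.elim0, by simp⟩

/-- The embedding of `ℤ` in `ℚ`. -/
def embZ : FieldEmbedding (ofRing ℤ) ℚ :=
  ringEmbedding (Int.castRingHom ℚ) Int.cast_injective

variable {N}

lemma embA_coe {n : ℕ} (a : (AN N).op n) (i : Fin n) : (embA N).coe a i = (a.1 i : ℚ) := rfl

lemma embB_ANincl {n : ℕ} (a : (AN N).op n) :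
    (embB N).coe ((ANincl N).app a) = (embA N).coe a := rfl

lemma embB_Zincl {n : ℕ} (z : (ofRing ℤ).op n) : (embB N).coe ((Zincl N).app z) = embZ.coe z := by
  funext i
  change ((algebraMap ℤ (ZInv N) (z i) : ZInv N) : ℚ) = (z i : ℚ)
  simp

lemma exists_pow_mul_eq (hN : 1 < N) (b : ZInv N) : ∃ (k : ℕ) (z : ℤ), (N : ℚ) ^ k * b = z := by
  have hN0 : (N : ℚ) ≠ 0 := by positivity
  obtain ⟨b, hb⟩ := b
  induction hb using Algebra.adjoin_induction with
  | mem x hx =>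
    rw [Set.mem_singleton_iff] at hx
    exact ⟨1, 1, by simp [hx, hN0]⟩
  | algebraMap z => exact ⟨0, z, by simp⟩
  | add x y hx hy ihx ihy =>
    obtain ⟨k, z, h⟩ := ihx
    obtain ⟨l, w, h'⟩ := ihy
    refine ⟨k + l, N ^ l * z + N ^ k * w, ?_⟩
    push_cast
    rw [← h, ← h']
    ring
  | mul x y hx hy ihx ihy =>
    obtain ⟨k, z, h⟩ := ihx
    obtain ⟨l, w, h'⟩ := ihy
    refine ⟨k + l, z * w, ?_⟩
    push_cast
    rw [← h, ← h']
    ring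

lemma exists_pow_mul_eq_pi (hN : 1 < N) {n : ℕ} (b : Fin n → ZInv N) :
    ∃ (k : ℕ) (z : Fin n → ℤ), ∀ i, (N : ℚ) ^ k * b i = z i := by
  choose k z h using fun i => exists_pow_mul_eq hN (b i)
  refine ⟨∑ i, k i, fun i => N ^ (∑ i' ∈ Finset.univ.erase i, k i') * z i, fun i => ?_⟩
  push_cast
  rw [← h, ← Finset.sum_erase_add _ _ (Finset.mem_univ i)]
  ring

/-- The element `N⁻¹` of `ℤ[N⁻¹]`. -/
def invN (N : ℕ) : ZInv N := ⟨(N : ℚ)⁻¹, Algebra.subset_adjoin rfl⟩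

/-- The element `N⁻¹` of `A_N(𝟏)`. -/
def invA (hN : 1 < N) : (AN N).op 1 := ⟨fun _ => invN N, by
  simp only [Finset.univ_unique, Finset.sum_const, Finset.card_singleton, one_smul]
  change |(N : ℚ)⁻¹| ≤ 1
  rw [abs_of_nonneg (by positivity)]
  exact inv_le_one_of_one_le₀ (by exact_mod_cast hN.le)⟩

lemma isAway_Zincl (hN : 1 < N) : IsAway (Zincl N) (vec fun _ => (N : ℤ)) where
  isUnit := by
    have hN0 : (N : ℚ) ≠ 0 := by positivity
    refine ⟨vec fun _ => invN N, (embB N).coe_injective (funext fun i => ?_)⟩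
    rw [Subsingleton.elim i 0, (embB N).coe_mul, (embB N).coe_one, embB_Zincl]
    exact inv_mul_cancel₀ hN0
  surj b := by
    obtain ⟨k, z, h⟩ := exists_pow_mul_eq_pi hN b
    refine ⟨k, vec z, (embB N).coe_injective (funext fun i => ?_)⟩
    rw [(embB N).coe_scale, embB_Zincl, embB_Zincl, embZ.coe_pow]
    exact (h i).symm

/-- Since `N > 1`, a high power of `N⁻¹` shrinks any vector over `ℤ[N⁻¹]` into the octahedron. Thus
`ℤ[N⁻¹]` is `A_N` with `N⁻¹` inverted. -/
lemma isAway_ANincl (hN : 1 < N) : IsAway (ANincl N) (invA hN) where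
  isUnit := by
    have hN0 : (N : ℚ) ≠ 0 := by positivity
    refine ⟨vec fun _ => (N : ZInv N), (embB N).coe_injective (funext fun i => ?_)⟩
    rw [Subsingleton.elim i 0, (embB N).coe_mul, (embB N).coe_one]
    exact mul_inv_cancel₀ hN0
  surj {n} b := by
    obtain ⟨k, hk⟩ := pow_unbounded_of_one_lt (∑ i, |(b i : ℚ)|) (y := (N : ℚ))
      (by exact_mod_cast hN)
    have hN0 : (0 : ℚ) < N ^ k := by positivity
    have hle : ∑ i, |(invN N ^ k * b i : ZInv N)| ≤ 1 := by
      have h1 : |(invN N : ZInv N) ^ k| = invN N ^ k :=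
        abs_of_nonneg (pow_nonneg (show (0 : ℚ) ≤ (N : ℚ)⁻¹ by positivity) k)
      simp only [abs_mul, h1, ← Finset.mul_sum]
      change ((((invN N : ZInv N) ^ k * ∑ i, |(b i : ZInv N)| : ZInv N)) : ℚ) ≤ 1
      push_cast
      change ((N : ℚ)⁻¹) ^ k * ∑ i, |(b i : ℚ)| ≤ 1
      rw [inv_pow, inv_mul_le_iff₀ hN0, mul_one]
      exact hk.le
    let a : (AN N).op n := ⟨fun i => invN N ^ k * b i, hle⟩
    refine ⟨k, a, (embB N).coe_injective (funext fun i => ?_)⟩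
    · rw [(embB N).coe_scale, embB_ANincl, embB_ANincl, (embA N).coe_pow]
      rfl

/-- The chart `Spec A_N`. -/
def chartA (hN : 1 < N) : Opens (SpecZHat N).carrier :=
  ⟨Set.range (GluedSpec.inl (ANincl N) (Zincl N)), GluedSpec.isOpen_range_inl (by
    rw [(isAway_Zincl hN).range_comap embB_Zincl]
    exact isOpen_basicOpen _)⟩

/-- The chart `Spec ℤ`. -/
def chartZ (hN : 1 < N) : Opens (SpecZHat N).carrier :=
  ⟨Set.range (GluedSpec.inr (ANincl N) (Zincl N)), GluedSpec.isOpen_range_inr (by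
    rw [(isAway_ANincl hN).range_comap embB_ANincl]
    exact isOpen_basicOpen _)⟩

lemma chartA_sup_chartZ (hN : 1 < N) : chartA hN ⊔ chartZ hN = ⊤ := by
  refine eq_top_iff.2 fun z _ => ?_
  obtain ⟨x, rfl⟩ | ⟨x, rfl⟩ := GluedSpec.exists_rep z
  · exact Or.inl ⟨x, rfl⟩
  · exact Or.inr ⟨x, rfl⟩

variable (N) in
/-- The generic point. -/
def gen : (SpecZHat N).carrier := GluedSpec.inr (ANincl N) (Zincl N) embZ.generic

lemma gen_mem {U : Opens (SpecZHat N).carrier} {z : (SpecZHat N).carrier} (hz : z ∈ U) :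
    gen N ∈ U := GluedSpec.generic_mem embB_ANincl embB_Zincl hz

lemma gen_mem_chartA (hN : 1 < N) : gen N ∈ chartA hN :=
  gen_mem (z := GluedSpec.inl (ANincl N) (Zincl N) (embA N).generic) ⟨_, rfl⟩

lemma gen_mem_chartZ (hN : 1 < N) : gen N ∈ chartZ hN := ⟨_, rfl⟩

/-- The value at the generic point of a section of `𝒪(𝐧)`. -/
def val {U : Opens (SpecZHat N).carrier} (hU : gen N ∈ U) {n : ℕ}
    (c : ((SpecZHat N).O U).op n) : Fin n → ℚ :=
  (GluedSpec.val embZ U hU).app c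

variable {U : Opens (SpecZHat N).carrier} (hU : gen N ∈ U) {n : ℕ}

lemma val_var (i : Fin n) : val hU (((SpecZHat N).O U).var i) = Pi.single i 1 :=
  (GluedSpec.val embZ U hU).map_var i

lemma val_subst {m : ℕ} (t : ((SpecZHat N).O U).op n) (x : Fin n → ((SpecZHat N).O U).op m) :
    val hU (((SpecZHat N).O U).subst t x) = ∑ i, val hU t i • val hU (x i) := by
  refine ((GluedSpec.val embZ U hU).map_subst t x).trans (funext fun k => ?_)
  rw [Finset.sum_apply]
  rfl

lemma val_res {V : Opens (SpecZHat N).carrier} (h : V ≤ U) (hV : gen N ∈ V)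
    (c : ((SpecZHat N).O U).op n) : val hV (((SpecZHat N).res h).app c) = val hU c := rfl

lemma val_injective {c c' : ((SpecZHat N).O U).op n} (h : val hU c = val hU c') : c = c' :=
  GluedSpec.val_injective embB_ANincl embB_Zincl hU h

lemma pullsBackTo_iff (c : ((SpecZHat N).O U).op n) (b : Fin n → ZInv N) :
    GluedSpec.PullsBackTo c b ↔ val hU c = fun i => (b i : ℚ) :=
  GluedSpec.pullsBackTo_iff embB_ANincl embB_Zincl hU c b

/-- On `Spec ℤ[N⁻¹]` the three descriptions of the stalks agree. -/
lemma stalkSet_eq (hN : 1 < N) (y : PrimeSpec (ofRing (ZInv N))) :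
    (embA N).stalkSet (comap (ANincl N) y) n = embZ.stalkSet (comap (Zincl N) y) n := by
  rw [← (isAway_ANincl hN).stalkSet_eq embB_ANincl, ← (isAway_Zincl hN).stalkSet_eq embB_Zincl]

/-- A point of `Spec A_N` that lies in this chart comes from `Spec ℤ[N⁻¹]`, where the stalks of
`A_N` and `ℤ` coincide; only the conditions on `Spec ℤ` remain. -/
lemma exists_val_eq_of_le_chartZ (hN : 1 < N) (hUV : U ≤ chartZ hN) {v : Fin n → ℚ}
    (hv : ∀ x, GluedSpec.inr (ANincl N) (Zincl N) x ∈ U → v ∈ embZ.stalkSet x n) :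
    ∃ c : ((SpecZHat N).O U).op n, val hU c = v := by
  refine GluedSpec.exists_val_eq embB_ANincl embB_Zincl hU (fun x hx => ?_) hv
  obtain ⟨y, rfl⟩ := GluedSpec.inl_mem_range_inr_iff.1 (hUV hx)
  rw [stalkSet_eq hN]
  apply hv
  rwa [← GluedSpec.inl_comap]

lemma exists_val_eq_of_le_chartA (hN : 1 < N) (hUV : U ≤ chartA hN) {v : Fin n → ℚ}
    (hv : ∀ x, GluedSpec.inl (ANincl N) (Zincl N) x ∈ U → v ∈ (embA N).stalkSet x n) :
    ∃ c : ((SpecZHat N).O U).op n, val hU c = v := by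
  refine GluedSpec.exists_val_eq embB_ANincl embB_Zincl hU hv (fun x hx => ?_)
  obtain ⟨y, rfl⟩ := GluedSpec.inr_mem_range_inl_iff.1 (hUV hx)
  rw [← stalkSet_eq hN]
  apply hv
  rwa [GluedSpec.inl_comap]

lemma val_mem_stalkSet (c : ((SpecZHat N).O U).op n) {x : PrimeSpec (ofRing ℤ)}
    (hx : GluedSpec.inr (ANincl N) (Zincl N) x ∈ U) : val hU c ∈ embZ.stalkSet x n := by
  rw [val, ← GluedSpec.val_inr hU c x hx]
  exact embZ.fracVal_mem _ _

/-! ### Sections over the charts -/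

lemma exists_val_eq_int (hN : 1 < N) (hUV : U ≤ chartZ hN) (z : Fin n → ℤ) :
    ∃ c : ((SpecZHat N).O U).op n, val hU c = fun i => (z i : ℚ) :=
  exists_val_eq_of_le_chartZ hU hN hUV fun x _ => embZ.coe_mem x z

lemma val_chartZ (hN : 1 < N) (hUV : chartZ hN ≤ U) (c : ((SpecZHat N).O U).op n) :
    ∃ z : Fin n → ℤ, ∀ i, val hU c i = z i :=
  exists_coe_eq (Int.castRingHom ℚ) Int.cast_injective
    fun x => val_mem_stalkSet hU c (hUV ⟨x, rfl⟩)

lemma exists_val_eq_AN (hN : 1 < N) (hUV : U ≤ chartA hN) (a : (AN N).op n) :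
    ∃ c : ((SpecZHat N).O U).op n, val hU c = fun i => (a.1 i : ℚ) :=
  exists_val_eq_of_le_chartA hU hN hUV fun x _ => (embA N).coe_mem x a

lemma exists_val_eq_ZInv (hN : 1 < N) (hUV : U ≤ chartA hN ⊓ chartZ hN) (b : Fin n → ZInv N) :
    ∃ c : ((SpecZHat N).O U).op n, val hU c = fun i => (b i : ℚ) := by
  refine exists_val_eq_of_le_chartZ hU hN (hUV.trans inf_le_right) fun x hx => ?_
  obtain ⟨y, rfl⟩ := GluedSpec.inr_mem_range_inl_iff.1 (hUV hx).1
  rw [← (isAway_Zincl hN).stalkSet_eq embB_Zincl]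
  exact (embB N).coe_mem y b

lemma val_ZInv (hN : 1 < N) (hUV : chartA hN ⊓ chartZ hN ≤ U) (c : ((SpecZHat N).O U).op n) :
    ∃ b : Fin n → ZInv N, ∀ i, val hU c i = b i := by
  refine exists_coe_eq (ZInv N).val.toRingHom Subtype.val_injective fun y => ?_
  change _ ∈ (embB N).stalkSet y n
  rw [(isAway_Zincl hN).stalkSet_eq embB_Zincl]
  exact val_mem_stalkSet hU c (hUV ⟨⟨_, GluedSpec.inl_comap _ _ y⟩, ⟨_, rfl⟩⟩)

variable (N) in
/-- The maximal ideal `{|λ| < 1}` of `A_N`. -/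
def infty : PrimeSpec (AN N) where
  carrier := {a | |a.1 0| < 1}
  subst_mem {n} t x hx := by
    change |∑ i, t.1 i * (x i).1 0| < 1
    -- The strict inequality below needs a nonzero coefficient; if all coefficients vanish, the sum
    -- is `0` and the bound is trivial.
    by_cases h : ∑ i, |t.1 i| = 0
    · have h' : ∀ i, t.1 i = 0 := fun i => abs_eq_zero.1
        ((Finset.sum_eq_zero_iff_of_nonneg fun i _ => abs_nonneg _).1 h i (Finset.mem_univ i))
      simp [h']
    · obtain ⟨i, -, hi⟩ := Finset.exists_ne_zero_of_sum_ne_zero h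
      calc |∑ i, t.1 i * (x i).1 0| ≤ ∑ i, |t.1 i| * |(x i).1 0| := by
            simpa only [abs_mul] using
              Finset.abs_sum_le_sum_abs (fun i => t.1 i * (x i).1 0) Finset.univ
        _ < ∑ i, |t.1 i| := by
            refine Finset.sum_lt_sum
              (fun k _ => mul_le_of_le_one_right (abs_nonneg _) (le_of_lt (hx k)))
              ⟨i, Finset.mem_univ i, ?_⟩
            exact mul_lt_of_lt_one_right (lt_of_le_of_ne (abs_nonneg _) hi.symm) (hx i)
        _ ≤ 1 := t.2
  one_notMem := by
    change ¬ |(1 : (ofRing (ZInv N)).op 1) 0| < 1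
    rw [ofRing_one_apply]
    simp
  mul_notMem a b ha hb := by
    have hle : ∀ a : (AN N).op 1, |a.1 0| ≤ 1 := fun a => by simpa using a.2
    have ha' : |a.1 0| = 1 := le_antisymm (hle a) (not_lt.1 ha)
    have hb' : |b.1 0| = 1 := le_antisymm (hle b) (not_lt.1 hb)
    have h1 : (a * b).1 0 = a.1 0 * b.1 0 := Fin.sum_univ_one (fun i => a.1 i * b.1 0)
    change ¬ |(a * b).1 0| < 1
    rw [h1, abs_mul, ha', hb']
    simp

/-- An element outside `infty` has absolute value `1`, so its square is `1` and no prime contains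
it. Every prime is therefore contained in `infty`, and open sets are stable under generization. -/
lemma chartA_le_of_infty_mem (hN : 1 < N)
    (h : GluedSpec.inl (ANincl N) (Zincl N) (infty N) ∈ U) : chartA hN ≤ U := by
  rintro _ ⟨x, rfl⟩
  refine mem_of_le (U.2.preimage (GluedSpec.continuous_inl _ _)) (fun a ha => ?_) h
  by_contra hn
  have hle : |a.1 0| ≤ 1 := by simpa using a.2
  have h1 : |a.1 0| = 1 := le_antisymm hle (not_lt.1 hn)
  refine x.one_notMem ?_
  have : a * a = 1 := Subtype.ext (funext fun i => by
    have h2 : (a * a).1 0 = a.1 0 * a.1 0 := Fin.sum_univ_one (fun i => a.1 i * a.1 0)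
    have h3 : (1 : (AN N).op 1).1 0 = 1 := ofRing_one_apply
    rw [Subsingleton.elim i 0, h2, h3, ← abs_mul_abs_self, h1, one_mul])
  rw [← this]
  exact x.mul_mem a ha

/-- Denominators `s` at `infty` satisfy `s² = 1`, so `a / s = s a` already lies in `A_N(𝐧)`:
regularity at this single point suffices. -/
lemma val_chartA (hN : 1 < N) (hUV : chartA hN ≤ U) (c : ((SpecZHat N).O U).op n) :
    ∃ a : (AN N).op n, ∀ i, val hU c i = a.1 i := by
  have hx : GluedSpec.inl (ANincl N) (Zincl N) (infty N) ∈ U := hUV ⟨_, rfl⟩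
  have h := (embA N).fracVal_mem (infty N) (c.1.1.1 ⟨_, hx⟩)
  rw [GluedSpec.val_inl embB_ANincl embB_Zincl hU c _ hx] at h
  obtain ⟨a, s, hs, h⟩ := h
  have hle : |s.1 0| ≤ 1 := by simpa using s.2
  have h1 : |s.1 0| = 1 := le_antisymm hle (not_lt.1 hs)
  have h2 : s.1 0 * s.1 0 = 1 := by rw [← abs_mul_abs_self, h1, one_mul]
  refine ⟨(AN N).scale s a, fun i => ?_⟩
  rw [← embA_coe, (embA N).coe_scale, ← h, ← mul_assoc, embA_coe]
  have h3 : ((s.1 0 : ZInv N) : ℚ) * (s.1 0 : ZInv N) = 1 := by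
    exact_mod_cast congrArg Subtype.val h2
  rw [h3, one_mul]
  rfl

end SpecZHat

/-! ### Lattices in `ℚ^r` -/

/-- Bounded denominators put `L` inside `D⁻¹ℤ^r`, so `L` is finitely generated and torsion-free,
hence free over `ℤ`. A `ℤ`-basis stays independent over `ℚ`, and it spans by `hspan`, so the rank is
`r`. -/
lemma exists_lattice_basis {r : ℕ} (L : Submodule ℤ (Fin r → ℚ)) {D : ℤ} (hD : D ≠ 0)
    (hL : ∀ v ∈ L, ∃ a : Fin r → ℤ, ∀ k, (D : ℚ) * v k = a k)
    (hspan : ∀ v : Fin r → ℚ, ∃ d : ℤ, d ≠ 0 ∧ d • v ∈ L) :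
    ∃ h : Module.Basis (Fin r) ℚ (Fin r → ℚ), (∀ i, h i ∈ L) ∧
      ∀ v ∈ L, ∃ z : Fin r → ℤ, v = ∑ i, (z i : ℚ) • h i := by
  have hD' : (D : ℚ) ≠ 0 := by exact_mod_cast hD
  let f : (Fin r → ℤ) →ₗ[ℤ] (Fin r → ℚ) :=
    { toFun := fun a k => (a k : ℚ) / D
      map_add' := fun a b => by
        funext k
        simp [add_div]
      map_smul' := fun c a => by
        funext k
        simp [mul_div_assoc] }
  have hle : L ≤ LinearMap.range f := fun v hv => by
    obtain ⟨a, ha⟩ := hL v hv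
    refine ⟨a, funext fun k => ?_⟩
    change (a k : ℚ) / D = v k
    rw [← ha, mul_div_cancel_left₀ _ hD']
  have : IsNoetherian ℤ L := isNoetherian_of_le hle
  have : Module.Free ℤ L := inferInstance
  let b := Module.finBasis ℤ L
  have hli : LinearIndependent ℚ (fun i => (b i : Fin r → ℚ)) := by
    rw [← LinearIndependent.iff_fractionRing (R := ℤ)]
    exact b.linearIndependent.map' L.subtype (Submodule.ker_subtype L)
  have hsum : ∀ v ∈ L, ∃ z : Fin (Module.finrank ℤ L) → ℤ,
      v = ∑ i, (z i : ℚ) • (b i : Fin r → ℚ) := fun v hv => by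
    refine ⟨b.repr ⟨v, hv⟩, ?_⟩
    refine (congrArg Subtype.val (b.sum_repr ⟨v, hv⟩)).symm.trans ?_
    push_cast
    exact Finset.sum_congr rfl fun i _ => by rw [Int.cast_smul_eq_zsmul]
  have hsp : ⊤ ≤ Submodule.span ℚ (Set.range fun i => (b i : Fin r → ℚ)) := fun v _ => by
    obtain ⟨d, hd, hdv⟩ := hspan v
    obtain ⟨z, hz⟩ := hsum _ hdv
    have hd' : (d : ℚ) ≠ 0 := by exact_mod_cast hd
    have : v = (d : ℚ)⁻¹ • (d • v) := by
      rw [← Int.cast_smul_eq_zsmul ℚ, smul_smul, inv_mul_cancel₀ hd', one_smul]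
    rw [this, hz]
    exact Submodule.smul_mem _ _ (Submodule.sum_mem _ fun i _ =>
      Submodule.smul_mem _ _ (Submodule.subset_span ⟨i, rfl⟩))
  let b' := Module.Basis.mk hli hsp
  have hcard : Module.finrank ℤ L = r := by
    have := Module.finrank_eq_card_basis b'
    simpa using this.symm
  refine ⟨b'.reindex (finCongr hcard), fun i => ?_, fun v hv => ?_⟩
  · rw [Module.Basis.reindex_apply, Module.Basis.mk_apply]
    exact (b _).2
  · obtain ⟨z, hz⟩ := hsum v hv
    refine ⟨fun i => z ((finCongr hcard).symm i), ?_⟩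
    rw [hz, ← Equiv.sum_comp (finCongr hcard)]
    simp [b']

namespace SpecZHat

open GenRing PrimeSpec OModule

variable {N r : ℕ} {E : OModule (SpecZHat N)}

/-! ### Stalks over `Spec ℤ` -/

/-- The stalk of `𝒪(𝐫)` at a point of `Spec ℤ` as a subgroup of `ℚ^r`. -/
def stalkModule (x : PrimeSpec (ofRing ℤ)) (r : ℕ) : Submodule ℤ (Fin r → ℚ) where
  carrier := embZ.stalkSet x r
  zero_mem' := ⟨vec fun _ => 0, 1, x.one_notMem, fun k => by
    rw [Pi.zero_apply, mul_zero]
    exact Int.cast_zero.symm⟩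
  add_mem' := by
    rintro v w ⟨a, s, hs, h⟩ ⟨b, t, ht, h'⟩
    refine ⟨vec fun k => t 0 * a k + s 0 * b k, s * t, x.mul_notMem _ _ hs ht, fun k => ?_⟩
    have h1 : (embZ.coe a k : ℚ) = (a k : ℤ) := rfl
    have h2 : (embZ.coe b k : ℚ) = (b k : ℤ) := rfl
    have h3 : (embZ.coe s 0 : ℚ) = (s 0 : ℤ) := rfl
    have h4 : (embZ.coe t 0 : ℚ) = (t 0 : ℤ) := rfl
    have e : embZ.coe (vec fun k => t 0 * a k + s 0 * b k) k =
        ((t 0 * a k + s 0 * b k : ℤ) : ℚ) := rfl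
    rw [e, embZ.coe_mul]
    push_cast
    rw [← h1, ← h2, ← h, ← h', ← h3, ← h4, Pi.add_apply]
    ring
  smul_mem' := by
    rintro c v ⟨a, s, hs, h⟩
    refine ⟨vec fun k => c * a k, s, hs, fun k => ?_⟩
    have h1 : (embZ.coe a k : ℚ) = (a k : ℤ) := rfl
    have e : embZ.coe (vec fun k => c * a k) k = ((c * a k : ℤ) : ℚ) := rfl
    rw [e]
    push_cast
    rw [← h1, ← h, Pi.smul_apply, zsmul_eq_mul]
    ring

lemma mem_stalkModule {x : PrimeSpec (ofRing ℤ)} {v : Fin r → ℚ} :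
    v ∈ stalkModule x r ↔
      ∃ s : ℤ, vec (fun _ => s) ∉ x.carrier ∧ ∃ a : Fin r → ℤ, ∀ k, (s : ℚ) * v k = a k := by
  constructor
  · rintro ⟨a, s, hs, h⟩
    have hc : vec (fun _ => s 0) = s := funext fun i => by rw [Subsingleton.elim i 0]; rfl
    exact ⟨s 0, by rwa [hc], a, h⟩
  · rintro ⟨s, hs, a, h⟩
    exact ⟨a, _, hs, h⟩

lemma vec_mul (s t : ℤ) : vec (fun _ : Fin 1 => s * t) = vec (fun _ => s) * vec (fun _ => t) :=
  embZ.coe_injective (funext fun i => by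
    rw [Subsingleton.elim i 0, embZ.coe_mul]
    exact Int.cast_mul s t)

lemma mem_stalkModule_of_smul {x : PrimeSpec (ofRing ℤ)} {q : ℤ}
    (hq : vec (fun _ => q) ∉ x.carrier)
    {v : Fin r → ℚ} (h : q • v ∈ stalkModule x r) : v ∈ stalkModule x r := by
  obtain ⟨s, hs, a, h⟩ := mem_stalkModule.1 h
  refine mem_stalkModule.2 ⟨s * q, ?_, a, fun k => ?_⟩
  · rw [vec_mul]
    exact x.mul_notMem _ _ hs hq
  · rw [← h, Pi.smul_apply, zsmul_eq_mul]
    push_cast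
    ring

/-- The points of `Spec ℤ` are the zero ideal and the ideals generated by prime numbers. For each
point `x` and `d ≠ 0` there is a decomposition `d = p d'` with `d' ∉ x` and `p` invertible outside
of `x`. -/
lemma exists_eq_mul (x : PrimeSpec (ofRing ℤ)) {d : ℤ} (hd : d ≠ 0) :
    ∃ p d' : ℤ, d = p * d' ∧ vec (fun _ => d') ∉ x.carrier ∧
      ∀ x', x' ≠ x → vec (fun _ => p) ∉ x'.carrier := by
  obtain ⟨P, rfl⟩ := ofPrime_surjective x
  by_cases hP : P.asIdeal = ⊥
  · refine ⟨1, d, (one_mul d).symm, fun h => hd ?_, fun x' _ => ?_⟩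
    · have h : d ∈ P.asIdeal := h
      rwa [hP] at h
    have h1 : vec (fun _ : Fin 1 => (1 : ℤ)) = 1 := embZ.coe_injective (funext fun i => by
      rw [Subsingleton.elim i 0, embZ.coe_one]
      exact Int.cast_one)
    rw [h1]
    exact x'.one_notMem
  · obtain ⟨p, hp⟩ := (inferInstance : P.asIdeal.IsPrincipal)
    have hp' : P.asIdeal = Ideal.span {p} := hp
    have hp0 : p ≠ 0 := by
      rintro rfl
      exact hP (by simpa using hp')
    have hpp : Prime p := (Ideal.span_singleton_prime hp0).1 (hp' ▸ P.2)
    obtain ⟨d', hd', hdd⟩ := (Int.finiteMultiplicity_iff.2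
      ⟨fun h => hpp.not_isUnit (Int.isUnit_iff_natAbs_eq.2 h), hd⟩).exists_eq_pow_mul_and_not_dvd
    refine ⟨p ^ _, d', hd', fun h => hdd ?_, fun x' hx' h => ?_⟩
    · have h : d' ∈ P.asIdeal := h
      rwa [hp', Ideal.mem_span_singleton] at h
    · obtain ⟨P', rfl⟩ := ofPrime_surjective x'
      have h' : p ∈ P'.asIdeal := P'.2.mem_of_pow_mem _ h
      -- Nonzero primes of `ℤ` are maximal, so a prime that contains `p` must be `P` itself.
      have hmax : P.asIdeal.IsMaximal := P.2.isMaximal hP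
      have : P.asIdeal = P'.asIdeal := hmax.eq_of_le P'.2.ne_top (by
        rw [hp', Ideal.span_singleton_le_iff_mem]
        exact h')
      exact hx' (congrArg ofPrime (PrimeSpectrum.ext this.symm))

/-! ### Values of sections of vector bundles at the generic point -/

lemma eq_empty {W : Opens (SpecZHat N).carrier} (h : gen N ∉ W) (x : (SpecZHat N).carrier) :
    x ∉ W := fun hx => h (gen_mem hx)

lemma gen_mem_inf {U V : Opens (SpecZHat N).carrier} (hU : gen N ∈ U) (hV : gen N ∈ V) :
    gen N ∈ U ⊓ V := ⟨hU, hV⟩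

section

variable {W₀ : Opens (SpecZHat N).carrier} {e₀ : Fin r → E.obj W₀} (h₀ : gen N ∈ W₀)
  (he₀ : IsBasis E W₀ e₀)

/-- The value at the generic point of a section of `E`, in terms of a basis near this point. -/
def bval {W : Opens (SpecZHat N).carrier} (hW : gen N ∈ W) (s : E.obj W) : Fin r → ℚ :=
  val (gen_mem_inf hW h₀) (he₀.coord inf_le_right (E.res inf_le_left s))

lemma bval_act {W : Opens (SpecZHat N).carrier} (hW : gen N ∈ W) {n : ℕ}
    (t : ((SpecZHat N).O W).op n) (s : Fin n → E.obj W) :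
    bval h₀ he₀ hW ((E.str W).act t s) = ∑ i, val hW t i • bval h₀ he₀ hW (s i) := by
  rw [bval, E.res_act, he₀.coord_act, val_subst]
  rfl

lemma bval_res {V W : Opens (SpecZHat N).carrier} (h : V ≤ W) (hV : gen N ∈ V) (hW : gen N ∈ W)
    (s : E.obj W) : bval h₀ he₀ hV (E.res h s) = bval h₀ he₀ hW s := by
  have h1 : E.res (inf_le_left : V ⊓ W₀ ≤ V) (E.res h s) =
      E.res (inf_le_inf_right W₀ h) (E.res (inf_le_left : W ⊓ W₀ ≤ W) s) := by
    rw [E.res_res, E.res_res]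
  rw [bval, h1, he₀.coord_res (inf_le_inf_right W₀ h) inf_le_right]
  rfl

lemma bval_basis (i : Fin r) : bval h₀ he₀ h₀ (e₀ i) = Pi.single i 1 := by
  rw [bval, he₀.coord_eq (t := ((SpecZHat N).O _).var i), val_var]
  rw [(E.str _).var_act]

/-- Near each point of `W` the coordinates in a local trivialization are vectors in `ℚ^r`,
determined by their restriction to `W₀`. The equality is assumed only when `gen N ∈ W`; an empty `W`
has just one section. -/
lemma eq_of_bval_eq (hE : E.IsVectorBundle r) {W : Opens (SpecZHat N).carrier} {s t : E.obj W}
    (h : ∀ hW : gen N ∈ W, bval h₀ he₀ hW s = bval h₀ he₀ hW t) : s = t := by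
  refine ext_of_mem fun z hz => ?_
  obtain ⟨U, hzU, ⟨τ⟩⟩ := hE z
  have hW := gen_mem hz
  have hU := gen_mem hzU
  refine ⟨W ⊓ U, inf_le_left, ⟨hz, hzU⟩, ?_⟩
  have h1 : E.res (inf_le_left : W ⊓ W₀ ≤ W) s = E.res (inf_le_left : W ⊓ W₀ ≤ W) t := by
    rw [← he₀.act_coord inf_le_right (E.res (inf_le_left : W ⊓ W₀ ≤ W) s),
      ← he₀.act_coord inf_le_right (E.res (inf_le_left : W ⊓ W₀ ≤ W) t),
      val_injective _ (h hW)]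
  have h2 : τ.isBasis.coord inf_le_right (E.res (inf_le_left : W ⊓ U ≤ W) s) =
      τ.isBasis.coord inf_le_right (E.res (inf_le_left : W ⊓ U ≤ W) t) := by
    apply val_injective (gen_mem_inf hW hU)
    have hle : W ⊓ U ⊓ W₀ ≤ W ⊓ U := inf_le_left
    rw [← val_res _ hle (gen_mem_inf (gen_mem_inf hW hU) h₀),
      ← val_res _ hle (gen_mem_inf (gen_mem_inf hW hU) h₀),
      ← τ.isBasis.coord_res hle inf_le_right, ← τ.isBasis.coord_res hle inf_le_right,
      E.res_res, E.res_res, ← E.res_res (inf_le_inf_right W₀ inf_le_left) inf_le_left s,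
      ← E.res_res (inf_le_inf_right W₀ inf_le_left) inf_le_left t, h1]
  rw [← τ.isBasis.act_coord inf_le_right (E.res (inf_le_left : W ⊓ U ≤ W) s), h2,
    τ.isBasis.act_coord]

/-- Over `U ⊓ W₀` each `e₀ i`, whose value is a standard basis vector, is a combination of the `e
k`. -/
lemma span_bval {U : Opens (SpecZHat N).carrier} {e : Fin r → E.obj U} (hU : gen N ∈ U)
    (he : IsBasis E U e) : ⊤ ≤ Submodule.span ℚ (Set.range fun i => bval h₀ he₀ hU (e i)) := by
  rw [← (Pi.basisFun ℚ (Fin r)).span_eq, Submodule.span_le]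
  rintro _ ⟨i, rfl⟩
  have hg : gen N ∈ U ⊓ W₀ := gen_mem_inf hU h₀
  have h1 := congrArg (bval h₀ he₀ hg)
    (he.act_coord inf_le_left (E.res (inf_le_right : U ⊓ W₀ ≤ W₀) (e₀ i)))
  rw [bval_act, bval_res _ _ _ _ h₀, bval_basis] at h1
  rw [Pi.basisFun_apply, ← h1]
  refine Submodule.sum_mem _ fun k _ => Submodule.smul_mem _ _ ?_
  rw [bval_res _ _ _ _ hU]
  exact Submodule.subset_span ⟨k, rfl⟩

/-- The basis of `ℚ^r` given by a basis of `E` over an open set. -/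
def ratBasis {U : Opens (SpecZHat N).carrier} {e : Fin r → E.obj U} (hU : gen N ∈ U)
    (he : IsBasis E U e) : Module.Basis (Fin r) ℚ (Fin r → ℚ) :=
  basisOfTopLeSpanOfCardEqFinrank _ (span_bval h₀ he₀ hU he) (by simp)

lemma ratBasis_apply {U : Opens (SpecZHat N).carrier} {e : Fin r → E.obj U} (hU : gen N ∈ U)
    (he : IsBasis E U e) (i : Fin r) : ratBasis h₀ he₀ hU he i = bval h₀ he₀ hU (e i) :=
  congrFun (coe_basisOfTopLeSpanOfCardEqFinrank _ (span_bval h₀ he₀ hU he) (by simp)) i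

lemma ratBasis_repr_act {U W : Opens (SpecZHat N).carrier} {e : Fin r → E.obj U} (hU : gen N ∈ U)
    (he : IsBasis E U e) (hW : gen N ∈ W) (h : W ≤ U) (t : ((SpecZHat N).O W).op r) :
    ⇑((ratBasis h₀ he₀ hU he).repr
      (bval h₀ he₀ hW ((E.str W).act t fun i => E.res h (e i)))) = val hW t := by
  rw [bval_act]
  simp only [bval_res _ _ _ _ hU, ← ratBasis_apply h₀ he₀ hU he]
  exact (ratBasis h₀ he₀ hU he).repr_sum_self _

lemma ratBasis_repr_mem {U W : Opens (SpecZHat N).carrier} {e : Fin r → E.obj U} (hU : gen N ∈ U)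
    (he : IsBasis E U e) (hW : gen N ∈ W) (s : E.obj W) {x : PrimeSpec (ofRing ℤ)}
    (hx : GluedSpec.inr (ANincl N) (Zincl N) x ∈ W ⊓ U) :
    ⇑((ratBasis h₀ he₀ hU he).repr (bval h₀ he₀ hW s)) ∈ stalkModule x r := by
  have hg : gen N ∈ W ⊓ U := gen_mem hx
  rw [← bval_res h₀ he₀ inf_le_left hg hW, ← he.act_coord inf_le_right (E.res inf_le_left s),
    ratBasis_repr_act h₀ he₀ hU he hg inf_le_right]
  exact val_mem_stalkSet hg _ hx

end

/-! ### Vector bundles are trivial over the charts -/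

/-- `Spec A_N` is local: a trivialization near `infty` is defined on the whole chart. -/
lemma exists_isBasis_chartA (hN : 1 < N) (hE : E.IsVectorBundle r) :
    ∃ e : Fin r → E.obj (chartA hN), IsBasis E (chartA hN) e := by
  obtain ⟨U, hU, ⟨τ⟩⟩ := hE (GluedSpec.inl (ANincl N) (Zincl N) (infty N))
  exact ⟨_, τ.isBasis.restrict (chartA_le_of_infty_mem hN hU)⟩

lemma exists_finite_cover (hE : E.IsVectorBundle r) :
    ∃ (T : Finset (PrimeSpec (ofRing ℤ))) (U : T → Opens (SpecZHat N).carrier)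
      (e : (k : T) → Fin r → E.obj (U k)), (∀ k, IsBasis E (U k) (e k)) ∧
      (∀ k, gen N ∈ U k) ∧ ∀ x, ∃ k, GluedSpec.inr (ANincl N) (Zincl N) x ∈ U k := by
  choose U hU τ using fun x => hE (GluedSpec.inr (ANincl N) (Zincl N) x)
  obtain ⟨T, hT⟩ := isCompact_univ.elim_finite_subcover
    (fun x => {x' | GluedSpec.inr (ANincl N) (Zincl N) x' ∈ U x})
    (fun x => (U x).2.preimage (GluedSpec.continuous_inr _ _))
    (fun x _ => Set.mem_iUnion.2 ⟨x, hU x⟩)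
  refine ⟨T, fun k => U k, fun k => (τ k).some.basis, fun k => (τ k).some.isBasis,
    fun k => gen_mem (hU k), fun x => ?_⟩
  obtain ⟨y, hy, hxy⟩ := Set.mem_iUnion₂.1 (hT (Set.mem_univ x))
  exact ⟨⟨y, hy⟩, hxy⟩

lemma exists_common_denominator {ι : Type} [Finite ι] (v : ι → ℚ) :
    ∃ d : ℤ, d ≠ 0 ∧ ∀ i, ∃ a : ℤ, (d : ℚ) * v i = a := by
  have := Fintype.ofFinite ι
  classical
  refine ⟨∏ i, ((v i).den : ℤ), Finset.prod_ne_zero_iff.2 fun i _ => by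
    exact_mod_cast (v i).den_nz, fun i =>
    ⟨(∏ k ∈ Finset.univ.erase i, ((v k).den : ℤ)) * (v i).num, ?_⟩⟩
  rw [← Finset.prod_erase_mul _ _ (Finset.mem_univ i)]
  push_cast
  rw [mul_assoc, mul_comm ((v i).den : ℚ), Rat.mul_den_eq_num]

/-- Inside the generic fibre `ℚ^r`, the vectors regular at every point of `Spec ℤ` form a lattice
`L`, which is the module of global sections over this chart. A `ℤ`-basis of `L` also generates each
stalk, because a denominator can be split into a part invertible at the point and a part invertible
at all other points. -/
lemma exists_isBasis_chartZ (hN : 1 < N) (hE : E.IsVectorBundle r) :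
    ∃ f : Fin r → E.obj (chartZ hN), IsBasis E (chartZ hN) f := by
  obtain ⟨W₀, h₀, ⟨τ₀⟩⟩ := hE (gen N)
  have he₀ := τ₀.isBasis
  obtain ⟨T, U, e, he, hU, hT⟩ := exists_finite_cover hE
  let b := fun k => ratBasis h₀ he₀ (hU k) (he k)
  let L : Submodule ℤ (Fin r → ℚ) :=
    { carrier := {v | ∀ k x, GluedSpec.inr (ANincl N) (Zincl N) x ∈ U k →
        ⇑((b k).repr v) ∈ stalkModule x r}
      zero_mem' := fun k x _ => by
        simp only [map_zero, Finsupp.coe_zero]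
        exact zero_mem _
      add_mem' := fun {v w} hv hw k x hx => by
        simp only [map_add, Finsupp.coe_add]
        exact add_mem (hv k x hx) (hw k x hx)
      smul_mem' := fun c v hv k x hx => by
        simp only [map_zsmul, Finsupp.coe_smul]
        exact Submodule.smul_mem _ c (hv k x hx) }
  have hglob : ∀ v ∈ L, ∃ s : E.obj (chartZ hN), bval h₀ he₀ (gen_mem_chartZ hN) s = v := by
    intro v hv
    have hk : ∀ k, ∃ s : E.obj (U k ⊓ chartZ hN),
        bval h₀ he₀ (gen_mem_inf (hU k) (gen_mem_chartZ hN)) s = v := by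
      intro k
      have hg := gen_mem_inf (hU k) (gen_mem_chartZ hN)
      obtain ⟨c, hc⟩ := exists_val_eq_of_le_chartZ hg hN inf_le_right
        (fun x hx => hv k x hx.1)
      refine ⟨(E.str _).act c fun i => E.res inf_le_left (e k i), ?_⟩
      apply (b k).repr.injective
      apply DFunLike.coe_injective
      rw [ratBasis_repr_act, hc]
    choose s hs using hk
    have hx : ∀ x : chartZ hN, ∃ k, x.1 ∈ U k := by
      rintro ⟨_, x, rfl⟩
      exact hT x
    choose k hk using hx
    obtain ⟨t, ht⟩ := exists_glue_of_mem (E := E) (fun x => U (k x) ⊓ chartZ hN)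
      (fun _ => inf_le_right) (fun x => ⟨hk x, x.2⟩) (fun x => s (k x))
      (fun i j W' hi hj => eq_of_bval_eq h₀ he₀ hE fun hW => by
        rw [bval_res _ _ _ _ (hi hW), bval_res _ _ _ _ (hj hW), hs, hs])
    refine ⟨t, ?_⟩
    have := ht ⟨gen N, gen_mem_chartZ hN⟩
    rw [← bval_res h₀ he₀ inf_le_right (gen_mem_inf (hU _) (gen_mem_chartZ hN)) _ t, this, hs]
  have hdenom : ∀ v : Fin r → ℚ, ∃ d : ℤ, d ≠ 0 ∧ d • v ∈ L := by
    intro v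
    obtain ⟨d, hd, h⟩ := exists_common_denominator (fun p : T × Fin r => (b p.1).repr v p.2)
    choose a ha using h
    refine ⟨d, hd, fun k x _ => ?_⟩
    have : ⇑((b k).repr (d • v)) = fun i => ((a (k, i) : ℤ) : ℚ) := by
      funext i
      rw [map_zsmul, Finsupp.smul_apply, zsmul_eq_mul]
      exact ha (k, i)
    rw [this]
    exact embZ.coe_mem x (vec fun i => a (k, i))
  -- `D` clears the denominators of the finitely many local bases, written in the reference basis
  -- `e₀`.
  obtain ⟨D, hD, hDa⟩ := exists_common_denominator
    (fun p : T × Fin r × Fin r => bval h₀ he₀ (hU p.1) (e p.1 p.2.1) p.2.2)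
  choose A hA using hDa
  have hbound : ∀ v ∈ L, ∃ a : Fin r → ℤ, ∀ k, (D : ℚ) * v k = a k := by
    -- At each point `v` is a combination of some local basis with coefficients in the stalk, so `D
    -- v` is regular there; a vector regular everywhere is integral.
    intro v hv
    refine exists_coe_eq (Int.castRingHom ℚ) Int.cast_injective (v := fun k => (D : ℚ) * v k)
      fun x => ?_
    obtain ⟨k, hk⟩ := hT x
    obtain ⟨s, hs, a, h⟩ := mem_stalkModule.1 (hv k x hk)
    refine mem_stalkModule.2 ⟨s, hs, fun i => ∑ l, a l * A (k, l, i), fun i => ?_⟩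
    have hv' := congrFun ((b k).sum_repr v) i
    simp only [Finset.sum_apply, Pi.smul_apply, smul_eq_mul, b, ratBasis_apply] at hv'
    push_cast
    rw [← hv', Finset.mul_sum, Finset.mul_sum]
    refine Finset.sum_congr rfl fun l _ => ?_
    rw [← h, ← hA]
    simp only [b]
    ring
  obtain ⟨h, hL, hLZ⟩ := exists_lattice_basis L hD hbound hdenom
  choose f hf using fun i => hglob _ (hL i)
  refine ⟨f, fun W hW => ?_⟩
  by_cases hg : gen N ∈ W
  · have hact : ∀ t : ((SpecZHat N).O W).op r,
        bval h₀ he₀ hg ((E.str W).act t fun i => E.res hW (f i)) = ∑ i, val hg t i • h i := by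
      intro t
      rw [bval_act]
      simp only [bval_res _ _ _ _ (gen_mem_chartZ hN), hf]
    refine ⟨fun t t' htt => val_injective hg ?_, fun s => ?_⟩
    · have h1 := congrArg (bval h₀ he₀ hg) htt
      simp only [hact] at h1
      have h2 := congrArg (fun v => ⇑(h.repr v)) h1
      simp only [h.repr_sum_self] at h2
      exact h2
    · have key : ∀ x, GluedSpec.inr (ANincl N) (Zincl N) x ∈ W →
          ⇑(h.repr (bval h₀ he₀ hg s)) ∈ embZ.stalkSet x r := by
        intro x hx
        -- Write `d = p q` with `q` outside `x` and `p` invertible at all other points. Then `q s`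
        -- is regular at `x` because `s` is, and elsewhere because `p q s` is. So `q s` lies in `L`,
        -- and dividing by `q` is allowed in the stalk at `x`.
        obtain ⟨d, hd, hdL⟩ := hdenom (bval h₀ he₀ hg s)
        obtain ⟨p, q, rfl, hq, hp⟩ := exists_eq_mul x hd
        have hqL : q • bval h₀ he₀ hg s ∈ L := by
          intro k x' hx'
          by_cases hxx : x' = x
          · subst hxx
            simp only [map_zsmul, Finsupp.coe_smul]
            exact Submodule.smul_mem _ q (ratBasis_repr_mem h₀ he₀ (hU k) (he k) hg s ⟨hx, hx'⟩)
          · refine mem_stalkModule_of_smul (hp x' hxx) ?_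
            have := hdL k x' hx'
            rwa [mul_smul, map_zsmul, Finsupp.coe_smul] at this
        obtain ⟨z, hz⟩ := hLZ _ hqL
        refine mem_stalkModule.2 ⟨q, hq, z, fun k => ?_⟩
        have h3 := congrFun (congrArg (fun v => ⇑(h.repr v)) hz) k
        simp only [h.repr_sum_self] at h3
        rw [← h3, map_zsmul, Finsupp.smul_apply, zsmul_eq_mul]
      obtain ⟨t, ht⟩ := exists_val_eq_of_le_chartZ hg hN hW key
      refine ⟨t, eq_of_bval_eq h₀ he₀ hE fun _ => ?_⟩
      rw [hact, ht]
      exact h.sum_repr _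
  -- An open set without the generic point is empty; there both the free module and `E` have exactly
  -- one section.
  · refine ⟨fun t t' _ => ?_, fun s => ?_⟩
    · exact ext_of_mem (E := free _ r) fun x hx => absurd hx (eq_empty hg x)
    · obtain ⟨t, -⟩ := exists_glue_of_mem (E := free (SpecZHat N) r) (W := W) (fun _ => W)
        (fun _ => le_rfl) (fun x => x.2) (fun x => absurd x.2 (eq_empty hg x))
        (fun i => absurd i.2 (eq_empty hg i))
      exact ⟨t, ext_of_mem fun x hx => absurd hx (eq_empty hg x)⟩

end SpecZHat

/-! ### The symmetries of the octahedron -/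

section Octahedron

variable {r : ℕ}

/-- From `1 = ∑ P i j * Q j i ≤ ∑ |P i j| ≤ 1`, using `|Q j i| ≤ 1`, equality holds termwise: `P i j
* Q j i = |P i j|`. By symmetry this also equals `|Q j i|`. -/
lemma eq_transpose_of_row_sum_le {P Q : Matrix (Fin r) (Fin r) ℝ} (hPQ : P * Q = 1)
    (hQP : Q * P = 1) (hP : ∀ i, ∑ j, |P i j| ≤ 1) (hQ : ∀ i, ∑ j, |Q i j| ≤ 1) :
    Q = P.transpose := by
  have key : ∀ {P Q : Matrix (Fin r) (Fin r) ℝ}, P * Q = 1 → (∀ i, ∑ j, |P i j| ≤ 1) →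
      (∀ i, ∑ j, |Q i j| ≤ 1) → ∀ i j, P i j * Q j i = |P i j| := by
    intro P Q hPQ hP hQ i j
    have h1 : ∑ j, P i j * Q j i = 1 := by
      have := congrFun (congrFun hPQ i) i
      rwa [Matrix.mul_apply, Matrix.one_apply_eq] at this
    have h2 : ∀ j, P i j * Q j i ≤ |P i j| := fun j => by
      have h3 : |Q j i| ≤ 1 :=
        (Finset.single_le_sum (fun k _ => abs_nonneg (Q j k)) (Finset.mem_univ i)).trans (hQ j)
      calc P i j * Q j i ≤ |P i j * Q j i| := le_abs_self _
        _ = |P i j| * |Q j i| := abs_mul _ _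
        _ ≤ |P i j| := mul_le_of_le_one_right (abs_nonneg _) h3
    have h4 : ∑ j, P i j * Q j i = ∑ j, |P i j| :=
      le_antisymm (Finset.sum_le_sum fun j _ => h2 j) (h1 ▸ hP i)
    exact (Finset.sum_eq_sum_iff_of_le fun j _ => h2 j).1 h4 j (Finset.mem_univ j)
  ext j i
  rw [Matrix.transpose_apply]
  have h1 := key hPQ hP hQ i j
  have h2 := key hQP hQ hP j i
  have h3 := sq_abs (P i j)
  have h4 := sq_abs (Q j i)
  have h5 : |P i j| * |Q j i| = |P i j| := by rw [← abs_mul, h1, abs_abs]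
  have h6 : |P i j| = |Q j i| := by rw [← h1, ← h2, mul_comm]
  rw [← h6] at h4 h5
  -- With `x = |P i j| = |Q j i|` and `x² = x`, the square expands to `2 x² - 2 x = 0`.
  have : (Q j i - P i j) ^ 2 = 0 := by linear_combination -h3 - h4 - 2 * h1 + 2 * h5
  exact sub_eq_zero.1 (pow_eq_zero_iff two_ne_zero |>.1 this)

lemma col_sum_le_of_mem_octReal {g : GL (Fin r) ℝ} (hg : g ∈ octReal r) (j : Fin r) :
    ∑ i, |g.1 i j| ≤ 1 := by
  have hg' : (fun x => g.1.mulVec x) '' octahedron r = octahedron r := hg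
  have h1 : Pi.single j 1 ∈ octahedron r := by
    change ∑ i, |(Pi.single j 1 : Fin r → ℝ) i| ≤ 1
    simp [Pi.single_apply, apply_ite]
  have h2 : g.1.mulVec (Pi.single j 1) ∈ octahedron r := hg' ▸ ⟨_, h1, rfl⟩
  rw [Matrix.mulVec_single_one] at h2
  exact h2

lemma mulVec_mem_octahedron {A : Matrix (Fin r) (Fin r) ℝ} (hA : ∀ j, ∑ i, |A i j| ≤ 1)
    {x : Fin r → ℝ} (hx : x ∈ octahedron r) : A.mulVec x ∈ octahedron r := by
  calc ∑ i, |∑ j, A i j * x j| ≤ ∑ i, ∑ j, |A i j| * |x j| := by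
        refine Finset.sum_le_sum fun i _ => (Finset.abs_sum_le_sum_abs _ _).trans ?_
        simp only [abs_mul, le_refl]
    _ = ∑ j, (∑ i, |A i j|) * |x j| := by
        rw [Finset.sum_comm]; simp only [Finset.sum_mul]
    _ ≤ ∑ j, |x j| :=
        Finset.sum_le_sum fun j _ => mul_le_of_le_one_left (abs_nonneg _) (hA j)
    _ ≤ 1 := hx

/-- Images of the vertices `±e_j` are columns, so preserving the octahedron bounds column sums of
`g` and `g⁻¹`, whereas operations of `A_N` are rows. Either kind of bound forces `g⁻¹ = gᵀ`, which
exchanges the two. -/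
lemma mem_octReal_iff {g : GL (Fin r) ℝ} : g ∈ octReal r ↔
    (∀ i, ∑ j, |g.1 i j| ≤ 1) ∧ ∀ i, ∑ j, |(g⁻¹).1 i j| ≤ 1 := by
  have hgg : g.1 * (g⁻¹).1 = 1 := g.mul_inv
  have hgg' : (g⁻¹).1 * g.1 = 1 := g.inv_mul
  constructor
  · intro hg
    have h1 := col_sum_le_of_mem_octReal hg
    have h2 := col_sum_le_of_mem_octReal (inv_mem hg)
    have h3 := eq_transpose_of_row_sum_le (P := g.1.transpose) (Q := (g⁻¹).1.transpose)
      (by rw [← Matrix.transpose_mul, hgg', Matrix.transpose_one])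
      (by rw [← Matrix.transpose_mul, hgg, Matrix.transpose_one]) h1 h2
    have h4 : ∀ i j, (g⁻¹).1 j i = g.1 i j := fun i j => congrFun (congrFun h3 i) j
    refine ⟨fun i => ?_, fun i => ?_⟩
    · simp only [← h4]
      exact h2 i
    · simp only [h4]
      exact h1 i
  · rintro ⟨h1, h2⟩
    have h3 := eq_transpose_of_row_sum_le hgg hgg' h1 h2
    have h4 : ∀ i j, (g⁻¹).1 i j = g.1 j i := fun i j => congrFun (congrFun h3 i) j
    change (fun x => g.1.mulVec x) '' octahedron r = octahedron r
    refine Set.Subset.antisymm ?_ fun x hx => ⟨(g⁻¹).1.mulVec x, ?_, ?_⟩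
    · rintro _ ⟨x, hx, rfl⟩
      exact mulVec_mem_octahedron (fun j => by simp only [← h4]; exact h2 j) hx
    · exact mulVec_mem_octahedron (fun j => by simp only [h4]; exact h1 j) hx
    · simp only [Matrix.mulVec_mulVec, hgg, Matrix.one_mulVec]

lemma mem_Oct_iff {N : ℕ} {g : GL (Fin r) (ZInv N)} : g ∈ Oct N r ↔
    (∀ i, ∑ j, |g.1 i j| ≤ 1) ∧ ∀ i, ∑ j, |(g⁻¹).1 i j| ≤ 1 := by
  have key : ∀ (h : GL (Fin r) (ZInv N)) (i : Fin r),
      ∑ j, |(Matrix.GeneralLinearGroup.map (ZInv.toReal N) h).1 i j| ≤ 1 ↔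
        ∑ j, |h.1 i j| ≤ 1 := by
    intro h i
    have h1 : ∑ j, |(Matrix.GeneralLinearGroup.map (ZInv.toReal N) h).1 i j| =
        (((∑ j, |h.1 i j| : ZInv N) : ℚ) : ℝ) := by
      push_cast
      exact Finset.sum_congr rfl fun j _ => (Rat.cast_abs _).symm
    rw [h1]
    exact_mod_cast Iff.rfl
  change Matrix.GeneralLinearGroup.map (ZInv.toReal N) g ∈ octReal r ↔ _
  rw [mem_octReal_iff, ← map_inv]
  exact and_congr (forall_congr' (key g)) (forall_congr' (key g⁻¹))

end Octahedron

/-! ### Transition matrices -/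

namespace SpecZHat

open GenRing PrimeSpec OModule

variable {N r : ℕ} {E F : OModule (SpecZHat N)}

/-! ### Matrices of sections over `ℤ[N⁻¹]` -/

section Matrix

variable {U : Opens (SpecZHat N).carrier} (hU : gen N ∈ U)

/-- Operations are row vectors and substitution multiplies them on the right; this fixes the order
of the factors in all base changes. -/
lemma val_subst_matrix {c : ((SpecZHat N).O U).op r} {d : Fin r → ((SpecZHat N).O U).op r}
    {v : Fin r → ZInv N} {B : Matrix (Fin r) (Fin r) (ZInv N)}
    (hc : val hU c = fun j => (v j : ℚ)) (hd : ∀ i, val hU (d i) = fun j => (B i j : ℚ)) :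
    val hU (((SpecZHat N).O U).subst c d) = fun k => ((Matrix.vecMul v B k : ZInv N) : ℚ) := by
  rw [val_subst, hc]
  funext k
  rw [Finset.sum_apply]
  simp only [hd, Pi.smul_apply, smul_eq_mul, Matrix.vecMul, dotProduct]
  push_cast
  rfl

lemma subst_eq_var_iff {c d : Fin r → ((SpecZHat N).O U).op r}
    {A B : Matrix (Fin r) (Fin r) (ZInv N)} (hc : ∀ i, val hU (c i) = fun j => (A i j : ℚ))
    (hd : ∀ i, val hU (d i) = fun j => (B i j : ℚ)) :
    (∀ i, ((SpecZHat N).O U).subst (c i) d = ((SpecZHat N).O U).var i) ↔ A * B = 1 := by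
  have h1 : ∀ i, val hU (((SpecZHat N).O U).subst (c i) d) = fun k => ((A * B) i k : ℚ) :=
    fun i => val_subst_matrix hU (hc i) hd
  have h2 : ∀ i, val hU (((SpecZHat N).O U).var i) =
      fun k => ((1 : Matrix (Fin r) (Fin r) (ZInv N)) i k : ℚ) := fun i => by
    rw [val_var]
    funext k
    by_cases h : i = k
    · subst h
      simp
    · rw [Matrix.one_apply_ne h, Pi.single_eq_of_ne' h]
      rfl
  constructor
  · intro h
    ext i k
    have := congrArg (val hU) (h i)
    rw [h1, h2] at this
    exact congrFun this k
  · intro h i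
    apply val_injective hU
    rw [h1, h2, h]

end Matrix

lemma describes_iff (hN : 1 < N) {A : Matrix (Fin r) (Fin r) (ZInv N)} :
    Describes A E ↔ ∃ (e : Fin r → E.obj (chartA hN)) (f : Fin r → E.obj (chartZ hN))
      (c : Fin r → ((SpecZHat N).O (chartA hN ⊓ chartZ hN)).op r),
      IsBasis E (chartA hN) e ∧ IsBasis E (chartZ hN) f ∧
      (∀ i, val (gen_mem_inf (gen_mem_chartA hN) (gen_mem_chartZ hN)) (c i) =
        fun j => (A i j : ℚ)) ∧
      ∀ i, E.res inf_le_left (e i) =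
        (E.str (chartA hN ⊓ chartZ hN)).act (c i) (fun j => E.res inf_le_right (f j)) := by
  constructor
  · rintro ⟨U, V, hU, hV, e, f, h⟩
    obtain rfl : U = chartA hN := Opens.ext hU
    obtain rfl : V = chartZ hN := Opens.ext hV
    choose c hc hef using h
    exact ⟨e.basis, f.basis, c, e.isBasis, f.isBasis,
      fun i => (pullsBackTo_iff _ (c i) (A i)).1 (hc i), hef⟩
  · rintro ⟨e, f, c, he, hf, hc, hef⟩
    refine ⟨chartA hN, chartZ hN, rfl, rfl, he.trivialization, hf.trivialization, fun i =>
      ⟨c i, (pullsBackTo_iff (gen_mem_inf (gen_mem_chartA hN) (gen_mem_chartZ hN)) _ _).2 (hc i),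
        ?_⟩⟩
    rw [he.basis_trivialization, hf.basis_trivialization]
    exact hef i

lemma exists_describes (hN : 1 < N) (hE : E.IsVectorBundle r) :
    ∃ A : GL (Fin r) (ZInv N), Describes A.1 E := by
  obtain ⟨e, he⟩ := exists_isBasis_chartA hN hE
  obtain ⟨f, hf⟩ := exists_isBasis_chartZ hN hE
  have hg := gen_mem_inf (gen_mem_chartA hN) (gen_mem_chartZ hN)
  have he' := he.restrict (V := chartA hN ⊓ chartZ hN) inf_le_left
  have hf' := hf.restrict (V := chartA hN ⊓ chartZ hN) inf_le_right
  choose A hA using fun i => val_ZInv hg hN le_rfl (hf'.coord le_rfl (E.res inf_le_left (e i)))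
  choose B hB using fun i => val_ZInv hg hN le_rfl (he'.coord le_rfl (E.res inf_le_right (f i)))
  have h1 := (subst_eq_var_iff hg (A := A) (B := B) (fun i => funext (hA i))
    (fun i => funext (hB i))).1 (hf'.coord_subst_coord he')
  have h2 := (subst_eq_var_iff hg (A := B) (B := A) (fun i => funext (hB i))
    (fun i => funext (hA i))).1 (he'.coord_subst_coord hf')
  refine ⟨⟨A, B, h1, h2⟩, (describes_iff hN).2 ⟨e, f, _, he, hf, fun i => funext (hA i),
    fun i => ?_⟩⟩
  have := hf'.act_coord le_rfl (E.res inf_le_left (e i))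
  simp only [E.res_self] at this
  exact this.symm

lemma exists_bundle (hN : 1 < N) (A : GL (Fin r) (ZInv N)) :
    ∃ E : GenVectorBundle (SpecZHat N) r, Describes A.1 E.1 := by
  have hg := gen_mem_inf (gen_mem_chartA hN) (gen_mem_chartZ hN)
  choose c hc using fun i => exists_val_eq_ZInv hg hN le_rfl (A.1 i)
  choose d hd using fun i => exists_val_eq_ZInv hg hN le_rfl ((A⁻¹).1 i)
  obtain ⟨e, f, he, hf, hef⟩ := exists_glued c ((subst_eq_var_iff hg hc hd).2 A.mul_inv)
    ((subst_eq_var_iff hg hd hc).2 A.inv_mul)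
  refine ⟨⟨glued c, fun x => ?_⟩, (describes_iff hN).2 ⟨e, f, c, he, hf, hc, hef⟩⟩
  have hx : x ∈ chartA hN ⊔ chartZ hN := by
    rw [chartA_sup_chartZ]
    trivial
  obtain hx | hx := hx
  · exact ⟨_, hx, ⟨he.trivialization⟩⟩
  · exact ⟨_, hx, ⟨hf.trivialization⟩⟩

lemma isIsoTo_of_describes (hN : 1 < N) {A : Matrix (Fin r) (Fin r) (ZInv N)}
    (hE : Describes A E) (hF : Describes A F) : IsIsoTo E F := by
  obtain ⟨e, f, c, he, hf, hc, hef⟩ := (describes_iff hN).1 hE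
  obtain ⟨e', f', c', he', hf', hc', hef'⟩ := (describes_iff hN).1 hF
  obtain rfl : c = c' := funext fun i => val_injective _ ((hc i).trans (hc' i).symm)
  exact isIsoTo_of_isBasis (chartA_sup_chartZ hN) he hf he' hf' c hef hef'

lemma describes_of_isIsoTo (hN : 1 < N) {A : Matrix (Fin r) (Fin r) (ZInv N)}
    (hE : Describes A E) (h : IsIsoTo E F) : Describes A F := by
  obtain ⟨e, f, c, he, hf, hc, hef⟩ := (describes_iff hN).1 hE
  obtain ⟨φ, ψ, h1, h2⟩ := h
  refine (describes_iff hN).2 ⟨_, _, c, he.map h1 h2, hf.map h1 h2, hc, fun i => ?_⟩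
  rw [← φ.naturality, hef, φ.map_act]
  simp only [φ.naturality]

lemma isVectorBundle_of_isIsoTo (hE : E.IsVectorBundle r) (h : IsIsoTo E F) :
    F.IsVectorBundle r := by
  obtain ⟨φ, ψ, h1, h2⟩ := h
  intro x
  obtain ⟨U, hx, ⟨τ⟩⟩ := hE x
  exact ⟨U, hx, ⟨(τ.isBasis.map h1 h2).trivialization⟩⟩

/-- The new bases are `e' = P e` and `f' = Q⁻¹ f`, for then `e' = P A f = P A Q f'`. The row bounds
on `P` and `P⁻¹` say that their rows are operations of `A_N`. -/
lemma describes_mul (hN : 1 < N) {A P Q : GL (Fin r) (ZInv N)} (hP : P ∈ Oct N r)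
    (hQ : Q ∈ GLZ N r) (h : Describes A.1 E) : Describes (P * A * Q).1 E := by
  obtain ⟨e, f, c, he, hf, hc, hef⟩ := (describes_iff hN).1 h
  have hgA := gen_mem_chartA hN
  have hgZ := gen_mem_chartZ hN
  have hg := gen_mem_inf hgA hgZ
  obtain ⟨hP1, hP2⟩ := mem_Oct_iff.1 hP
  obtain ⟨Z, rfl⟩ := hQ
  set Q := Matrix.GeneralLinearGroup.map (algebraMap ℤ (ZInv N)) Z with hQ
  choose p hp using fun i => exists_val_eq_AN hgA hN le_rfl ⟨P.1 i, hP1 i⟩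
  choose p' hp' using fun i => exists_val_eq_AN hgA hN le_rfl ⟨(P⁻¹).1 i, hP2 i⟩
  have hZ : ∀ z : GL (Fin r) ℤ, ∃ q : Fin r → ((SpecZHat N).O (chartZ hN)).op r, ∀ i,
      val hgZ (q i) = fun j => (((Matrix.GeneralLinearGroup.map (algebraMap ℤ (ZInv N)) z).1 i j :
        ZInv N) : ℚ) := by
    intro z
    choose q hq using fun i => exists_val_eq_int hgZ hN le_rfl (z.1 i)
    refine ⟨q, fun i => (hq i).trans (funext fun j => ?_)⟩
    simp
  obtain ⟨q, hq⟩ := hZ Z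
  obtain ⟨q', hq'⟩ := hZ Z⁻¹
  rw [map_inv, ← hQ] at hq'
  rw [← hQ] at hq
  have hqq : ∀ i, ((SpecZHat N).O (chartZ hN)).subst (q i) q' = ((SpecZHat N).O _).var i :=
    (subst_eq_var_iff hgZ hq hq').2 Q.mul_inv
  have he' := he.change ((subst_eq_var_iff hgA hp hp').2 P.mul_inv)
    ((subst_eq_var_iff hgA hp' hp).2 P.inv_mul)
  have hf' := hf.change ((subst_eq_var_iff hgZ hq' hq).2 Q.inv_mul) hqq
  have hff : ∀ j, (E.str _).act (q j) (fun i => (E.str _).act (q' i) f) = f j := fun j => by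
    rw [← (E.str _).act_assoc, hqq, (E.str _).var_act]
  refine (describes_iff hN).2 ⟨_, _, fun i => ((SpecZHat N).O _).subst
    (((SpecZHat N).O _).subst (((SpecZHat N).res inf_le_left).app (p i)) c)
    (fun j => ((SpecZHat N).res inf_le_right).app (q j)), he', hf', fun i => ?_, fun i => ?_⟩
  · exact val_subst_matrix hg (v := (P * A).1 i) (val_subst_matrix hg (v := P.1 i) (hp i) hc) hq
  · rw [E.res_act]
    simp only [hef, (E.str _).act_assoc]
    simp only [← E.res_act, hff]

/-- Here `P` and `Q` are the base changes `e' = P e` and `f = Q f'`. Their entries are controlled by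
the sections over each whole chart: rows in `A_N(𝐫)` for `P`, integers for `Q`. -/
lemma exists_eq_mul_of_describes (hN : 1 < N) {A A' : GL (Fin r) (ZInv N)}
    (h : Describes A.1 E) (h' : Describes A'.1 E) :
    ∃ P ∈ Oct N r, ∃ Q ∈ GLZ N r, A' = P * A * Q := by
  obtain ⟨e, f, c, he, hf, hc, hef⟩ := (describes_iff hN).1 h
  obtain ⟨e', f', c', he', hf', hc', hef'⟩ := (describes_iff hN).1 h'
  have hgA := gen_mem_chartA hN
  have hgZ := gen_mem_chartZ hN
  have hg := gen_mem_inf hgA hgZ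
  choose p hp using fun i => val_chartA hgA hN le_rfl (he.coord le_rfl (e' i))
  choose p' hp' using fun i => val_chartA hgA hN le_rfl (he'.coord le_rfl (e i))
  choose q hq using fun i => val_chartZ hgZ hN le_rfl (hf'.coord le_rfl (f i))
  choose q' hq' using fun i => val_chartZ hgZ hN le_rfl (hf.coord le_rfl (f' i))
  have hpm : ∀ i, val hgA (he.coord le_rfl (e' i)) =
    fun j => (Matrix.of (fun i j => (p i).1 j) i j : ℚ) := fun i => funext (hp i)
  have hpm' : ∀ i, val hgA (he'.coord le_rfl (e i)) =
    fun j => (Matrix.of (fun i j => (p' i).1 j) i j : ℚ) := fun i => funext (hp' i)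
  have hqm : ∀ i, val hgZ (hf'.coord le_rfl (f i)) =
      fun j => ((Matrix.map (Matrix.of q) (algebraMap ℤ (ZInv N)) i j : ZInv N) : ℚ) :=
    fun i => funext fun j => by simp [hq]
  have hqm' : ∀ i, val hgZ (hf.coord le_rfl (f' i)) =
      fun j => ((Matrix.map (Matrix.of q') (algebraMap ℤ (ZInv N)) i j : ZInv N) : ℚ) :=
    fun i => funext fun j => by simp [hq']
  have hinj : Function.Injective (fun B : Matrix (Fin r) (Fin r) ℤ =>
      B.map (algebraMap ℤ (ZInv N))) :=
    Matrix.map_injective (algebraMap ℤ (ZInv N)).injective_int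
  -- The base changes over `Spec ℤ` are seen to be inverse over `ℤ[N⁻¹]`; injectivity of `ℤ →
  -- ℤ[N⁻¹]` brings this back to `ℤ`.
  have hZ : ∀ B B' : Matrix (Fin r) (Fin r) ℤ,
      B.map (algebraMap ℤ (ZInv N)) * B'.map (algebraMap ℤ (ZInv N)) = 1 → B * B' = 1 := by
    intro B B' hB
    apply hinj
    simp only
    rw [Matrix.map_mul, hB, Matrix.map_one _ (map_zero _) (map_one _)]
  let P : GL (Fin r) (ZInv N) := ⟨Matrix.of fun i j => (p i).1 j, Matrix.of fun i j => (p' i).1 j,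
    (subst_eq_var_iff hgA hpm hpm').1 (he.coord_subst_coord he'),
    (subst_eq_var_iff hgA hpm' hpm).1 (he'.coord_subst_coord he)⟩
  let Z : GL (Fin r) ℤ := ⟨Matrix.of q, Matrix.of q',
    hZ _ _ ((subst_eq_var_iff hgZ hqm hqm').1 (hf'.coord_subst_coord hf)),
    hZ _ _ ((subst_eq_var_iff hgZ hqm' hqm).1 (hf.coord_subst_coord hf'))⟩
  refine ⟨P, mem_Oct_iff.2 ⟨fun i => (p i).2, fun i => (p' i).2⟩,
    Matrix.GeneralLinearGroup.map (algebraMap ℤ (ZInv N)) Z, ⟨Z, rfl⟩, Units.ext ?_⟩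
  -- Both sides are the coordinates of `e' i` in the basis `f'` over the intersection: `e' = P e = P
  -- c f = P c Q f'`.
  have h1 : ∀ i, c' i = ((SpecZHat N).O _).subst
      (((SpecZHat N).O _).subst (((SpecZHat N).res inf_le_left).app (he.coord le_rfl (e' i))) c)
      (fun j => ((SpecZHat N).res inf_le_right).app (hf'.coord le_rfl (f j))) := by
    intro i
    apply (hf' _ inf_le_right).1
    simp only
    rw [← hef', (E.str _).act_assoc, (E.str _).act_assoc]
    have h2 : ∀ j, (E.str _).act (((SpecZHat N).res inf_le_right).app (hf'.coord le_rfl (f j)))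
        (fun i => E.res (inf_le_right : chartA hN ⊓ chartZ hN ≤ _) (f' i)) =
          E.res inf_le_right (f j) := fun j => by
      conv_rhs => rw [← hf'.act_coord le_rfl (f j)]
      simp only [E.res_act, E.res_res]
    simp only [h2, ← hef]
    conv_lhs => rw [← he.act_coord le_rfl (e' i)]
    simp only [E.res_act, E.res_res]
  ext i k
  have h3 := hc' i
  rw [h1, val_subst_matrix hg (v := (P * A).1 i)
    (val_subst_matrix hg (v := P.1 i) (hpm i) hc) hqm] at h3
  exact (congrFun h3 k).symm

end SpecZHat

/-! ### Tensor products of line bundles -/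

namespace OModule

variable {X : GenRingedSpace} {E F G T T' : OModule X}

lemma Hom.ext_app {φ ψ : Hom E F} (h : ∀ U s, φ.app U s = ψ.app U s) : φ = ψ := by
  obtain ⟨a, _, _⟩ := φ
  obtain ⟨b, _, _⟩ := ψ
  obtain rfl : a = b := funext fun U => funext fun s => h U s
  rfl

/-- The composition of morphisms. -/
def Hom.comp (ψ : Hom F G) (φ : Hom E F) : Hom E G :=
  ⟨fun U s => ψ.app U (φ.app U s), fun h s => by rw [φ.naturality, ψ.naturality],
    fun U _ t x => by rw [φ.map_act, ψ.map_act]⟩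

/-- The identity morphism. -/
def Hom.id (E : OModule X) : Hom E E := ⟨fun _ s => s, fun _ _ => rfl, fun _ _ _ _ => rfl⟩

/-- Tensor products are unique up to isomorphism. -/
lemma IsTensorProduct.isIsoTo (h : IsTensorProduct E F T) (h' : IsTensorProduct E F T') :
    IsIsoTo T T' := by
  obtain ⟨β, hβ⟩ := h
  obtain ⟨β', hβ'⟩ := h'
  obtain ⟨φ, hφ, -⟩ := hβ T' β'
  obtain ⟨ψ, hψ, -⟩ := hβ' T β
  have h1 : ψ.comp φ = Hom.id T := (hβ T β).unique
    (fun U x y => by simp only [Hom.comp, hφ, hψ]) (fun U x y => rfl)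
  have h2 : φ.comp ψ = Hom.id T' := (hβ' T' β').unique
    (fun U x y => by simp only [Hom.comp, hφ, hψ]) (fun U x y => rfl)
  exact ⟨φ, ψ, fun U s => congrArg (fun f => f.app U s) h1,
    fun U s => congrArg (fun f => f.app U s) h2⟩

/-- A module with the product transition function is a tensor product of two line bundles. -/
lemma isTensorProduct_of_isBasis {U V : Opens X.carrier} (hUV : U ⊔ V = ⊤)
    {e : Fin 1 → E.obj U} {f : Fin 1 → E.obj V} {e' : Fin 1 → F.obj U} {f' : Fin 1 → F.obj V}
    {e'' : Fin 1 → T.obj U} {f'' : Fin 1 → T.obj V}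
    (he : IsBasis E U e) (hf : IsBasis E V f) (he' : IsBasis F U e') (hf' : IsBasis F V f')
    (he'' : IsBasis T U e'') (hf'' : IsBasis T V f'') (c c' : (X.O (U ⊓ V)).op 1)
    (hc : ∀ i, E.res inf_le_left (e i) =
      (E.str (U ⊓ V)).act c (fun j => E.res inf_le_right (f j)))
    (hc' : ∀ i, F.res inf_le_left (e' i) =
      (F.str (U ⊓ V)).act c' (fun j => F.res inf_le_right (f' j)))
    (hc'' : ∀ i, T.res inf_le_left (e'' i) =
      (T.str (U ⊓ V)).act (c * c') (fun j => T.res inf_le_right (f'' j))) :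
    IsTensorProduct E F T := by
  have act_mul : ∀ (G : OModule X) {W : Opens X.carrier} (a b : (X.O W).op 1)
      (x : Fin 1 → G.obj W),
      (G.str W).act (a * b) x = (G.str W).act a (fun _ => (G.str W).act b x) :=
    fun G W a b x => (G.str W).act_assoc a (fun _ => b) x
  have trans : ∀ {G : OModule X} {g : Fin 1 → G.obj U} {g' : Fin 1 → G.obj V}
      {b : (X.O (U ⊓ V)).op 1} (_ : ∀ i, G.res inf_le_left (g i) =
        (G.str (U ⊓ V)).act b (fun j => G.res inf_le_right (g' j)))
      {W : Opens X.carrier} (h₁ : W ≤ U) (h₂ : W ≤ V) (i : Fin 1),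
      G.res h₁ (g i) = (G.str W).act ((X.res (le_inf h₁ h₂)).app b)
        (fun j => G.res h₂ (g' j)) := by
    intro G g g' b hb W h₁ h₂ i
    rw [← G.res_res (le_inf h₁ h₂) inf_le_left, hb, G.res_act]
    simp only [G.res_res]
  have coord_trans : ∀ {G : OModule X} {g : Fin 1 → G.obj U} {g' : Fin 1 → G.obj V}
      (hg : IsBasis G U g) (hg' : IsBasis G V g')
      {b : (X.O (U ⊓ V)).op 1} (_ : ∀ i, G.res inf_le_left (g i) =
        (G.str (U ⊓ V)).act b (fun j => G.res inf_le_right (g' j)))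
      {W : Opens X.carrier} (h₁ : W ≤ U) (h₂ : W ≤ V) (x : G.obj W),
      hg'.coord h₂ x = hg.coord h₁ x * (X.res (le_inf h₁ h₂)).app b := by
    intro G g g' hg hg' b hb W h₁ h₂ x
    apply hg'.coord_eq
    rw [act_mul]
    conv_rhs => rw [← hg.act_coord h₁ x]
    congr 1
    funext i
    exact (trans hb h₁ h₂ i).symm
  have nat : ∀ {U : Opens X.carrier} {e : Fin 1 → E.obj U} {e' : Fin 1 → F.obj U}
      (he : IsBasis E U e) (he' : IsBasis F U e') (e'' : Fin 1 → T.obj U)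
      {W W' : Opens X.carrier} (h : W ≤ W') (hW : W' ≤ U) (x : E.obj W' × F.obj W'),
      (T.str W).act (he.coord (h.trans hW) (E.res h x.1) * he'.coord (h.trans hW) (F.res h x.2))
        (fun i => T.res (h.trans hW) (e'' i)) =
      T.res h ((T.str W').act (he.coord hW x.1 * he'.coord hW x.2)
        (fun i => T.res hW (e'' i))) := by
    intro U e e' he he' e'' W W' h hW x
    rw [he.coord_res h hW, he'.coord_res h hW, ← (X.res h).map_mul]
    simp only [T.res_act, T.res_res]
  -- On each chart `β(x e, y e') = (x y) e''`. The transition factors of `x` and `y` multiply to `c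
  -- * c'`, which is the transition function of `T`.
  obtain ⟨β, hβ, hβ₁, hβ₂⟩ := exists_glue_map (F := T) hUV (fun W => E.obj W × F.obj W)
    (fun h x => (E.res h x.1, F.res h x.2)) (fun h k s => by simp only [E.res_res, F.res_res])
    (fun W h x => (T.str W).act (he.coord h x.1 * he'.coord h x.2) (fun i => T.res h (e'' i)))
    (nat he he' e'')
    (fun W h x => (T.str W).act (hf.coord h x.1 * hf'.coord h x.2) (fun i => T.res h (f'' i)))
    (nat hf hf' f'') (by
      intro W h₁ h₂ x
      rw [coord_trans he hf hc h₁ h₂, coord_trans he' hf' hc' h₁ h₂, mul_mul_mul_comm,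
        ← (X.res _).map_mul, act_mul T (_ * _)]
      congr 1
      exact funext fun i => trans hc'' h₁ h₂ i)
  have act_left : ∀ {U W : Opens X.carrier} {e : Fin 1 → E.obj U} {e' : Fin 1 → F.obj U}
      (he : IsBasis E U e) (he' : IsBasis F U e') (e'' : Fin 1 → T.obj U) (hW : W ≤ U)
      (_ : ∀ x, β W x = (T.str W).act (he.coord hW x.1 * he'.coord hW x.2)
        (fun i => T.res hW (e'' i))) {n : ℕ} (a : (X.O W).op n) (x : Fin n → E.obj W)
      (y : F.obj W), β W ((E.str W).act a x, y) = (T.str W).act a (fun i => β W (x i, y)) := by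
    intro U W e e' he he' e'' hW hβW n a x y
    have h1 : (X.O W).subst a (fun i => he.coord hW (x i)) * he'.coord hW y =
        (X.O W).subst a (fun i => he.coord hW (x i) * he'.coord hW y) :=
      (X.O W).subst_assoc a _ _
    simp only [hβW, he.coord_act, h1, (T.str W).act_assoc]
  have act_right : ∀ {U W : Opens X.carrier} {e : Fin 1 → E.obj U} {e' : Fin 1 → F.obj U}
      (he : IsBasis E U e) (he' : IsBasis F U e') (e'' : Fin 1 → T.obj U) (hW : W ≤ U)
      (_ : ∀ x, β W x = (T.str W).act (he.coord hW x.1 * he'.coord hW x.2)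
        (fun i => T.res hW (e'' i))) {n : ℕ} (a : (X.O W).op n) (x : E.obj W)
      (y : Fin n → F.obj W), β W (x, (F.str W).act a y) =
        (T.str W).act a (fun i => β W (x, y i)) := by
    intro U W e e' he he' e'' hW hβW n a x y
    have h1 : he.coord hW x * (X.O W).subst a (fun i => he'.coord hW (y i)) =
        (X.O W).subst a (fun i => he.coord hW x * he'.coord hW (y i)) :=
      GenRing.scale_subst_right _ a _
    simp only [hβW, he'.coord_act, h1, (T.str W).act_assoc]
  have hβ' : ∀ {W W' : Opens X.carrier} (h : W ≤ W') (x : E.obj W') (y : F.obj W'),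
      β W (E.res h x, F.res h y) = T.res h (β W' (x, y)) := fun h x y => hβ h (x, y)
  have coord_self : ∀ {G : OModule X} {U : Opens X.carrier} {g : Fin 1 → G.obj U}
      (hg : IsBasis G U g) (i : Fin 1), hg.coord le_rfl (g i) = 1 := by
    intro G U g hg i
    apply hg.coord_eq
    rw [Subsingleton.elim i 0, ← G.res_self (g 0)]
    exact (G.str U).var_act 0 _
  have act_one : ∀ {G : OModule X} {U : Opens X.carrier} (g : Fin 1 → G.obj U) (i : Fin 1),
      (G.str U).act (1 * 1) (fun i => G.res le_rfl (g i)) = g i := by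
    intro G U g i
    rw [one_mul, Subsingleton.elim i 0]
    exact ((G.str U).var_act 0 _).trans (G.res_self _)
  refine ⟨⟨fun W x y => β W (x, y), hβ', fun W n a x y => ext_of_sup_eq_top hUV ?_ ?_,
    fun W n a x y => ext_of_sup_eq_top hUV ?_ ?_⟩, fun G γ => ?_⟩
  · rw [← hβ', E.res_act, act_left he he' e'' inf_le_right (hβ₁ _ _), T.res_act]
    simp only [hβ']
  · rw [← hβ', E.res_act, act_left hf hf' f'' inf_le_right (hβ₂ _ _), T.res_act]
    simp only [hβ']
  · rw [← hβ', F.res_act, act_right he he' e'' inf_le_right (hβ₁ _ _), T.res_act]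
    simp only [hβ']
  · rw [← hβ', F.res_act, act_right hf hf' f'' inf_le_right (hβ₂ _ _), T.res_act]
    simp only [hβ']
  -- In rank one a bilinear map is determined by its value on the pair of basis elements.
  · have hγ : ∀ {W : Opens X.carrier} (a b : (X.O W).op 1) (x : Fin 1 → E.obj W)
        (y : Fin 1 → F.obj W), γ.app W ((E.str W).act a x) ((F.str W).act b y) =
          (G.str W).act (a * b) (fun i => γ.app W (x i) (y i)) := by
      intro W a b x y
      rw [γ.map_act_left, act_mul]
      congr 1
      funext i
      rw [γ.map_act_right]
      congr 1
      funext k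
      rw [Subsingleton.elim i k]
    obtain ⟨φ, hφ₁, hφ₂⟩ := exists_hom_of_isBasis hUV he'' hf''
      (fun i => γ.app U (e i) (e' i)) (fun i => γ.app V (f i) (f' i)) (fun _ => c * c') hc'' (by
        intro i
        rw [← γ.naturality, hc, hc', hγ]
        simp only [γ.naturality])
    have comp : ∀ {U W : Opens X.carrier} {e : Fin 1 → E.obj U} {e' : Fin 1 → F.obj U}
        {e'' : Fin 1 → T.obj U} (he : IsBasis E U e) (he' : IsBasis F U e') (hW : W ≤ U)
        (_ : ∀ x, β W x = (T.str W).act (he.coord hW x.1 * he'.coord hW x.2)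
          (fun i => T.res hW (e'' i))) (_ : ∀ i, φ.app U (e'' i) = γ.app U (e i) (e' i))
        (x : E.obj W) (y : F.obj W), φ.app W (β W (x, y)) = γ.app W x y := by
      intro U W e e' e'' he he' hW hβW hφ x y
      rw [hβW, φ.map_act]
      simp only [φ.naturality, hφ, ← γ.naturality]
      rw [← hγ, he.act_coord, he'.act_coord]
    refine ⟨φ, fun W x y => ext_of_sup_eq_top hUV ?_ ?_, fun ψ hψ => Hom.ext_app
      (Hom.app_eq_of_isBasis hUV he'' hf'' (fun i => ?_) fun i => ?_)⟩
    · simp only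
      rw [← φ.naturality, ← hβ', ← γ.naturality, comp he he' inf_le_right (hβ₁ _ _) hφ₁]
    · simp only
      rw [← φ.naturality, ← hβ', ← γ.naturality, comp hf hf' inf_le_right (hβ₂ _ _) hφ₂]
    -- Uniqueness: `e'' = β(e, e')`, so the image of the basis element of `T` is prescribed by `γ`.
    · have h1 := hψ U (e i) (e' i)
      simp only at h1
      rw [hβ₁ U le_rfl, coord_self he, coord_self he', act_one e'' i] at h1
      rw [h1, hφ₁]
    · have h1 := hψ V (f i) (f' i)
      simp only at h1
      rw [hβ₂ V le_rfl, coord_self hf, coord_self hf', act_one f'' i] at h1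
      rw [h1, hφ₂]

end OModule

/-! ### Classification -/

/-- A surjection `mk` whose fibres are described by a relation defines a bijection. -/
lemma exists_equiv_of_relation {α : Type*} (s : Setoid α) {G κ : Type*} {mk : G → κ}
    (hmk : Function.Surjective mk) (D : G → α → Prop) (h₁ : ∀ a, ∃ g, D g a)
    (h₂ : ∀ {g g' a}, D g a → D g' a → mk g = mk g')
    (h₃ : ∀ {g g' a}, D g a → mk g = mk g' → D g' a) (h₄ : ∀ g, ∃ a, D g a)
    (h₅ : ∀ {g a a'}, D g a → D g a' → s a a') (h₆ : ∀ {g a a'}, D g a → s a a' → D g a') :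
    ∃ Φ : Quotient s ≃ κ, ∀ a g, Φ (Quotient.mk s a) = mk g ↔ D g a := by
  choose g hg using h₁
  have hbij : Function.Bijective (Quotient.lift (s := s) (fun a => mk (g a))
      fun a a' h => h₂ (h₆ (hg a) h) (hg a')) := by
    constructor
    · intro q q'
      induction q using Quotient.inductionOn with | h a => ?_
      induction q' using Quotient.inductionOn with | h a' => ?_
      intro h
      exact Quotient.sound (h₅ (h₃ (hg a) h) (hg a'))
    · intro k
      obtain ⟨x, rfl⟩ := hmk k
      obtain ⟨a, ha⟩ := h₄ x
      exact ⟨Quotient.mk s a, h₂ (hg a) ha⟩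
  exact ⟨Equiv.ofBijective _ hbij, fun a x => ⟨fun h => h₃ (hg a) h, fun h => h₂ (hg a) h⟩⟩

/-- Two surjections with the same fibres have isomorphic targets. -/
lemma exists_equiv_of_surjective {G κ κ' : Type*} {p : G → κ} {q : G → κ'}
    (hp : Function.Surjective p) (hq : Function.Surjective q)
    (h : ∀ a b, p a = p b ↔ q a = q b) : ∃ Λ : κ ≃ κ', ∀ g, Λ (p g) = q g := by
  have hs : ∀ g, q (Function.surjInv hp (p g)) = q g := fun g =>
    (h _ _).1 (Function.surjInv_eq hp (p g))
  refine ⟨Equiv.ofBijective (fun k => q (Function.surjInv hp k)) ⟨fun k k' hk => ?_, fun k => ?_⟩,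
    hs⟩
  · have := (h _ _).2 hk
    rwa [Function.surjInv_eq hp, Function.surjInv_eq hp] at this
  · obtain ⟨g, rfl⟩ := hq k
    exact ⟨p g, hs g⟩

namespace SpecZHat

open OModule

variable {N : ℕ}

lemma mk_surjective {G : Type*} [Group G] (H K : Subgroup G) :
    Function.Surjective (DoubleCoset.mk H K) := fun q =>
  Quotient.inductionOn' q fun g => ⟨g, rfl⟩

theorem exists_equiv_doubleCoset (hN : 1 < N) (r : ℕ) :
    ∃ Φ : GenVectorBundleClass (SpecZHat N) r ≃
        DoubleCoset.Quotient (Oct N r : Set (GL (Fin r) (ZInv N))) (GLZ N r),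
      ∀ (E : GenVectorBundle (SpecZHat N) r) (A : GL (Fin r) (ZInv N)),
        Φ E.cls = DoubleCoset.mk (Oct N r) (GLZ N r) A ↔ Describes A.1 E.1 := by
  refine exists_equiv_of_relation (GenVectorBundle.setoid (SpecZHat N) r)
    (mk_surjective (Oct N r) (GLZ N r))
    (fun (A : GL (Fin r) (ZInv N)) (E : GenVectorBundle (SpecZHat N) r) => Describes A.1 E.1)
    (fun E => exists_describes hN E.2) (fun {A A' E} h h' => ?_) (fun {A A' E} h h' => ?_)
    (fun A => exists_bundle hN A) (fun h h' => isIsoTo_of_describes hN h h')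
    (fun h h' => describes_of_isIsoTo hN h h')
  · exact (DoubleCoset.eq _ _ _ _).2 (exists_eq_mul_of_describes hN h h')
  · obtain ⟨P, hP, Q, hQ, rfl⟩ := (DoubleCoset.eq _ _ _ _).1 h'
    exact describes_mul hN hP hQ h

/-! ### Line bundles -/

/-- A unit as an invertible `1 × 1` matrix. -/
def unitMatrix {R : Type*} [CommRing R] (l : Rˣ) : GL (Fin 1) R :=
  ⟨Matrix.of fun _ _ => (l : R), Matrix.of fun _ _ => ((l⁻¹ : Rˣ) : R),
    by ext i j; fin_cases i; fin_cases j; simp [Matrix.mul_apply],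
    by ext i j; fin_cases i; fin_cases j; simp [Matrix.mul_apply]⟩

lemma unitMatrix_surjective {R : Type*} [CommRing R] :
    Function.Surjective (unitMatrix (R := R)) := fun A =>
  ⟨⟨A.1 0 0, (A⁻¹).1 0 0,
    by simpa [Matrix.mul_apply] using congrFun (congrFun A.mul_inv 0) 0,
    by simpa [Matrix.mul_apply] using congrFun (congrFun A.inv_mul 0) 0⟩,
    Units.ext (by ext i j; fin_cases i; fin_cases j; rfl)⟩

lemma unitMatrix_apply {R : Type*} [CommRing R] (l : Rˣ) : (unitMatrix l).1 0 0 = (l : R) := rfl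

lemma unitMatrix_mul {R : Type*} [CommRing R] (l l' : Rˣ) :
    unitMatrix (l * l') = unitMatrix l * unitMatrix l' :=
  Units.ext (by ext i j; fin_cases i; fin_cases j; simp [unitMatrix, Matrix.mul_apply])

lemma mem_Oct_one_iff {l : (ZInv N)ˣ} : unitMatrix l ∈ Oct N 1 ↔ |(l : ZInv N)| = 1 := by
  have h1 : |(l : ZInv N)| * |((l⁻¹ : (ZInv N)ˣ) : ZInv N)| = 1 := by
    rw [← abs_mul, Units.mul_inv, abs_one]
  have h2 : unitMatrix l ∈ Oct N 1 ↔
      |(l : ZInv N)| ≤ 1 ∧ |((l⁻¹ : (ZInv N)ˣ) : ZInv N)| ≤ 1 := by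
    rw [mem_Oct_iff]
    simp only [Fin.forall_fin_one, Fin.sum_univ_one]
    rfl
  rw [h2]
  constructor
  · rintro ⟨h3, h4⟩
    refine le_antisymm h3 ?_
    calc (1 : ZInv N) = |(l : ZInv N)| * |((l⁻¹ : (ZInv N)ˣ) : ZInv N)| := h1.symm
      _ ≤ |(l : ZInv N)| := mul_le_of_le_one_right (abs_nonneg _) h4
  · intro h
    rw [h, one_mul] at h1
    exact ⟨h.le, h1.le⟩

lemma abs_eq_one_of_mem_GLZ {l : (ZInv N)ˣ} (h : unitMatrix l ∈ GLZ N 1) :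
    |(l : ZInv N)| = 1 := by
  obtain ⟨Z, hZ⟩ := h
  obtain ⟨u, rfl⟩ := unitMatrix_surjective Z
  have h1 : (l : ZInv N) = algebraMap ℤ (ZInv N) u := by
    rw [← unitMatrix_apply l, ← hZ]
    rfl
  rw [h1]
  obtain rfl | rfl := Int.units_eq_one_or u <;> simp

/-- In rank one all elements of both groups have absolute value `1`, and `Oct` contains every such
unit, so double cosets are exactly the fibres of `l ↦ |l|`. -/
lemma mk_unitMatrix_eq_iff (l l' : (ZInv N)ˣ) :
    DoubleCoset.mk (Oct N 1) (GLZ N 1) (unitMatrix l) =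
      DoubleCoset.mk (Oct N 1) (GLZ N 1) (unitMatrix l') ↔ |(l : ZInv N)| = |(l' : ZInv N)| := by
  constructor
  · intro h
    obtain ⟨P, hP, Q, hQ, h⟩ := (DoubleCoset.eq _ _ _ _).1 h
    obtain ⟨p, rfl⟩ := unitMatrix_surjective P
    obtain ⟨q, rfl⟩ := unitMatrix_surjective Q
    rw [← unitMatrix_mul, ← unitMatrix_mul] at h
    have h1 := congrArg (fun A : GL (Fin 1) (ZInv N) => A.1 0 0) h
    simp only [unitMatrix_apply, Units.val_mul] at h1
    rw [h1, abs_mul, abs_mul, mem_Oct_one_iff.1 hP, abs_eq_one_of_mem_GLZ hQ, one_mul, mul_one]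
  · intro h
    -- The left factor `l' * l⁻¹` alone absorbs the difference.
    refine (DoubleCoset.eq _ _ _ _).2 ⟨unitMatrix (l' * l⁻¹), mem_Oct_one_iff.2 ?_, 1,
      one_mem _, ?_⟩
    · rw [Units.val_mul, abs_mul, ← h, ← abs_mul, Units.mul_inv, abs_one]
    · rw [mul_one, ← unitMatrix_mul, inv_mul_cancel_right]

lemma mem_pmOne_iff {l : (ZInv N)ˣ} : l ∈ pmOne N ↔ |(l : ZInv N)| = 1 := by
  constructor
  · rintro ⟨k, rfl⟩
    obtain h | h := Int.even_or_odd k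
    · simp [h.neg_one_zpow]
    · simp [h.neg_one_zpow]
  · intro h
    obtain h | h := eq_or_eq_neg_of_abs_eq h
    · rw [show l = 1 from Units.ext h]
      exact one_mem _
    · rw [show l = -1 from Units.ext h]
      exact Subgroup.mem_zpowers _

lemma mk_pmOne_eq_iff (l l' : (ZInv N)ˣ) :
    DoubleCoset.mk (pmOne N) (pmOne N) l = DoubleCoset.mk (pmOne N) (pmOne N) l' ↔
      |(l : ZInv N)| = |(l' : ZInv N)| := by
  constructor
  · intro h
    obtain ⟨p, hp, q, hq, rfl⟩ := (DoubleCoset.eq _ _ _ _).1 h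
    rw [Units.val_mul, Units.val_mul, abs_mul, abs_mul, mem_pmOne_iff.1 hp, mem_pmOne_iff.1 hq,
      one_mul, mul_one]
  · intro h
    refine (DoubleCoset.eq _ _ _ _).2 ⟨l' * l⁻¹, mem_pmOne_iff.2 ?_, 1, one_mem _, ?_⟩
    · rw [Units.val_mul, abs_mul, ← h, ← abs_mul, Units.mul_inv, abs_one]
    · rw [mul_one, inv_mul_cancel_right]

/-- The absolute value of a unit as an element of the group of positive units. -/
def absUnit (l : (ZInv N)ˣ) : Units.posSubgroup (ZInv N) :=
  ⟨⟨|(l : ZInv N)|, |((l⁻¹ : (ZInv N)ˣ) : ZInv N)|, by rw [← abs_mul, Units.mul_inv, abs_one],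
    by rw [← abs_mul, Units.inv_mul, abs_one]⟩, abs_pos.2 l.ne_zero⟩

lemma absUnit_mul (l l' : (ZInv N)ˣ) : absUnit (l * l') = absUnit l * absUnit l' :=
  Subtype.ext (Units.ext (abs_mul _ _))

lemma absUnit_eq_iff (l l' : (ZInv N)ˣ) :
    absUnit l = absUnit l' ↔ |(l : ZInv N)| = |(l' : ZInv N)| :=
  ⟨fun h => congrArg (fun u : Units.posSubgroup (ZInv N) => ((u : (ZInv N)ˣ) : ZInv N)) h,
    fun h => Subtype.ext (Units.ext h)⟩

lemma absUnit_surjective : Function.Surjective (absUnit (N := N)) := fun u =>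
  ⟨u.1, Subtype.ext (Units.ext (abs_of_pos u.2))⟩

/-- Units give the same class in either double coset space precisely when their absolute values
agree, so the rank-one classification transfers. -/
theorem exists_equiv_pic (hN : 1 < N) :
    ∃ Ψ : Pic (SpecZHat N) ≃ DoubleCoset.Quotient (pmOne N : Set (ZInv N)ˣ) (pmOne N),
      ∀ (L : GenVectorBundle (SpecZHat N) 1) (l : (ZInv N)ˣ),
        Ψ L.cls = DoubleCoset.mk (pmOne N) (pmOne N) l ↔
          Describes (Matrix.of fun _ _ : Fin 1 => (l : ZInv N)) L.1 := by
  obtain ⟨Φ, hΦ⟩ := exists_equiv_doubleCoset hN 1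
  obtain ⟨Λ, hΛ⟩ := exists_equiv_of_surjective
    ((mk_surjective (Oct N 1) (GLZ N 1)).comp unitMatrix_surjective)
    (mk_surjective (pmOne N) (pmOne N))
    (fun l l' => (mk_unitMatrix_eq_iff l l').trans (mk_pmOne_eq_iff l l').symm)
  refine ⟨Φ.trans Λ, fun L l => ?_⟩
  rw [← hΛ l, Equiv.trans_apply, Λ.injective.eq_iff]
  exact hΦ L (unitMatrix l)

/-- The tensor product of line bundles corresponds to the product of units. -/
lemma exists_tensorProduct (hN : 1 < N) {L L' : OModule (SpecZHat N)} {l l' : (ZInv N)ˣ}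
    (h : Describes (Matrix.of fun _ _ : Fin 1 => (l : ZInv N)) L)
    (h' : Describes (Matrix.of fun _ _ : Fin 1 => (l' : ZInv N)) L') :
    ∃ T : GenVectorBundle (SpecZHat N) 1, IsTensorProduct L L' T.1 ∧
      Describes (Matrix.of fun _ _ : Fin 1 => ((l * l' : (ZInv N)ˣ) : ZInv N)) T.1 := by
  obtain ⟨T, hT⟩ := exists_bundle hN (unitMatrix (l * l'))
  refine ⟨T, ?_, hT⟩
  have hg := gen_mem_inf (gen_mem_chartA hN) (gen_mem_chartZ hN)
  obtain ⟨e, f, c, he, hf, hc, hef⟩ := (describes_iff hN).1 h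
  obtain ⟨e', f', c', he', hf', hc', hef'⟩ := (describes_iff hN).1 h'
  obtain ⟨e'', f'', c'', he'', hf'', hc'', hef''⟩ := (describes_iff hN).1 hT
  -- Both sections have generic value `l * l'`, and values determine sections.
  have hcc : ∀ i, c'' i = c 0 * c' 0 := fun i => by
    apply val_injective hg
    rw [hc'']
    refine Eq.trans ?_ (val_subst hg (c 0) fun _ => c' 0).symm
    funext k
    rw [Fin.sum_univ_one, hc, hc']
    rfl
  refine isTensorProduct_of_isBasis (chartA_sup_chartZ hN) he hf he' hf' he'' hf'' (c 0) (c' 0)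
    (fun i => ?_) (fun i => ?_) fun i => ?_
  · rw [hef, Subsingleton.elim i 0]
  · rw [hef', Subsingleton.elim i 0]
  · rw [hef'', hcc]

end SpecZHat

end

theorem proposition3p5 (N : ℕ) (hN : 1 < N) :
    (∀ r : ℕ, ∃ Φ : GenVectorBundleClass (SpecZHat N) r ≃
        DoubleCoset.Quotient (Oct N r : Set (GL (Fin r) (ZInv N))) (GLZ N r),
      ∀ (E : GenVectorBundle (SpecZHat N) r) (A : GL (Fin r) (ZInv N)),
        Φ E.cls = DoubleCoset.mk (Oct N r) (GLZ N r) A ↔ Describes A.1 E.1) ∧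
    ∃ _ : AddCommGroup (Pic (SpecZHat N)),
      (∀ L L' : GenVectorBundle (SpecZHat N) 1, ∃ T, OModule.IsTensorProduct L.1 L'.1 T) ∧
      (∀ (L L' : GenVectorBundle (SpecZHat N) 1) (T : OModule (SpecZHat N)),
        OModule.IsTensorProduct L.1 L'.1 T →
          ∃ hT : T.IsVectorBundle 1, GenVectorBundle.cls ⟨T, hT⟩ = L.cls + L'.cls) ∧
      ∃ (Ψ : Pic (SpecZHat N) ≃
            DoubleCoset.Quotient (pmOne N : Set (ZInv N)ˣ) (pmOne N))
        (Λ : DoubleCoset.Quotient (pmOne N : Set (ZInv N)ˣ) (pmOne N) ≃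
            Additive (Units.posSubgroup (ZInv N))),
        (∀ (L : GenVectorBundle (SpecZHat N) 1) (l : (ZInv N)ˣ),
          Ψ L.cls = DoubleCoset.mk (pmOne N) (pmOne N) l ↔
            Describes (Matrix.of fun _ _ : Fin 1 => (l : ZInv N)) L.1) ∧
        (∀ l : (ZInv N)ˣ, (((Λ (DoubleCoset.mk (pmOne N) (pmOne N) l)).toMul :
          (ZInv N)ˣ) : ZInv N) = |(l : ZInv N)|) ∧
        ∀ a b : Pic (SpecZHat N), Λ (Ψ (a + b)) = Λ (Ψ a) + Λ (Ψ b) := by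
  refine ⟨SpecZHat.exists_equiv_doubleCoset hN, ?_⟩
  obtain ⟨Ψ, hΨ⟩ := SpecZHat.exists_equiv_pic hN
  obtain ⟨Λ, hΛ⟩ := exists_equiv_of_surjective (SpecZHat.mk_surjective (pmOne N) (pmOne N))
    (Additive.ofMul.surjective.comp (SpecZHat.absUnit_surjective (N := N)))
    (fun l l' => (SpecZHat.mk_pmOne_eq_iff l l').trans
      ((SpecZHat.absUnit_eq_iff l l').symm.trans Additive.ofMul.injective.eq_iff.symm))
  -- The group law is transported from the positive units. That it is given by the tensor product is
  -- a separate claim, verified below on transition units.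
  let G : AddCommGroup (Pic (SpecZHat N)) := (Ψ.trans Λ).addCommGroup
  have hadd : ∀ a b : Pic (SpecZHat N), Λ (Ψ (a + b)) = Λ (Ψ a) + Λ (Ψ b) :=
    fun a b => (Ψ.trans Λ).apply_symm_apply _
  have hdesc : ∀ L : GenVectorBundle (SpecZHat N) 1, ∃ l : (ZInv N)ˣ,
      Describes (Matrix.of fun _ _ : Fin 1 => (l : ZInv N)) L.1 := fun L => by
    obtain ⟨l, hl⟩ := SpecZHat.mk_surjective (pmOne N) (pmOne N) (Ψ L.cls)
    exact ⟨l, (hΨ L l).1 hl.symm⟩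
  refine ⟨G, fun L L' => ?_, fun L L' T hT => ?_, Ψ, Λ, hΨ, fun l => ?_, hadd⟩
  · obtain ⟨l, hl⟩ := hdesc L
    obtain ⟨l', hl'⟩ := hdesc L'
    obtain ⟨T, hT, -⟩ := SpecZHat.exists_tensorProduct hN hl hl'
    exact ⟨T.1, hT⟩
  · obtain ⟨l, hl⟩ := hdesc L
    obtain ⟨l', hl'⟩ := hdesc L'
    obtain ⟨T', hT', hl''⟩ := SpecZHat.exists_tensorProduct hN hl hl'
    -- An arbitrary tensor product is isomorphic to the constructed one, so it is a line bundle
    -- described by `l * l'`.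
    have hiso := hT'.isIsoTo hT
    refine ⟨SpecZHat.isVectorBundle_of_isIsoTo T'.2 hiso, (Ψ.trans Λ).injective ?_⟩
    change Λ (Ψ _) = Λ (Ψ _)
    rw [hadd, (hΨ L l).2 hl, (hΨ L' l').2 hl', (hΨ ⟨T, _⟩ (l * l')).2
      (SpecZHat.describes_of_isIsoTo hN hl'' hiso), hΛ, hΛ, hΛ]
    simp only [Function.comp, SpecZHat.absUnit_mul]
    rfl
  · rw [hΛ]
    rfl
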